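/- Let $\mathcal E$ be a finite set and consider the star graph with one vertex and edges $e\in\mathcal E$, each identified with $[0,\infty)$ (the vertex being $0$), and the Hilbert space $\mathcal H=\bigoplus_{e\in\mathcal E}L^2([0,\infty))$. Let $H$ be a self-adjoint $\mathcal E\times\mathcal E$ complex matrix and let $\Delta=\Delta(\mathcal M)$ be the Laplace operator with boundary conditions $A=H$, $B=\mathbb I$: $(\Delta\psi)_e=\psi_e''$ on the domain of all $\psi\in\mathcal H$ such that $\psi_e,\psi_e'$ are locally absolutely continuous on $[0,\infty)$, $\psi_e''\in L^2([0,\infty))$ for all $e$, and $H\underline\psi+\underline\psi'=0$, where $\underline\psi=(\psi_e(0))_{e}$ and $\underline\psi'=(\psi_e'(0))_{e}$. For $t>0$ let $$g_t(s)=\frac1{\sqrt{4\pi t}}\,e^{-s^2/4t},\qquad \mathrm{erfc}(w)=\frac2{\sqrt\pi}\int_w^\infty e^{-u^2}\,du,$$ $$h_t(s,\lambda)=-\lambda\sqrt{4\pi t}\;g_t(s)\,\exp\Big\{\Big(\frac{s}{2\sqrt t}-\lambda\sqrt t\Big)^2\Big\}\,\mathrm{erfc}\Big(\frac{s}{2\sqrt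 t}-\lambda\sqrt t\Big),$$ and let the matrix $h_t(s,H)$ be defined via the spectral theorem. Then the heat semigroup $e^{t\Delta}$, $t>0$, is an integral operator with a matrix-valued kernel $p_t$ whose entries are continuous functions of $x_e,y_{e'}\in[0,\infty)$, that is, $(e^{t\Delta}f)_e(x_e)=\sum_{e'}\int_0^\infty [p_t(x,y)]_{e,e'}f_{e'}(y_{e'})\,dy_{e'}$, and this kernel is given by $$[p_t(x,y)]_{e,e'}=g_t(x_e-y_e)\,\delta_{e,e'}+g_t(x_e+y_e)\,\delta_{e,e'}-[h_t(x_e+y_{e'},H)]_{e,e'}$$ for all $e,e'\in\mathcal E$ and $x_e,y_{e'}\ge 0$. Moreover, for fixed $x_e,y_{e'}\ge0$ with $x_e+y_{e'}>0$, as $t\downarrow0$, $$[p_t(x,y)]_{e,e'}=g_t(x_e-y_e)\,\delta_{e,e'}+g_t(x_e+y_e)\,\delta_{e,e'}+\frac{4t}{x_e+y_{e'}}\,g_t(x_e+y_{e'})\,\bigl(H_{e,e'}+O(t)\bigr).$$ In particular, if $H_{e,e'}\ne0$, the last term is $\dfrac{4tH_{e,e'}}{x_e+y_{e'}}\,g_t(x_e+y_{e'})\,(1+O(t))$.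 -/

import Mathlib

open MeasureTheory Filter Topology Asymptotics

noncomputable section

namespace StarGraph

/-- The Hilbert space `⨁_{e ∈ E} L²([0, ∞))` of the star graph whose (external) edges, all attached
to its single vertex, are indexed by `E`. -/
abbrev HilbertSpace (E : Type*) [Fintype E] : Type _ :=
  PiLp 2 (fun _ : E => Lp ℂ 2 (volume.restrict (Set.Ici (0 : ℝ))))

/-- `𝓜(A, B) = Ker (A, B) = {χ₁ ⊕ χ₂ | A χ₁ + B χ₂ = 0}`, a subspace of `𝓚 ⊕ 𝓚` with `𝓚 = ℂ^E`. -/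
def boundarySubspace {E : Type*} [Fintype E] (A B : Matrix E E ℂ) :
    Submodule ℂ ((E → ℂ) × (E → ℂ)) :=
  LinearMap.ker (LinearMap.coprod A.mulVecLin B.mulVecLin)

/-- `IsLaplacian M ψ φ` says that `ψ` is in the domain of the Laplace operator `Δ(M)` and
`Δ(M) ψ = φ`, i.e. it is the graph of `Δ(M)`. On every edge `e` the class `ψ e` has a representative
`u e` that is differentiable on `[0, ∞)` (one-sidedly at `0`) with derivative `v e`, which is locally
absolutely continuous (so `u e`, being of class `C¹`, is too) and has the square integrable
derivative `φ e`; the boundary values `(u e 0)_e ⊕ (v e 0)_e` lie in `M`. -/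
def IsLaplacian {E : Type*} [Fintype E] (M : Submodule ℂ ((E → ℂ) × (E → ℂ)))
    (ψ φ : HilbertSpace E) : Prop :=
  ∃ u v : E → ℝ → ℂ,
    (∀ e, (ψ e : ℝ → ℂ) =ᵐ[volume.restrict (Set.Ici (0 : ℝ))] u e) ∧
    (∀ e, ∀ x, 0 ≤ x → HasDerivWithinAt (u e) (v e x) (Set.Ici 0) x) ∧
    (∀ e, ∀ b, 0 ≤ b → AbsolutelyContinuousOnInterval (v e) 0 b) ∧
    (∀ e, ∀ᵐ x ∂(volume.restrict (Set.Ici (0 : ℝ))), HasDerivAt (v e) ((φ e : ℝ → ℂ) x) x) ∧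
    ((fun e => u e 0, fun e => v e 0) : (E → ℂ) × (E → ℂ)) ∈ M

/-- `T t`, `t ≥ 0`, is the heat semigroup `exp (t Δ(M))`: the strongly continuous one-parameter
semigroup of bounded operators whose infinitesimal generator is exactly `Δ(M)`
(values of `T` at negative times are irrelevant). -/
structure IsHeatSemigroup {E : Type*} [Fintype E] (M : Submodule ℂ ((E → ℂ) × (E → ℂ)))
    (T : ℝ → HilbertSpace E →L[ℂ] HilbertSpace E) : Prop where
  zero : ∀ f, T 0 f = f
  add : ∀ s t, 0 ≤ s → 0 ≤ t → ∀ f, T (s + t) f = T s (T t f)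
  tendsto : ∀ f, Tendsto (fun t => T t f) (𝓝[>] 0) (𝓝 f)
  generator : ∀ ψ φ, IsLaplacian M ψ φ ↔
    Tendsto (fun t : ℝ => ((t⁻¹ : ℝ) : ℂ) • (T t ψ - ψ)) (𝓝[>] 0) (𝓝 φ)

/-- `S` is the integral operator with the matrix-valued kernel `k`:
`(S f)_e (x) = ∑_{e'} ∫₀^∞ k e e' x y f_{e'} (y) dy` for almost every `x ≥ 0`. -/
def HasIntegralKernel {E : Type*} [Fintype E] (S : HilbertSpace E →L[ℂ] HilbertSpace E)
    (k : E → E → ℝ → ℝ → ℂ) : Prop :=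
  ∀ (f : HilbertSpace E) (e : E), ∀ᵐ x ∂(volume.restrict (Set.Ici (0 : ℝ))),
    (∀ e', IntegrableOn (fun y => k e e' x y * (f e' : ℝ → ℂ) y) (Set.Ici 0)) ∧
    (S f e : ℝ → ℂ) x = ∑ e', ∫ y in Set.Ici (0 : ℝ), k e e' x y * (f e' : ℝ → ℂ) y

/-- `p` is the heat kernel of `Δ(M)`: for each `t > 0`, `p t` is the (unique) version, continuous in
`x, y ∈ [0, ∞)`, of the integral kernel of `exp (t Δ(M))`. Here `p t e e' x y` is the entry `(e, e')`
at the point with coordinate `x` on the edge `e` and the point with coordinate `y` on `e'`. -/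
def IsHeatKernel {E : Type*} [Fintype E] (M : Submodule ℂ ((E → ℂ) × (E → ℂ)))
    (p : ℝ → E → E → ℝ → ℝ → ℂ) : Prop :=
  ∃ T, IsHeatSemigroup M T ∧ ∀ t, 0 < t →
    HasIntegralKernel (T t) (p t) ∧
    ∀ e e', ContinuousOn (fun z : ℝ × ℝ => p t e e' z.1 z.2) (Set.Ici 0 ×ˢ Set.Ici 0)

/-- The Gaussian `g_t(x) = (4πt)^{-1/2} exp (-x² / 4t)`. -/
def gauss (t x : ℝ) : ℝ :=
  1 / Real.sqrt (4 * Real.pi * t) * Real.exp (-x ^ 2 / (4 * t))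

/-- The complementary error function. -/
def erfc (w : ℝ) : ℝ :=
  2 / Real.sqrt Real.pi * ∫ u in Set.Ioi w, Real.exp (-u ^ 2)

/-- The function `h_t(s, l)`. -/
def hFun (t s l : ℝ) : ℝ :=
  -l * Real.sqrt (4 * Real.pi * t) * gauss t s *
    Real.exp ((s / (2 * Real.sqrt t) - l * Real.sqrt t) ^ 2) *
    erfc (s / (2 * Real.sqrt t) - l * Real.sqrt t)

/-- `h_t(s, H)` for a self-adjoint matrix `H`, through the spectral theorem. -/
def hMatrix {E : Type*} [Fintype E] [DecidableEq E] (t s : ℝ) (H : Matrix E E ℂ) :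
    Matrix E E ℂ :=
  cfc (fun l : ℝ => hFun t s l) H

/-- The diagonal part `g_t(x - y) δ_{e,e'} + g_t(x + y) δ_{e,e'}`. -/
def neumannPart {E : Type*} [DecidableEq E] (t : ℝ) (e e' : E) (x y : ℝ) : ℂ :=
  (if e = e' then (gauss t (x - y) : ℂ) else 0) + (if e = e' then (gauss t (x + y) : ℂ) else 0)

end StarGraph

end

/-! Diagonalise H = U diag(d) V with V = U⁻¹. Because `B` is the identity, V(Hψ + ψ') = diag(d)Vψ +
Vψ', so the constant matrix V carries the Laplacian to a direct sum of half-line Laplacians, one for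
each eigenvalue l of H, with the scalar Robin condition l u(0) + u'(0) = 0
(`isLaplacian_iff_isRobin`). Conjugating back puts U and V around the scalar kernels, which is the
functional calculus of H. So the problem is scalar.

On the half-line the method of images gives the candidate k_t(x,y) = g_t(x-y) + g_t(x+y) + 2l
q_t(x+y), where q_t(s) is the integral of exp(lz) g_t(s+z) over z > 0; its closed form `robinTail`
gives h_t(s,l) = -2l q_t(s). This kernel is symmetric, solves the heat equation, satisfies the
boundary condition and tends to the identity as t ↓ 0. For u in the domain, Green's identity turns
d/dt ∫ k_t u = ∫ (k_t)_yy u into ∫ k_t u'', and integration in t gives Duhamel's identity K_t ψ - ψ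
= ∫₀ᵗ K_s Δψ ds, at first only in weak form (`weak_duhamel_robinSemigroup`).

The semigroup law and the exact generator are then derived abstractly in
`isSemigroupOf_of_symmetric`, without composing kernels. The inputs are weak Duhamel, symmetry, an
exponential bound and an explicit symmetric right inverse R of μ - Δ for one large μ. Symmetry makes
the range of R dense and makes R commute with K_t; orbits starting in this range are therefore
solutions, and uniqueness of solutions gives the semigroup law. The generator is no larger than Δ,
since otherwise it would have an eigenvector for μ, against the growth bound.

The statement concerns an arbitrary heat kernel p, so two uniqueness facts are needed: the generator
determines the semigroup (`IsSemigroupOf.unique`), and the operator determines its continuous kernel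
(`HasIntegralKernel.eq_of_continuousOn`). The small time expansion is proved for each eigenvalue
from √π w exp(w²) erfc w = 1 + O(w⁻²), applied at w = s/(2√t) - l√t. -/

noncomputable section

namespace StarGraph

/-! ### Strongly continuous semigroups: basic properties and uniqueness -/

section Semigroup

variable {X : Type*} [NormedAddCommGroup X] [NormedSpace ℂ X]

/-- `T t`, `t ≥ 0`, is a strongly continuous semigroup whose generator has the graph `D`. -/
structure IsSemigroupOf (D : X → X → Prop) (T : ℝ → X →L[ℂ] X) : Prop where
  zero : ∀ f, T 0 f = f
  add : ∀ s t, 0 ≤ s → 0 ≤ t → ∀ f, T (s + t) f = T s (T t f)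
  tendsto : ∀ f, Tendsto (fun t => T t f) (𝓝[>] 0) (𝓝 f)
  generator : ∀ ψ φ, D ψ φ ↔
    Tendsto (fun t : ℝ => ((t⁻¹ : ℝ) : ℂ) • (T t ψ - ψ)) (𝓝[>] 0) (𝓝 φ)

/-- A strongly continuous, locally bounded family of operators satisfying the Duhamel identity
`K t ψ - ψ = ∫ s in 0..t, K s φ` for all `(ψ, φ)` in the graph `D`. -/
structure IsPropagator (D : X → X → Prop) (K : ℝ → X →L[ℂ] X) : Prop where
  zero : ∀ f, K 0 f = f
  bound : ∀ b, ∃ C, ∀ t, 0 ≤ t → t ≤ b → ‖K t‖ ≤ C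
  cont : ∀ f, ContinuousOn (fun t => K t f) (Set.Ici 0)
  duhamel : ∀ ψ φ, D ψ φ → ∀ t, 0 ≤ t → K t ψ - ψ = ∫ s in (0 : ℝ)..t, K s φ

variable {D : X → X → Prop} {K T : ℝ → X →L[ℂ] X}

/-- Strong continuity in time and local boundedness of the norms together give joint continuity:
K(τ)(w - w₀) is small by the bound, and K(τ)w₀ converges. -/
theorem IsPropagator.tendsto_apply (hK : IsPropagator D K) {ι : Type*} {l : Filter ι}
    {τ : ι → ℝ} {w : ι → X} {a : ℝ} {w₀ : X} (ha : 0 ≤ a) (hτ0 : ∀ᶠ i in l, 0 ≤ τ i)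
    (hτ : Tendsto τ l (𝓝 a)) (hw : Tendsto w l (𝓝 w₀)) :
    Tendsto (fun i => K (τ i) (w i)) l (𝓝 (K a w₀)) := by
  obtain ⟨C, hC⟩ := hK.bound (a + 1)
  have h1 : Tendsto (fun i => K (τ i) w₀) l (𝓝 (K a w₀)) :=
    (hK.cont w₀ a ha).tendsto.comp (tendsto_nhdsWithin_iff.2 ⟨hτ, hτ0⟩)
  have h2 : Tendsto (fun i => K (τ i) (w i - w₀)) l (𝓝 0) := by
    have hw' : Tendsto (fun i => C * ‖w i - w₀‖) l (𝓝 0) := by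
      simpa using (tendsto_iff_norm_sub_tendsto_zero.1 hw).const_mul C
    refine squeeze_zero_norm' ?_ hw'
    filter_upwards [hτ0, hτ.eventually (gt_mem_nhds (lt_add_one a))] with i hi hi'
    exact (K (τ i)).le_of_opNorm_le (hC _ hi hi'.le) _
  simpa using h2.add h1

theorem IsPropagator.hasDerivAt [CompleteSpace X] (hK : IsPropagator D K) {ψ φ : X} (h : D ψ φ)
    {t : ℝ} (ht : 0 < t) : HasDerivAt (fun s => K s ψ) (K t φ) t := by
  have hc : ContinuousAt (fun s => K s φ) t := (hK.cont φ).continuousAt (Ici_mem_nhds ht)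
  have hI : IntervalIntegrable (fun s => K s φ) volume 0 t :=
    ((hK.cont φ).mono (by rw [Set.uIcc_of_le ht.le]; exact Set.Icc_subset_Ici_self)).intervalIntegrable
  have h1 := intervalIntegral.integral_hasDerivAt_right hI
    (ContinuousOn.stronglyMeasurableAtFilter isOpen_Ioi
      ((hK.cont φ).mono Set.Ioi_subset_Ici_self) t ht) hc
  refine (h1.const_add ψ).congr_of_eventuallyEq ?_
  filter_upwards [lt_mem_nhds ht] with s hs
  rw [← hK.duhamel ψ φ h s hs.le]
  abel

/-- The curve s ↦ K(t-s) z(s) has right derivative -K(t-s)z'(s) + K(t-s)z'(s) = 0, so its values at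
s = 0 and s = t agree. Only Duhamel's identity is used, not the semigroup law; this is what later
allows the law itself to be deduced. -/
theorem IsPropagator.eq_of_solution [CompleteSpace X] (hK : IsPropagator D K) {z z' : ℝ → X}
    {t : ℝ} (ht : 0 ≤ t) (hz : ContinuousOn z (Set.Icc 0 t))
    (hz' : ∀ s ∈ Set.Ico 0 t, HasDerivWithinAt z (z' s) (Set.Ici s) s)
    (hD : ∀ s ∈ Set.Ico 0 t, D (z s) (z' s)) : K t (z 0) = z t := by
  have hcont : ContinuousOn (fun s => K (t - s) (z s)) (Set.Icc 0 t) := by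
    intro s hs
    refine hK.tendsto_apply (sub_nonneg.2 hs.2) ?_ ?_ (hz s hs)
    · filter_upwards [self_mem_nhdsWithin] with r hr using sub_nonneg.2 hr.2
    · exact (by fun_prop : Continuous fun s : ℝ => t - s).continuousWithinAt
  have hderiv : ∀ s ∈ Set.Ico 0 t,
      HasDerivWithinAt (fun s => K (t - s) (z s)) 0 (Set.Ici s) s := by
    intro s hs
    have hts : 0 < t - s := sub_pos.2 hs.2
    have h2 : HasDerivWithinAt (fun r => K (t - r) (z s)) (-K (t - s) (z' s)) (Set.Ici s) s := by
      have h3 : HasDerivAt (fun r : ℝ => t - r) (-1) s := by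
        simpa using (hasDerivAt_id s).const_sub t
      have := (hK.hasDerivAt (hD s hs) hts).scomp s h3
      simpa [Function.comp_def] using this.hasDerivWithinAt
    -- Product rule by hand: the difference quotient of this part is K(t-r) applied to the slope of
    -- z, and joint continuity passes to the limit.
    have h1 : HasDerivWithinAt (fun r => K (t - r) (z r - z s)) (K (t - s) (z' s))
        (Set.Ici s) s := by
      rw [hasDerivWithinAt_iff_tendsto_slope, Set.Ici_sdiff_left]
      have hsl := hasDerivWithinAt_iff_tendsto_slope.1 (hz' s hs)
      rw [Set.Ici_sdiff_left] at hsl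
      have := hK.tendsto_apply (l := 𝓝[>] s) (τ := fun r => t - r) hts.le ?_ ?_ hsl
      · refine this.congr fun r => ?_
        simp only [slope, vsub_eq_sub, sub_self, map_zero, sub_zero]
        rw [← algebraMap_smul ℂ ((r - s)⁻¹ : ℝ), map_smul, algebraMap_smul]
      · filter_upwards [Ioo_mem_nhdsGT hs.2] with r hr using sub_nonneg.2 hr.2.le
      · exact (by fun_prop : Continuous fun s : ℝ => t - s).continuousWithinAt
    have := h1.add h2
    rw [add_neg_cancel] at this
    refine this.congr_of_eventuallyEq (Eventually.of_forall fun r => ?_) ?_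
    · simp
    · simp
  have := constant_of_has_deriv_right_zero hcont hderiv t (Set.right_mem_Icc.2 ht)
  simpa [hK.zero] using this.symm

/-- Were the norms unbounded near 0, some t_n → 0 would have ‖T(t_n)‖ → ∞ although T(t_n)f → f for
all f, against Banach–Steinhaus. The semigroup law then spreads the bound in steps of length δ. -/
theorem IsSemigroupOf.exists_bound [CompleteSpace X] (hT : IsSemigroupOf D T) (b : ℝ) :
    ∃ C, ∀ t, 0 ≤ t → t ≤ b → ‖T t‖ ≤ C := by
  have key : ∃ δ > 0, ∃ C, ∀ t, 0 ≤ t → t ≤ δ → ‖T t‖ ≤ C := by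
    by_contra! hcon
    have h1 : ∀ n : ℕ, ∃ t, 0 ≤ t ∧ t ≤ 1 / ((n : ℝ) + 1) ∧ (n : ℝ) < ‖T t‖ := fun n =>
      let ⟨t, h⟩ := hcon (1 / ((n : ℝ) + 1)) (by positivity) n
      ⟨t, h⟩
    choose t ht0 ht1 htn using h1
    have htend : Tendsto t atTop (𝓝 0) :=
      squeeze_zero ht0 ht1 tendsto_one_div_add_atTop_nhds_zero_nat
    have hlim : ∀ f, Tendsto (fun n => T (t n) f) atTop (𝓝 f) := by
      intro f
      have hc : Tendsto (fun s => T s f) (𝓝[≥] 0) (𝓝 f) := by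
        have : insert (0 : ℝ) (Set.Ioi 0) = Set.Ici 0 := Set.Ioi_insert
        rw [← this, nhdsWithin_insert, tendsto_sup]
        exact ⟨by simpa [hT.zero] using tendsto_pure_nhds (fun s => T s f) 0, hT.tendsto f⟩
      exact hc.comp (tendsto_nhdsWithin_iff.2 ⟨htend, Eventually.of_forall ht0⟩)
    obtain ⟨C, hC⟩ := banach_steinhaus (g := fun n => T (t n)) fun f => by
      obtain ⟨c, hc⟩ := (hlim f).norm.bddAbove_range
      exact ⟨c, fun n => hc ⟨n, rfl⟩⟩
    obtain ⟨n, hn⟩ := exists_nat_gt C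
    exact absurd (htn n) (not_lt.2 ((hC n).trans hn.le))
  obtain ⟨δ, hδ, C, hC⟩ := key
  have hC1 : 1 ≤ max C 1 := le_max_right _ _
  -- The maximum with 1 makes the powers increase with n, so one bound covers the whole interval.
  have step : ∀ n : ℕ, ∀ t, 0 ≤ t → t ≤ (n + 1) * δ → ‖T t‖ ≤ max C 1 ^ (n + 1) := by
    intro n
    induction n with
    | zero =>
      intro t h0 h1
      simpa using Or.inl (hC t h0 (by simpa using h1))
    | succ n ih =>
      intro t h0 h1
      by_cases h : t ≤ δ
      · exact ((hC t h0 h).trans (le_max_left _ _)).trans (le_self_pow₀ hC1 (by simp))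
      · push Not at h
        have h2 : T t = (T δ).comp (T (t - δ)) := by
          ext f
          simpa using hT.add δ (t - δ) hδ.le (sub_nonneg.2 h.le) f
        rw [h2, pow_succ']
        refine (ContinuousLinearMap.opNorm_comp_le _ _).trans ?_
        push_cast at h1
        exact mul_le_mul ((hC δ hδ.le le_rfl).trans (le_max_left _ _))
          (ih _ (sub_nonneg.2 h.le) (by linarith)) (norm_nonneg _) (by positivity)
  obtain ⟨n, hn⟩ := exists_nat_gt (b / δ)
  refine ⟨_, fun t h0 h1 => step n t h0 (h1.trans ?_)⟩
  rw [div_lt_iff₀ hδ] at hn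
  nlinarith

theorem IsSemigroupOf.continuousOn [CompleteSpace X] (hT : IsSemigroupOf D T) (f : X) :
    ContinuousOn (fun t => T t f) (Set.Ici 0) := by
  have h0 : Tendsto (fun s => ‖T s f - f‖) (𝓝[≥] 0) (𝓝 0) := by
    have hc : Tendsto (fun s => T s f) (𝓝[≥] 0) (𝓝 f) := by
      have : insert (0 : ℝ) (Set.Ioi 0) = Set.Ici 0 := Set.Ioi_insert
      rw [← this, nhdsWithin_insert, tendsto_sup]
      exact ⟨by simpa [hT.zero] using tendsto_pure_nhds (fun s => T s f) 0, hT.tendsto f⟩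
    exact tendsto_iff_norm_sub_tendsto_zero.1 hc
  intro t ht
  obtain ⟨C, hC⟩ := hT.exists_bound (t + 1)
  rw [ContinuousWithinAt, tendsto_iff_norm_sub_tendsto_zero]
  have habs : Tendsto (fun s => |s - t|) (𝓝[Set.Ici 0] t) (𝓝[≥] 0) := by
    refine tendsto_nhdsWithin_iff.2 ⟨?_, Eventually.of_forall fun _ => Set.mem_Ici.2 (abs_nonneg _)⟩
    have : Continuous fun s : ℝ => |s - t| := by fun_prop
    simpa using (this.continuousWithinAt (s := Set.Ici 0) (x := t)).tendsto
  have h1 : Tendsto (fun s => C * ‖T |s - t| f - f‖) (𝓝[Set.Ici 0] t) (𝓝 0) := by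
    simpa using (h0.comp habs).const_mul C
  have hlt : ∀ᶠ s in 𝓝[Set.Ici 0] t, s < t + 1 :=
    mem_nhdsWithin_of_mem_nhds (gt_mem_nhds (lt_add_one t))
  refine squeeze_zero' (Eventually.of_forall fun _ => norm_nonneg _) ?_ h1
  filter_upwards [hlt, self_mem_nhdsWithin] with s hs hs0
  have hs0 : 0 ≤ s := hs0
  have ht : 0 ≤ t := ht
  rcases le_total s t with h | h
  · have h2 : T t f = T s (T (t - s) f) := by
      rw [← hT.add s (t - s) hs0 (sub_nonneg.2 h)]; simp
    rw [h2, ← map_sub, abs_of_nonpos (sub_nonpos.2 h), neg_sub, ← norm_neg, ← map_neg,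
      neg_sub]
    exact (T s).le_of_opNorm_le (hC s hs0 hs.le) _
  · have h2 : T s f = T t (T (s - t) f) := by
      rw [← hT.add t (s - t) ht (sub_nonneg.2 h)]; simp
    rw [h2, ← map_sub, abs_of_nonneg (sub_nonneg.2 h)]
    exact (T t).le_of_opNorm_le (hC t ht (by linarith)) _

theorem IsSemigroupOf.apply_generator (hT : IsSemigroupOf D T) {ψ φ : X} (h : D ψ φ) {t : ℝ}
    (ht : 0 ≤ t) : D (T t ψ) (T t φ) := by
  rw [hT.generator] at h ⊢
  refine (((T t).continuous.tendsto φ).comp h).congr' ?_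
  filter_upwards [self_mem_nhdsWithin] with s hs
  have hs : 0 < s := hs
  simp only [Function.comp_apply, map_smul, map_sub]
  rw [← hT.add t s ht hs.le, ← hT.add s t hs.le ht, add_comm]

theorem IsSemigroupOf.hasDerivWithinAt (hT : IsSemigroupOf D T) {ψ φ : X} (h : D ψ φ) {t : ℝ}
    (ht : 0 ≤ t) : HasDerivWithinAt (fun s => T s ψ) (T t φ) (Set.Ici t) t := by
  rw [hasDerivWithinAt_iff_tendsto_slope, Set.Ici_sdiff_left]
  have h1 := (hT.generator _ _).1 (hT.apply_generator h ht)
  have h2 : Tendsto (fun s : ℝ => s - t) (𝓝[>] t) (𝓝[>] 0) := by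
    refine tendsto_nhdsWithin_iff.2 ⟨?_, ?_⟩
    · have : Continuous fun s : ℝ => s - t := by fun_prop
      simpa using (this.continuousWithinAt (s := Set.Ioi t) (x := t)).tendsto
    · filter_upwards [self_mem_nhdsWithin] with s hs using Set.mem_Ioi.2 (sub_pos.2 (Set.mem_Ioi.1 hs))
  refine (h1.comp h2).congr' ?_
  filter_upwards [self_mem_nhdsWithin] with s hs
  have hs : t < s := hs
  simp only [Function.comp_apply, slope, vsub_eq_sub]
  rw [← hT.add _ _ (sub_nonneg.2 hs.le) ht, sub_add_cancel, ← Complex.coe_smul]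

theorem IsSemigroupOf.isPropagator [CompleteSpace X] (hT : IsSemigroupOf D T) :
    IsPropagator D T where
  zero := hT.zero
  bound := hT.exists_bound
  cont := hT.continuousOn
  duhamel ψ φ h t ht := by
    have hsub : Set.uIcc 0 t ⊆ Set.Ici 0 := by
      rw [Set.uIcc_of_le ht]; exact Set.Icc_subset_Ici_self
    rw [intervalIntegral.integral_eq_sub_of_hasDeriv_right (f := fun s => T s ψ)
      ((hT.continuousOn ψ).mono hsub) ?_ ((hT.continuousOn φ).mono hsub).intervalIntegrable, hT.zero]
    intro s hs
    rw [min_eq_left ht] at hs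
    exact (hT.hasDerivWithinAt h hs.1.le).mono Set.Ioi_subset_Ici_self

/-- The averages h⁻¹ ∫₀ʰ T_r f dr tend to f. They lie in the domain because (T_k - 1) ∫₀ʰ T_r f dr
is the integral over [h, h+k] minus the integral over [0, k], and after division by k this tends to
T_h f - f. -/
theorem IsSemigroupOf.dense_domain [CompleteSpace X] (hT : IsSemigroupOf D T) :
    Dense {ψ | ∃ φ, D ψ φ} := by
  intro f
  have hI : ∀ a b, 0 ≤ a → 0 ≤ b → IntervalIntegrable (fun s => T s f) volume a b := fun a b ha hb =>
    ((hT.continuousOn f).mono fun x hx =>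
      (le_min ha hb).trans (Set.mem_Icc.1 hx).1).intervalIntegrable
  have hder : ∀ t, 0 ≤ t → HasDerivWithinAt (fun s => ∫ r in (0 : ℝ)..s, T r f) (T t f) (Set.Ici t) t := by
    intro t ht
    refine intervalIntegral.integral_hasDerivWithinAt_right (hI 0 t le_rfl ht) ?_ ?_
    · refine ⟨Set.Ioi t, self_mem_nhdsWithin, ?_⟩
      exact ((hT.continuousOn f).mono fun x hx => ht.trans (le_of_lt hx)).aestronglyMeasurable
        measurableSet_Ioi
    · exact ((hT.continuousOn f) t ht).mono fun x hx => ht.trans (le_of_lt hx)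
  have hslope : ∀ t, 0 ≤ t → Tendsto (fun h : ℝ => ((h⁻¹ : ℝ) : ℂ) • ∫ r in t..(t + h), T r f) (𝓝[>] 0)
      (𝓝 (T t f)) := by
    intro t ht
    have h1 := hasDerivWithinAt_iff_tendsto_slope.1 (hder t ht)
    rw [Set.Ici_sdiff_left] at h1
    have h2 : Tendsto (fun s : ℝ => t + s) (𝓝[>] 0) (𝓝[>] t) := by
      refine tendsto_nhdsWithin_iff.2 ⟨?_, ?_⟩
      · have : Continuous fun s : ℝ => t + s := by fun_prop
        simpa using (this.continuousWithinAt (s := Set.Ioi 0) (x := 0)).tendsto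
      · filter_upwards [self_mem_nhdsWithin] with s hs using Set.mem_Ioi.2 (lt_add_of_pos_right t (Set.mem_Ioi.1 hs))
    refine (h1.comp h2).congr' ?_
    filter_upwards [self_mem_nhdsWithin] with h hh
    have hh : 0 < h := hh
    simp only [Function.comp_apply, slope, vsub_eq_sub, add_sub_cancel_left]
    rw [intervalIntegral.integral_interval_sub_left (hI _ _ le_rfl (by linarith)) (hI _ _ le_rfl ht),
      ← Complex.coe_smul]
  have hmem : ∀ h : ℝ, 0 < h → ((h⁻¹ : ℝ) : ℂ) • (∫ r in (0 : ℝ)..h, T r f) ∈ {ψ | ∃ φ, D ψ φ} := by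
    intro h hh
    refine ⟨((h⁻¹ : ℝ) : ℂ) • (T h f - f), ?_⟩
    rw [hT.generator]
    have h1 := ((hslope h hh.le).sub (hslope 0 le_rfl)).const_smul ((h⁻¹ : ℝ) : ℂ)
    rw [hT.zero] at h1
    refine h1.congr' ?_
    filter_upwards [self_mem_nhdsWithin] with k hk
    have hk : 0 < k := hk
    have h2 : T k (∫ r in (0 : ℝ)..h, T r f) = ∫ r in k..(h + k), T r f := by
      rw [← ContinuousLinearMap.intervalIntegral_comp_comm _ (hI 0 h le_rfl hh.le)]
      rw [show (∫ r in k..(h + k), T r f) = ∫ r in (0 : ℝ)..h, T (r + k) f by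
        rw [intervalIntegral.integral_comp_add_right (fun r => T r f) k, zero_add]]
      refine intervalIntegral.integral_congr fun r hr => ?_
      rw [Set.uIcc_of_le hh.le] at hr
      rw [add_comm, hT.add k r hk.le hr.1]
    rw [map_smul, h2, ← smul_sub, smul_comm, ← smul_sub]
    congr 2
    have h3 := intervalIntegral.integral_add_adjacent_intervals (hI 0 k le_rfl hk.le)
      (hI k (h + k) hk.le (by linarith))
    have h4 := intervalIntegral.integral_add_adjacent_intervals (hI 0 h le_rfl hh.le)
      (hI h (h + k) hh.le (by linarith))
    rw [zero_add, sub_eq_sub_iff_add_eq_add, add_comm, h4, ← h3, add_comm]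
  have h0 := hslope 0 le_rfl
  rw [hT.zero] at h0
  refine mem_closure_of_tendsto h0 ?_
  filter_upwards [self_mem_nhdsWithin] with h hh
  simpa using hmem h hh

/-- A strongly continuous semigroup is determined by its generator. -/
theorem IsSemigroupOf.unique [CompleteSpace X] {T' : ℝ → X →L[ℂ] X} (hT : IsSemigroupOf D T)
    (hT' : IsSemigroupOf D T') {t : ℝ} (ht : 0 ≤ t) : T t = T' t := by
  refine DFunLike.coe_injective (Continuous.ext_on hT.dense_domain (T t).continuous
    (T' t).continuous ?_)
  rintro ψ ⟨φ, h⟩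
  have := hT'.isPropagator.eq_of_solution (z := fun s => T s ψ) (z' := fun s => T s φ) ht
    ((hT.continuousOn ψ).mono Set.Icc_subset_Ici_self)
    (fun s hs => hT.hasDerivWithinAt h hs.1) (fun s hs => hT.apply_generator h hs.1)
  simpa [hT.zero] using this.symm

end Semigroup

/-! ### Generation from symmetry, a weak Duhamel identity and a resolvent -/

section Existence

variable {X : Type*} [NormedAddCommGroup X] [InnerProductSpace ℂ X]
  {D : X → X → Prop} {K : ℝ → X →L[ℂ] X} {R : X →L[ℂ] X}

local notation "⟪" x ", " y "⟫" => inner ℂ x y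

/-- Testing the weak identity against η = K_t ψ - K_s ψ itself bounds ‖η‖² by ‖η‖ C‖φ‖(t - s), and
one factor cancels. -/
theorem norm_apply_sub_le_of_weak_duhamel {b C : ℝ} (hC : ∀ t, 0 ≤ t → t ≤ b → ‖K t‖ ≤ C)
    (weak : ∀ ψ φ, D ψ φ → ∀ η t, 0 ≤ t →
      IntervalIntegrable (fun s => ⟪η, K s φ⟫) volume 0 t ∧
      ⟪η, K t ψ - ψ⟫ = ∫ s in (0 : ℝ)..t, ⟪η, K s φ⟫) {ψ φ : X} (h : D ψ φ) {s t : ℝ}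
    (hs : 0 ≤ s) (hst : s ≤ t) (htb : t ≤ b) : ‖K t ψ - K s ψ‖ ≤ C * ‖φ‖ * (t - s) := by
  set η := K t ψ - K s ψ with hη
  have h1 : ⟪η, η⟫ = ∫ r in s..t, ⟪η, K r φ⟫ := by
    have ht' := weak ψ φ h η t (hs.trans hst)
    have hs' := weak ψ φ h η s hs
    rw [← intervalIntegral.integral_interval_sub_left ht'.1 hs'.1, ← ht'.2, ← hs'.2,
      ← inner_sub_right]
    congr 1
    rw [hη]; abel
  have h2 : ‖η‖ * ‖η‖ ≤ ‖η‖ * (C * ‖φ‖ * (t - s)) := by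
    have h3 : ‖η‖ * ‖η‖ = ‖⟪η, η⟫‖ := by
      rw [inner_self_eq_norm_sq_to_K, norm_pow]; simp [sq]
    rw [h3, h1]
    have := intervalIntegral.norm_integral_le_of_norm_le_const (a := s) (b := t)
      (f := fun r => ⟪η, K r φ⟫) (C := ‖η‖ * (C * ‖φ‖)) ?_
    · rw [abs_of_nonneg (sub_nonneg.2 hst)] at this
      linarith
    · intro r hr
      rw [Set.uIoc_of_le hst] at hr
      refine (norm_inner_le_norm _ _).trans ?_
      gcongr
      exact (K r).le_of_opNorm_le (hC r (hs.trans hr.1.le) (hr.2.trans htb)) φ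
  rcases (norm_nonneg η).eq_or_lt with h0 | h0
  · rw [← h0]
    have : 0 ≤ C := (norm_nonneg _).trans (hC s hs (hst.trans htb))
    have := sub_nonneg.2 hst
    positivity
  · exact le_of_mul_le_mul_left h2 h0

variable [CompleteSpace X]

/-- Orbits of domain vectors are Lipschitz; density and the local bound extend continuity to all
vectors by an ε/3 argument. The integral of K_s φ then exists in norm, and the weak identity becomes
a strong one. -/
theorem isPropagator_of_weak_duhamel (hK0 : ∀ f, K 0 f = f)
    (bound : ∀ b, ∃ C, ∀ t, 0 ≤ t → t ≤ b → ‖K t‖ ≤ C)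
    (weak : ∀ ψ φ, D ψ φ → ∀ η t, 0 ≤ t →
      IntervalIntegrable (fun s => ⟪η, K s φ⟫) volume 0 t ∧
      ⟪η, K t ψ - ψ⟫ = ∫ s in (0 : ℝ)..t, ⟪η, K s φ⟫)
    (hdense : Dense {ψ | ∃ φ, D ψ φ}) : IsPropagator D K := by
  have hcont : ∀ f, ContinuousOn (fun t => K t f) (Set.Ici 0) := by
    intro f t ht
    have ht : 0 ≤ t := ht
    obtain ⟨C, hC⟩ := bound (t + 1)
    have hC0 : 0 ≤ C := (norm_nonneg _).trans (hC t ht (by linarith))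
    rw [Metric.continuousWithinAt_iff]
    intro ε hε
    obtain ⟨ψ, hψ, φ, hfψ⟩ := Metric.dense_iff.1 hdense f (ε / (3 * (C + 1))) (by positivity)
    rw [Metric.mem_ball, dist_comm, dist_eq_norm] at hψ
    refine ⟨min 1 (ε / (3 * (C * ‖φ‖ + 1))), by positivity, fun s hs hst => ?_⟩
    have hs : 0 ≤ s := hs
    rw [lt_min_iff, Real.dist_eq] at hst
    have hs1 : s ≤ t + 1 := by linarith [(abs_lt.1 hst.1).2]
    have hlip : ‖K s ψ - K t ψ‖ ≤ C * ‖φ‖ * |s - t| := by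
      rcases le_total s t with h | h
      · rw [norm_sub_rev, abs_of_nonpos (sub_nonpos.2 h), neg_sub]
        exact norm_apply_sub_le_of_weak_duhamel hC weak hfψ hs h (by linarith)
      · rw [abs_of_nonneg (sub_nonneg.2 h)]
        exact norm_apply_sub_le_of_weak_duhamel hC weak hfψ ht h hs1
    have h1 : ‖K s ψ - K t ψ‖ < ε / 3 := by
      refine hlip.trans_lt ?_
      have h2 := hst.2
      rw [lt_div_iff₀ (by positivity)] at h2
      have := abs_nonneg (s - t)
      nlinarith
    have h3 : ∀ r, 0 ≤ r → r ≤ t + 1 → ‖K r (f - ψ)‖ ≤ ε / 3 := by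
      intro r hr hr'
      refine ((K r).le_of_opNorm_le (hC r hr hr') _).trans ?_
      rw [lt_div_iff₀ (by positivity)] at hψ
      have := norm_nonneg (f - ψ)
      nlinarith
    have h4 : K s f - K t f = K s (f - ψ) + (K s ψ - K t ψ) - K t (f - ψ) := by
      simp only [map_sub]; abel
    rw [dist_eq_norm, h4]
    have := norm_sub_le (K s (f - ψ) + (K s ψ - K t ψ)) (K t (f - ψ))
    have := norm_add_le (K s (f - ψ)) (K s ψ - K t ψ)
    have := h3 s hs hs1
    have := h3 t ht (by linarith)
    linarith
  refine ⟨hK0, bound, hcont, fun ψ φ h t ht => ext_inner_left ℂ fun η => ?_⟩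
  have hI : IntervalIntegrable (fun s => K s φ) volume 0 t :=
    ((hcont φ).mono (by rw [Set.uIcc_of_le ht]; exact Set.Icc_subset_Ici_self)).intervalIntegrable
  rw [(weak ψ φ h η t ht).2]
  exact (ContinuousLinearMap.intervalIntegral_comp_comm (innerSL ℂ η) hI)

/-- A vector g orthogonal to the range of the symmetric R satisfies R g = 0, hence `D 0 (-g)`, and
so g = 0. -/
theorem dense_domain_of_symmetric_resolvent {μ : ℝ} (hR : ∀ f, D (R f) ((μ : ℂ) • R f - f))
    (hRsymm : ∀ f g, ⟪R f, g⟫ = ⟪f, R g⟫) (hD0 : ∀ φ, D 0 φ → φ = 0) :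
    Dense {ψ | ∃ φ, D ψ φ} := by
  have h1 : (LinearMap.range R.toLinearMap).topologicalClosure = ⊤ := by
    rw [Submodule.topologicalClosure_eq_top_iff, Submodule.eq_bot_iff]
    intro g hg
    have h2 : R g = 0 := ext_inner_left ℂ fun f => by
      rw [← hRsymm, inner_zero_right]
      exact (Submodule.mem_orthogonal _ _).1 hg _ ⟨f, rfl⟩
    have := hD0 _ (h2 ▸ hR g)
    simpa [h2] using this
  have h2 : Dense (LinearMap.range R.toLinearMap : Set X) :=
    Submodule.dense_iff_topologicalClosure_eq_top.2 h1
  refine h2.mono ?_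
  rintro _ ⟨f, rfl⟩
  exact ⟨_, hR f⟩

/-- Both K_t R f and R K_t f satisfy an integral identity with the same inhomogeneous term -∫ K_s f.
Their difference c solves c(t) = μ ∫₀ᵗ c, and the factor exp(-μt) forces c = 0. -/
theorem commute_of_symmetric_resolvent (hK : IsPropagator D K) {μ : ℝ}
    (hR : ∀ f, D (R f) ((μ : ℂ) • R f - f)) (hRsymm : ∀ f g, ⟪R f, g⟫ = ⟪f, R g⟫)
    (hKsymm : ∀ t, 0 ≤ t → ∀ f g, ⟪K t f, g⟫ = ⟪f, K t g⟫) {t : ℝ} (ht : 0 ≤ t) (f : X) :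
    K t (R f) = R (K t f) := by
  have hcI : ∀ f t, 0 ≤ t → IntervalIntegrable (fun s => K s f) volume 0 t := fun f t ht =>
    ((hK.cont f).mono (by rw [Set.uIcc_of_le ht]; exact Set.Icc_subset_Ici_self)).intervalIntegrable
  have hRc : ∀ f, ContinuousOn (fun s => R (K s f)) (Set.Ici 0) := fun f =>
    R.continuous.comp_continuousOn (hK.cont f)
  have hRI : ∀ f t, 0 ≤ t → IntervalIntegrable (fun s => R (K s f)) volume 0 t := fun f t ht =>
    ((hRc f).mono (by rw [Set.uIcc_of_le ht]; exact Set.Icc_subset_Ici_self)).intervalIntegrable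
  have h1 : ∀ t, 0 ≤ t → K t (R f) - R f =
      (μ : ℂ) • (∫ s in (0 : ℝ)..t, K s (R f)) - ∫ s in (0 : ℝ)..t, K s f := by
    intro t ht
    have h3 : IntervalIntegrable (fun s => (μ : ℂ) • K s (R f)) volume 0 t :=
      (hcI _ t ht).smul (μ : ℂ)
    rw [hK.duhamel _ _ (hR f) t ht, ← intervalIntegral.integral_smul,
      ← intervalIntegral.integral_sub h3 (hcI _ t ht)]
    simp
  -- The adjoint of Duhamel's identity: pair with g, move R and K_t to the other side, and apply
  -- Duhamel to the domain vector R g.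
  have h2 : ∀ t, 0 ≤ t → R (K t f) - R f =
      (μ : ℂ) • (∫ s in (0 : ℝ)..t, R (K s f)) - ∫ s in (0 : ℝ)..t, K s f := by
    intro t ht
    refine ext_inner_right ℂ fun g => ?_
    have h3 : ⟪R (K t f) - R f, g⟫ = ⟪f, K t (R g) - R g⟫ := by
      rw [inner_sub_left, inner_sub_right, hRsymm, hRsymm, hKsymm t ht]
    rw [h3, hK.duhamel _ _ (hR g) t ht]
    have h4 : ∀ F : ℝ → X, IntervalIntegrable F volume 0 t → ⟪∫ s in (0 : ℝ)..t, F s, g⟫ =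
        ∫ s in (0 : ℝ)..t, ⟪F s, g⟫ := by
      intro F hF
      rw [← inner_conj_symm, show ⟪g, ∫ s in (0 : ℝ)..t, F s⟫ = ∫ s in (0 : ℝ)..t, ⟪g, F s⟫ from
        (ContinuousLinearMap.intervalIntegral_comp_comm (innerSL ℂ g) hF).symm,
        intervalIntegral.integral_of_le ht, ← integral_conj, intervalIntegral.integral_of_le ht]
      simp only [inner_conj_symm]
    have h5 : ⟪f, ∫ s in (0 : ℝ)..t, K s ((μ : ℂ) • R g - g)⟫ =
        ∫ s in (0 : ℝ)..t, ⟪f, K s ((μ : ℂ) • R g - g)⟫ :=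
      (ContinuousLinearMap.intervalIntegral_comp_comm (innerSL ℂ f) (hcI _ t ht)).symm
    have h6 : IntervalIntegrable (fun s => (μ : ℂ) • R (K s f)) volume 0 t :=
      (hRI _ t ht).smul (μ : ℂ)
    rw [h5, ← intervalIntegral.integral_smul,
      ← intervalIntegral.integral_sub h6 (hcI _ t ht), h4 _ (h6.sub (hcI _ t ht))]
    refine intervalIntegral.integral_congr fun s hs => ?_
    rw [Set.uIcc_of_le ht] at hs
    rw [← hKsymm s hs.1, inner_sub_left, inner_sub_right, inner_smul_left, inner_smul_right,
      hRsymm, Complex.conj_ofReal]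
  set c : ℝ → X := fun s => K s (R f) - R (K s f) with hc
  have hcc : ContinuousOn c (Set.Ici 0) := (hK.cont _).sub (hRc f)
  have h3 : ∀ t, 0 ≤ t → c t = ∫ s in (0 : ℝ)..t, (μ : ℂ) • c s := by
    intro t ht
    have h4 : c t = (K t (R f) - R f) - (R (K t f) - R f) := by simp [hc]
    rw [h4, h1 t ht, h2 t ht, intervalIntegral.integral_smul,
      intervalIntegral.integral_sub (hcI _ t ht) (hRI _ t ht), smul_sub]
    abel
  have hder : ∀ s ∈ Set.Ico 0 t, HasDerivWithinAt c ((μ : ℂ) • c s) (Set.Ici s) s := by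
    intro s hs
    have hμc : ContinuousOn (fun s => (μ : ℂ) • c s) (Set.Ici 0) := hcc.const_smul _
    have h5 : HasDerivWithinAt (fun r => ∫ x in (0 : ℝ)..r, (μ : ℂ) • c x) ((μ : ℂ) • c s)
        (Set.Ici s) s := by
      refine intervalIntegral.integral_hasDerivWithinAt_right ?_ ?_ ?_
      · exact (hμc.mono (by
          rw [Set.uIcc_of_le hs.1]; exact Set.Icc_subset_Ici_self)).intervalIntegrable
      · refine ⟨Set.Ioi s, self_mem_nhdsWithin, ?_⟩
        exact (hμc.mono fun x hx => hs.1.trans (le_of_lt hx)).aestronglyMeasurable measurableSet_Ioi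
      · exact (hμc s hs.1).mono fun x hx => hs.1.trans (le_of_lt hx)
    exact h5.congr (fun r hr => h3 r (hs.1.trans hr)) (h3 s hs.1)
  have hexp : ∀ s : ℝ, HasDerivAt (fun s : ℝ => Complex.exp (-μ * s)) (Complex.exp (-μ * s) * -μ) s := by
    intro s
    have := ((hasDerivAt_id (s : ℂ)).const_mul (-μ : ℂ)).cexp.comp_ofReal
    simpa using this
  have hconst := constant_of_has_deriv_right_zero
    (f := fun s : ℝ => Complex.exp (-μ * s) • c s) (a := 0) (b := t) ?_ ?_ t (Set.right_mem_Icc.2 ht)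
  · have h0 : c 0 = 0 := by simpa using h3 0 le_rfl
    simp only [h0, smul_zero, smul_eq_zero, Complex.exp_ne_zero, false_or] at hconst
    exact sub_eq_zero.1 hconst
  · exact (by fun_prop : Continuous fun s : ℝ => Complex.exp (-μ * s)).continuousOn.smul
      (hcc.mono Set.Icc_subset_Ici_self)
  · intro s hs
    have := (hexp s).hasDerivWithinAt.smul (hder s hs)
    refine this.congr_deriv ?_
    rw [smul_smul, ← add_smul]
    ring_nf
    simp

/-- An exponentially bounded family of symmetric operators that satisfies the weak Duhamel identity
for `D` is the semigroup generated by `D`, provided that `μ - D` has a symmetric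
right inverse for some `μ` above the growth bound. -/
theorem isSemigroupOf_of_symmetric {C ω μ : ℝ} (hω : ω < μ) (hK0 : ∀ f, K 0 f = f)
    (bound : ∀ t, 0 ≤ t → ‖K t‖ ≤ C * Real.exp (ω * t))
    (weak : ∀ ψ φ, D ψ φ → ∀ η t, 0 ≤ t →
      IntervalIntegrable (fun s => ⟪η, K s φ⟫) volume 0 t ∧
      ⟪η, K t ψ - ψ⟫ = ∫ s in (0 : ℝ)..t, ⟪η, K s φ⟫)
    (hR : ∀ f, D (R f) ((μ : ℂ) • R f - f)) (hRsymm : ∀ f g, ⟪R f, g⟫ = ⟪f, R g⟫)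
    (hKsymm : ∀ t, 0 ≤ t → ∀ f g, ⟪K t f, g⟫ = ⟪f, K t g⟫) (hD0 : ∀ φ, D 0 φ → φ = 0) :
    IsSemigroupOf D K := by
  have hC0 : 0 ≤ C := by simpa using (norm_nonneg _).trans (bound 0 le_rfl)
  have hbound : ∀ b, ∃ C, ∀ t, 0 ≤ t → t ≤ b → ‖K t‖ ≤ C := fun b =>
    ⟨C * Real.exp (|ω| * b), fun t h0 hb => (bound t h0).trans (by
      gcongr
      exact le_abs_self ω)⟩
  have hdense := dense_domain_of_symmetric_resolvent hR hRsymm hD0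
  have hK : IsPropagator D K := isPropagator_of_weak_duhamel hK0 hbound weak hdense
  have hcomm : ∀ t, 0 ≤ t → ∀ f, K t (R f) = R (K t f) := fun t ht f =>
    commute_of_symmetric_resolvent hK hR hRsymm hKsymm ht f
  have hright : ∀ f, Tendsto (fun t => K t f) (𝓝[>] 0) (𝓝 f) := by
    intro f
    have := ((hK.cont f) 0 Set.self_mem_Ici).tendsto.mono_left
      (nhdsWithin_mono _ Set.Ioi_subset_Ici_self)
    simpa [hK0] using this
  have hderiv : ∀ ψ φ, D ψ φ →
      ∀ s, 0 ≤ s → HasDerivWithinAt (fun s => K s ψ) (K s φ) (Set.Ici s) s := by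
    intro ψ φ h s hs
    have hc := hK.cont φ
    have h5 : HasDerivWithinAt (fun r => ∫ x in (0 : ℝ)..r, K x φ) (K s φ) (Set.Ici s) s := by
      refine intervalIntegral.integral_hasDerivWithinAt_right ?_ ?_ ?_
      · exact (hc.mono (by
          rw [Set.uIcc_of_le hs]; exact Set.Icc_subset_Ici_self)).intervalIntegrable
      · refine ⟨Set.Ioi s, self_mem_nhdsWithin, ?_⟩
        exact (hc.mono fun x hx => hs.trans (le_of_lt hx)).aestronglyMeasurable measurableSet_Ioi
      · exact (hc s hs).mono fun x hx => hs.trans (le_of_lt hx)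
    refine (h5.const_add ψ).congr (fun r hr => ?_) ?_
    · rw [← hK.duhamel ψ φ h r (hs.trans hr)]; abel
    · rw [← hK.duhamel ψ φ h s hs]; abel
  have hadd : ∀ s t, 0 ≤ s → 0 ≤ t → ∀ f, K (s + t) f = K s (K t f) := by
    intro s t hs ht
    -- The density lemma is applied to `D` restricted to the range of `R`, which satisfies the same
    -- hypotheses.
    have hrange : Dense (Set.range R) := by
      have h1 : Dense {ψ | ∃ φ, D ψ φ ∧ ψ ∈ Set.range R} := by
        refine (dense_domain_of_symmetric_resolvent
          (D := fun ψ φ => D ψ φ ∧ ψ ∈ Set.range R) (fun f => ⟨hR f, f, rfl⟩) hRsymm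
          (fun φ h => hD0 φ h.1))
      refine h1.mono ?_
      rintro ψ ⟨_, _, h⟩
      exact h
    have : (K (s + t) : X → X) = fun f => K s (K t f) := by
      refine Continuous.ext_on hrange (K (s + t)).continuous (by fun_prop) ?_
      rintro _ ⟨f, rfl⟩
      -- The shifted orbit r ↦ K(t+r) R f equals R K(t+r) f, so it stays in the domain and is a
      -- solution starting at K(t) R f.
      have h1 := hK.eq_of_solution (t := s) (z := fun r => K (t + r) (R f))
        (z' := fun r => (μ : ℂ) • K (t + r) (R f) - K (t + r) f) hs ?_ ?_ ?_
      · simp only [add_zero] at h1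
        rw [add_comm, ← h1]
      · refine (hK.cont (R f)).comp (by fun_prop) fun r hr => add_nonneg ht hr.1
      · intro r hr
        have h2 := hderiv _ _ (hR f) (t + r) (add_nonneg ht hr.1)
        have h3 : HasDerivWithinAt (fun r : ℝ => t + r) 1 (Set.Ici r) r := by
          simpa using ((hasDerivAt_id r).const_add t).hasDerivWithinAt
        have h4 := h2.scomp (s := Set.Ici r) r h3 fun x hx => add_le_add_right hx t
        simpa [Function.comp_def] using h4
      · intro r hr
        simp only [hcomm _ (add_nonneg ht hr.1)]
        exact hR _
    exact fun f => congrFun this f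
  have hgen : ∀ ψ φ, D ψ φ →
      Tendsto (fun t : ℝ => ((t⁻¹ : ℝ) : ℂ) • (K t ψ - ψ)) (𝓝[>] 0) (𝓝 φ) := by
    intro ψ φ h
    have := hasDerivWithinAt_iff_tendsto_slope.1 (hderiv ψ φ h 0 le_rfl)
    rw [Set.Ici_sdiff_left, hK0] at this
    refine this.congr fun t => ?_
    simp only [slope, vsub_eq_sub, sub_zero, hK0]
    rw [← Complex.coe_smul]
  refine ⟨hK0, hadd, hright, fun ψ φ => ⟨hgen ψ φ, fun h => ?_⟩⟩
  obtain ⟨f, hf⟩ : ∃ f, f = (μ : ℂ) • ψ - φ := ⟨_, rfl⟩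
  -- Maximality: w is in the domain of the generator with eigenvalue μ, so K_t w = exp(μt) w. As the
  -- norms grow at most like exp(ωt) with ω < μ, w vanishes and ψ = R f is in the domain of `D`.
  obtain ⟨w, hw⟩ : ∃ w, w = ψ - R f := ⟨_, rfl⟩
  have hA : Tendsto (fun t : ℝ => ((t⁻¹ : ℝ) : ℂ) • (K t w - w)) (𝓝[>] 0) (𝓝 ((μ : ℂ) • w)) := by
    have h1 := h.sub (hgen _ _ (hR f))
    have h2 : φ - ((μ : ℂ) • R f - f) = (μ : ℂ) • w := by
      rw [hw, smul_sub, show (μ : ℂ) • ψ = f + φ by rw [hf]; abel]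
      abel
    rw [h2] at h1
    refine h1.congr fun t => ?_
    rw [← smul_sub, hw, map_sub]
    congr 1
    abel
  have hAs : IsSemigroupOf (fun ψ φ => Tendsto (fun t : ℝ => ((t⁻¹ : ℝ) : ℂ) • (K t ψ - ψ))
      (𝓝[>] 0) (𝓝 φ)) K := ⟨hK0, hadd, hright, fun _ _ => Iff.rfl⟩
  have hexp : ∀ s : ℝ, HasDerivAt (fun s : ℝ => Complex.exp (-μ * s)) (Complex.exp (-μ * s) * -μ) s := by
    intro s
    have := ((hasDerivAt_id (s : ℂ)).const_mul (-μ : ℂ)).cexp.comp_ofReal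
    simpa using this
  have hconst : ∀ t : ℝ, 0 ≤ t → Complex.exp (-μ * t) • K t w = w := by
    intro t ht
    have := constant_of_has_deriv_right_zero
      (f := fun s : ℝ => Complex.exp (-μ * s) • K s w) (a := 0) (b := t) ?_ ?_ t
      (Set.right_mem_Icc.2 ht)
    · simpa [hK0] using this
    · exact (by fun_prop : Continuous fun s : ℝ => Complex.exp (-μ * s)).continuousOn.smul
        ((hK.cont w).mono Set.Icc_subset_Ici_self)
    · intro s hs
      have := (hexp s).hasDerivWithinAt.smul (hAs.hasDerivWithinAt hA hs.1)
      refine this.congr_deriv ?_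
      rw [map_smul, smul_smul, ← add_smul]
      ring_nf
      simp
  have hw0 : w = 0 := by
    have h1 : ∀ t, 0 ≤ t → ‖w‖ ≤ C * ‖w‖ * Real.exp (-(μ - ω) * t) := by
      intro t ht
      conv_lhs => rw [← hconst t ht]
      rw [norm_smul, Complex.norm_exp]
      have h2 := (K t).le_of_opNorm_le (bound t ht) w
      have h3 : (-(μ : ℂ) * t).re = -μ * t := by simp
      have h4 : Real.exp (-(μ - ω) * t) = Real.exp (-μ * t) * Real.exp (ω * t) := by
        rw [← Real.exp_add]; ring_nf
      rw [h3, h4]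
      calc _ ≤ Real.exp (-μ * t) * (C * Real.exp (ω * t) * ‖w‖) := by gcongr
        _ = _ := by ring
    have h2 : Tendsto (fun t => C * ‖w‖ * Real.exp (-(μ - ω) * t)) atTop (𝓝 0) := by
      have h3 : Tendsto (fun t : ℝ => -(μ - ω) * t) atTop atBot :=
        tendsto_id.const_mul_atTop_of_neg (by linarith)
      simpa using (Real.tendsto_exp_atBot.comp h3).const_mul (C * ‖w‖)
    have h3 := ge_of_tendsto h2 (by
      filter_upwards [eventually_ge_atTop 0] with t ht using h1 t ht)
    exact norm_le_zero_iff.1 h3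
  have hψ : ψ = R f := sub_eq_zero.1 (hw ▸ hw0)
  have hφ : φ = (μ : ℂ) • R f - f := by
    rw [← hψ, hf]; abel
  rw [hφ, hψ]
  exact hR f

end Existence

/-! ### Integral operators on L² by the Schur test -/

section SchurTest

/-- Cauchy–Schwarz after writing a f = a^{1/2} · (a^{1/2} f). -/
theorem sq_lintegral_mul_le {α : Type*} [MeasurableSpace α] (ν : Measure α) {a f : α → ENNReal}
    (ha : AEMeasurable a ν) (hf : AEMeasurable f ν) :
    (∫⁻ x, a x * f x ∂ν) ^ 2 ≤ (∫⁻ x, a x ∂ν) * ∫⁻ x, a x * f x ^ 2 ∂ν := by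
  have h2 : (2 : ℝ).HolderConjugate 2 := Real.HolderConjugate.two_two
  have h := ENNReal.lintegral_mul_le_Lp_mul_Lq ν h2 (f := fun x => a x ^ (1 / 2 : ℝ))
    (g := fun x => a x ^ (1 / 2 : ℝ) * f x) (ha.pow_const _) ((ha.pow_const _).mul hf)
  have e1 : ∀ x : ENNReal, (x ^ (1 / 2 : ℝ)) ^ (2 : ℝ) = x := fun x => by
    rw [← ENNReal.rpow_mul]; norm_num
  have e2 : ∀ x : ENNReal, x ^ (1 / 2 : ℝ) * x ^ (1 / 2 : ℝ) = x := fun x => by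
    rw [← ENNReal.rpow_add_of_nonneg _ _ (by norm_num) (by norm_num)]; norm_num
  simp only [Pi.mul_apply, ← mul_assoc, e2, e1, ENNReal.mul_rpow_of_nonneg _ _ zero_le_two] at h
  rw [← ENNReal.mul_rpow_of_nonneg _ _ (by norm_num)] at h
  have h3 := ENNReal.rpow_le_rpow h zero_le_two
  rw [e1, ENNReal.rpow_two] at h3
  simpa using h3

theorem enorm_ofReal_complex (r : ℝ) : ‖(r : ℂ)‖ₑ = ‖r‖ₑ := by
  simp [enorm_eq_nnnorm, Complex.nnnorm_real]

theorem mul_le_sq_add_sq_ennreal (a b : ENNReal) : a * b ≤ a ^ 2 + b ^ 2 := by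
  rcases le_total a b with h | h
  · calc a * b ≤ b * b := by gcongr
      _ ≤ _ := by rw [sq b]; exact le_add_self
  · calc a * b ≤ a * a := by gcongr
      _ ≤ _ := by rw [sq a]; exact le_self_add

variable {α : Type*} [MeasurableSpace α] {ν : Measure α}

/-- The hypotheses of the Schur test for the kernel `k` on `L²(ν)`. -/
structure IsSchurKernel (ν : Measure α) (k : α → α → ℝ) (C : NNReal) : Prop where
  meas : Measurable (Function.uncurry k)
  left : ∀ᵐ x ∂ν, ∫⁻ y, ‖k x y‖ₑ ∂ν ≤ C
  right : ∀ᵐ y ∂ν, ∫⁻ x, ‖k x y‖ₑ ∂ν ≤ C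

variable {k : α → α → ℝ} {C : NNReal}

theorem IsSchurKernel.swap (h : IsSchurKernel ν k C) : IsSchurKernel ν (fun x y => k y x) C where
  meas := h.meas.comp measurable_swap
  left := h.right
  right := h.left

theorem IsSchurKernel.measurable_mul (h : IsSchurKernel ν k C) (f : Lp ℂ 2 ν) :
    Measurable fun p : α × α => (k p.1 p.2 : ℂ) * f p.2 :=
  (Complex.measurable_ofReal.comp h.meas).mul
    ((Lp.stronglyMeasurable f).measurable.comp measurable_snd)

variable [SFinite ν]

/-- Cauchy–Schwarz with weight |k(x,·)| uses the row bound; after Tonelli the column bound gives the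
second factor C. -/
theorem IsSchurKernel.lintegral_sq_le (h : IsSchurKernel ν k C) {f : α → ENNReal}
    (hf : Measurable f) :
    ∫⁻ x, (∫⁻ y, ‖k x y‖ₑ * f y ∂ν) ^ 2 ∂ν ≤ C ^ 2 * ∫⁻ y, f y ^ 2 ∂ν := by
  have hk : Measurable (fun p : α × α => ‖k p.1 p.2‖ₑ) := h.meas.enorm
  calc ∫⁻ x, (∫⁻ y, ‖k x y‖ₑ * f y ∂ν) ^ 2 ∂ν
      ≤ ∫⁻ x, C * ∫⁻ y, ‖k x y‖ₑ * f y ^ 2 ∂ν ∂ν := by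
        refine lintegral_mono_ae ?_
        filter_upwards [h.left] with x hx
        refine (sq_lintegral_mul_le ν ?_ hf.aemeasurable).trans (by gcongr)
        exact (hk.comp (measurable_const.prodMk measurable_id)).aemeasurable
    _ = C * ∫⁻ x, ∫⁻ y, ‖k x y‖ₑ * f y ^ 2 ∂ν ∂ν := by
        rw [lintegral_const_mul']; exact ENNReal.coe_ne_top
    _ = C * ∫⁻ y, ∫⁻ x, ‖k x y‖ₑ * f y ^ 2 ∂ν ∂ν := by
        rw [lintegral_lintegral_swap]
        exact (hk.mul ((hf.comp measurable_snd).pow_const 2)).aemeasurable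
    _ ≤ C * ∫⁻ y, C * f y ^ 2 ∂ν := by
        gcongr 1
        refine lintegral_mono_ae ?_
        filter_upwards [h.right] with y hy
        rw [lintegral_mul_const]
        · gcongr
        · exact hk.comp (measurable_id.prodMk measurable_const)
    _ = _ := by
        rw [lintegral_const_mul' _ _ ENNReal.coe_ne_top, ← mul_assoc, sq]

theorem lintegral_enorm_sq_lt_top {μ : Measure α} (f : Lp ℂ 2 μ) : ∫⁻ x, ‖f x‖ₑ ^ 2 ∂μ < ⊤ := by
  have h := (Lp.memLp f).eLpNorm_lt_top
  rw [eLpNorm_lt_top_iff_lintegral_rpow_enorm_lt_top (by norm_num) (by norm_num)] at h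
  simpa using h

theorem memLp_two_of_lintegral_lt_top {μ : Measure α} {f : α → ℂ} (hf : AEStronglyMeasurable f μ)
    (h : ∫⁻ x, ‖f x‖ₑ ^ 2 ∂μ < ⊤) : MemLp f 2 μ := by
  refine ⟨hf, ?_⟩
  rw [eLpNorm_lt_top_iff_lintegral_rpow_enorm_lt_top (by norm_num) (by norm_num)]
  simpa using h

theorem enorm_sq_Lp {μ : Measure α} (f : Lp ℂ 2 μ) : ‖f‖ₑ ^ 2 = ∫⁻ x, ‖f x‖ₑ ^ 2 ∂μ := by
  rw [Lp.enorm_def, eLpNorm_eq_lintegral_rpow_enorm_toReal (by norm_num) (by norm_num),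
    ← ENNReal.rpow_two, ← ENNReal.rpow_mul]
  norm_num

theorem IsSchurKernel.lintegral_lt_top (h : IsSchurKernel ν k C) (f : Lp ℂ 2 ν) :
    ∫⁻ x, (∫⁻ y, ‖k x y‖ₑ * ‖f y‖ₑ ∂ν) ^ 2 ∂ν < ⊤ :=
  (h.lintegral_sq_le (Lp.stronglyMeasurable f).measurable.enorm).trans_lt
    (ENNReal.mul_lt_top (by simp) (lintegral_enorm_sq_lt_top f))

theorem IsSchurKernel.ae_integrable (h : IsSchurKernel ν k C) (f : Lp ℂ 2 ν) :
    ∀ᵐ x ∂ν, Integrable (fun y => (k x y : ℂ) * f y) ν := by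
  have hm : Measurable fun p : α × α => ‖k p.1 p.2‖ₑ * ‖f p.2‖ₑ :=
    h.meas.enorm.mul ((Lp.stronglyMeasurable f).measurable.comp measurable_snd).enorm
  filter_upwards [ae_lt_top (hm.lintegral_prod_right'.pow_const 2) (h.lintegral_lt_top f).ne]
    with x hx
  refine ⟨((h.measurable_mul f).comp (measurable_const.prodMk measurable_id)).aestronglyMeasurable,
    ?_⟩
  simp only [HasFiniteIntegral, enorm_mul, enorm_ofReal_complex]
  simpa using hx

theorem IsSchurKernel.stronglyMeasurable_integral (h : IsSchurKernel ν k C) (f : Lp ℂ 2 ν) :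
    StronglyMeasurable fun x => ∫ y, (k x y : ℂ) * f y ∂ν :=
  (h.measurable_mul f).stronglyMeasurable.integral_prod_right

theorem IsSchurKernel.lintegral_integral_le (h : IsSchurKernel ν k C) (f : Lp ℂ 2 ν) :
    ∫⁻ x, ‖∫ y, (k x y : ℂ) * f y ∂ν‖ₑ ^ 2 ∂ν ≤ C ^ 2 * ∫⁻ y, ‖f y‖ₑ ^ 2 ∂ν := by
  refine le_trans (lintegral_mono fun x => ?_)
    (h.lintegral_sq_le (Lp.stronglyMeasurable f).measurable.enorm)
  gcongr
  refine (enorm_integral_le_lintegral_enorm _).trans (le_of_eq ?_)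
  simp [enorm_mul, enorm_ofReal_complex]

theorem IsSchurKernel.memLp (h : IsSchurKernel ν k C) (f : Lp ℂ 2 ν) :
    MemLp (fun x => ∫ y, (k x y : ℂ) * f y ∂ν) 2 ν :=
  memLp_two_of_lintegral_lt_top (h.stronglyMeasurable_integral f).aestronglyMeasurable
    ((h.lintegral_integral_le f).trans_lt
      (ENNReal.mul_lt_top (by simp) (lintegral_enorm_sq_lt_top f)))

/-- The bounded operator on `L²(ν)` with a kernel that satisfies the Schur test. -/
def integralOp (h : IsSchurKernel ν k C) : Lp ℂ 2 ν →L[ℂ] Lp ℂ 2 ν :=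
  LinearMap.mkContinuous
    { toFun := fun f => (h.memLp f).toLp
      map_add' := fun f g => by
        rw [← MemLp.toLp_add]
        refine MemLp.toLp_congr _ _ ?_
        filter_upwards [h.ae_integrable f, h.ae_integrable g] with x hf hg
        rw [Pi.add_apply, ← integral_add hf hg]
        refine integral_congr_ae ?_
        filter_upwards [Lp.coeFn_add f g] with y hy
        rw [hy, Pi.add_apply, mul_add]
      map_smul' := fun c f => by
        rw [RingHom.id_apply, ← MemLp.toLp_const_smul]
        refine MemLp.toLp_congr _ _ (Eventually.of_forall fun x => ?_)
        rw [Pi.smul_apply, smul_eq_mul, ← integral_const_mul]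
        refine integral_congr_ae ?_
        filter_upwards [Lp.coeFn_smul c f] with y hy
        rw [hy, Pi.smul_apply, smul_eq_mul]
        ring } C fun f => by
    have h1 : ‖(h.memLp f).toLp‖ₑ ^ 2 ≤ (C * ‖f‖ₑ) ^ 2 := by
      rw [enorm_sq_Lp, mul_pow, enorm_sq_Lp]
      refine le_trans (le_of_eq ?_) (h.lintegral_integral_le f)
      refine lintegral_congr_ae ?_
      filter_upwards [(h.memLp f).coeFn_toLp] with x hx
      rw [hx]
    have h2 := (ENNReal.pow_le_pow_left_iff two_ne_zero).1 h1
    rw [enorm_eq_nnnorm, enorm_eq_nnnorm] at h2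
    exact_mod_cast h2

theorem integralOp_ae (h : IsSchurKernel ν k C) (f : Lp ℂ 2 ν) :
    integralOp h f =ᵐ[ν] fun x => ∫ y, (k x y : ℂ) * f y ∂ν :=
  (h.memLp f).coeFn_toLp

theorem norm_integralOp_le (h : IsSchurKernel ν k C) : ‖integralOp h‖ ≤ C :=
  LinearMap.mkContinuous_norm_le _ C.2 _

theorem inner_integralOp_left (h : IsSchurKernel ν k C) (f g : Lp ℂ 2 ν) :
    inner ℂ (integralOp h f) g = inner ℂ f (integralOp h.swap g) := by
  have hm : Measurable fun p : α × α => (k p.1 p.2 : ℂ) * starRingEnd ℂ (f p.2) * g p.1 := by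
    have h1 := (Lp.stronglyMeasurable f).measurable.comp (measurable_snd : Measurable (Prod.snd : α × α → α))
    have h2 := (Lp.stronglyMeasurable g).measurable.comp (measurable_fst : Measurable (Prod.fst : α × α → α))
    exact ((Complex.measurable_ofReal.comp h.meas).mul
      (Complex.continuous_conj.measurable.comp h1)).mul h2
  have hI : Integrable (fun p : α × α => (k p.1 p.2 : ℂ) * starRingEnd ℂ (f p.2) * g p.1)
      (ν.prod ν) := by
    refine ⟨hm.aestronglyMeasurable, ?_⟩
    have hf := (Lp.stronglyMeasurable f).measurable.enorm
    have hg := (Lp.stronglyMeasurable g).measurable.enorm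
    have hm1 : Measurable fun p : α × α => ‖k p.1 p.2‖ₑ * ‖f p.2‖ₑ :=
      h.meas.enorm.mul (hf.comp measurable_snd)
    rw [HasFiniteIntegral, lintegral_prod _ hm.enorm.aemeasurable]
    calc ∫⁻ x, ∫⁻ y, ‖(k x y : ℂ) * starRingEnd ℂ (f y) * g x‖ₑ ∂ν ∂ν
        = ∫⁻ x, (∫⁻ y, ‖k x y‖ₑ * ‖f y‖ₑ ∂ν) * ‖g x‖ₑ ∂ν := by
          refine lintegral_congr fun x => ?_
          rw [← lintegral_mul_const]
          · simp [enorm_mul, enorm_ofReal_complex]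
          · exact hm1.comp (measurable_const.prodMk measurable_id)
      _ ≤ ∫⁻ x, ((∫⁻ y, ‖k x y‖ₑ * ‖f y‖ₑ ∂ν) ^ 2 + ‖g x‖ₑ ^ 2) ∂ν :=
          lintegral_mono fun x => mul_le_sq_add_sq_ennreal _ _
      _ < ⊤ := by
          rw [lintegral_add_right _ (hg.pow_const 2)]
          exact ENNReal.add_lt_top.2 ⟨h.lintegral_lt_top f, lintegral_enorm_sq_lt_top g⟩
  rw [L2.inner_def, L2.inner_def]
  calc ∫ x, inner ℂ (integralOp h f x) (g x) ∂ν
      = ∫ x, ∫ y, (k x y : ℂ) * starRingEnd ℂ (f y) * g x ∂ν ∂ν := by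
        refine integral_congr_ae ?_
        filter_upwards [integralOp_ae h f] with x hx
        rw [hx, RCLike.inner_apply, ← integral_conj, mul_comm, ← integral_mul_const]
        simp
    _ = ∫ y, ∫ x, (k x y : ℂ) * starRingEnd ℂ (f y) * g x ∂ν ∂ν :=
        integral_integral_swap (f := fun x y => (k x y : ℂ) * starRingEnd ℂ (f y) * g x) hI
    _ = ∫ y, inner ℂ (f y) (integralOp h.swap g y) ∂ν := by
        refine integral_congr_ae ?_
        filter_upwards [integralOp_ae h.swap g] with y hy
        rw [hy, RCLike.inner_apply, ← integral_mul_const]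
        refine integral_congr_ae (Eventually.of_forall fun x => ?_)
        simp only
        ring

end SchurTest

/-! ### Bounds and asymptotics of the complementary error function -/

section Erfc

theorem integrable_exp_neg_sq : Integrable fun u : ℝ => Real.exp (-u ^ 2) := by
  simpa using integrable_exp_neg_mul_sq (b := 1) one_pos

theorem integral_exp_neg_sq : ∫ u : ℝ, Real.exp (-u ^ 2) = Real.sqrt Real.pi := by
  simpa using integral_gaussian 1

theorem erfc_eq (w : ℝ) :
    erfc w = erfc 0 - 2 / Real.sqrt Real.pi * ∫ u in (0 : ℝ)..w, Real.exp (-u ^ 2) := by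
  have h := intervalIntegral.integral_interval_add_Ioi (a := 0) (b := w) (μ := volume)
    (f := fun u : ℝ => Real.exp (-u ^ 2)) integrable_exp_neg_sq.integrableOn
    integrable_exp_neg_sq.integrableOn
  rw [erfc, erfc, ← h]
  ring

theorem hasDerivAt_erfc (w : ℝ) :
    HasDerivAt erfc (-(2 / Real.sqrt Real.pi * Real.exp (-w ^ 2))) w := by
  have hc : Continuous fun u : ℝ => Real.exp (-u ^ 2) := by fun_prop
  have h1 := (hc.integral_hasStrictDerivAt 0 w).hasDerivAt
  have h2 := (h1.const_mul (2 / Real.sqrt Real.pi)).const_sub (erfc 0)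
  refine h2.congr_of_eventuallyEq (Eventually.of_forall erfc_eq)

theorem continuous_erfc : Continuous erfc :=
  continuous_iff_continuousAt.2 fun w => (hasDerivAt_erfc w).continuousAt

theorem erfc_nonneg (w : ℝ) : 0 ≤ erfc w :=
  mul_nonneg (by positivity) (integral_nonneg fun u => (Real.exp_pos _).le)

theorem erfc_le_two (w : ℝ) : erfc w ≤ 2 := by
  have h : ∫ u in Set.Ioi w, Real.exp (-u ^ 2) ≤ Real.sqrt Real.pi := by
    rw [← integral_exp_neg_sq]
    exact setIntegral_le_integral integrable_exp_neg_sq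
      (Eventually.of_forall fun u => (Real.exp_pos _).le)
  have hpi : 0 < Real.sqrt Real.pi := Real.sqrt_pos.2 Real.pi_pos
  rw [erfc, div_mul_eq_mul_div, div_le_iff₀ hpi]
  linarith

/-- For u > w ≥ 0 one has u² ≥ w² + (u - w)², so the tail is at most exp(-w²) times a full Gaussian
integral. -/
theorem erfc_le_exp {w : ℝ} (hw : 0 ≤ w) : erfc w ≤ 2 * Real.exp (-w ^ 2) := by
  have hint : Integrable fun u : ℝ => Real.exp (-(u - w) ^ 2) :=
    integrable_exp_neg_sq.comp_sub_right w
  have hpi : 0 < Real.sqrt Real.pi := Real.sqrt_pos.2 Real.pi_pos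
  have h : ∫ u in Set.Ioi w, Real.exp (-u ^ 2) ≤ Real.exp (-w ^ 2) * Real.sqrt Real.pi := by
    calc ∫ u in Set.Ioi w, Real.exp (-u ^ 2)
        ≤ ∫ u in Set.Ioi w, Real.exp (-w ^ 2) * Real.exp (-(u - w) ^ 2) := by
          refine setIntegral_mono_on integrable_exp_neg_sq.integrableOn
            (hint.const_mul _).integrableOn measurableSet_Ioi fun u hu => ?_
          rw [← Real.exp_add, Real.exp_le_exp]
          have : w < u := hu
          nlinarith
      _ ≤ ∫ u : ℝ, Real.exp (-w ^ 2) * Real.exp (-(u - w) ^ 2) :=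
          setIntegral_le_integral (hint.const_mul _) (Eventually.of_forall fun u => by positivity)
      _ = _ := by
          rw [integral_const_mul, integral_sub_right_eq_self (fun u : ℝ => Real.exp (-u ^ 2)),
            integral_exp_neg_sq]
  rw [erfc, div_mul_eq_mul_div, div_le_iff₀ hpi]
  linarith

theorem tendsto_erfc_atTop : Tendsto erfc atTop (𝓝 0) := by
  have h1 : Tendsto (fun w : ℝ => 2 * Real.exp (-w ^ 2)) atTop (𝓝 0) := by
    have h2 : Tendsto (fun w : ℝ => -w ^ 2) atTop atBot :=
      tendsto_neg_atTop_atBot.comp (tendsto_pow_atTop two_ne_zero)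
    simpa using (Real.tendsto_exp_atBot.comp h2).const_mul 2
  refine squeeze_zero' (Eventually.of_forall erfc_nonneg) ?_ h1
  filter_upwards [eventually_ge_atTop 0] with w hw using erfc_le_exp hw

theorem nonneg_of_deriv_nonpos_of_tendsto_zero {G G' : ℝ → ℝ}
    (hG : ∀ x, 0 < x → HasDerivAt G (G' x) x) (hG' : ∀ x, 0 < x → G' x ≤ 0)
    (hlim : Tendsto G atTop (𝓝 0)) {x : ℝ} (hx : 0 < x) : 0 ≤ G x := by
  have hanti : AntitoneOn G (Set.Ioi 0) := by
    refine antitoneOn_of_deriv_nonpos (convex_Ioi 0)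
      (fun x hx => (hG x hx).continuousAt.continuousWithinAt) ?_ ?_
    · intro x hx
      rw [interior_Ioi] at hx
      exact (hG x hx).differentiableAt.differentiableWithinAt
    · intro x hx
      rw [interior_Ioi] at hx
      rw [(hG x hx).deriv]
      exact hG' x hx
  refine le_of_tendsto hlim ?_
  filter_upwards [eventually_ge_atTop x] with y hy
  exact hanti hx (hx.trans_le hy) hy

theorem tendsto_exp_neg_sq_mul_inv : Tendsto (fun w : ℝ => Real.exp (-w ^ 2) * w⁻¹) atTop (𝓝 0) := by
  have h2 : Tendsto (fun w : ℝ => -w ^ 2) atTop atBot :=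
    tendsto_neg_atTop_atBot.comp (tendsto_pow_atTop two_ne_zero)
  simpa using (Real.tendsto_exp_atBot.comp h2).mul tendsto_inv_atTop_zero

theorem hasDerivAt_exp_neg_sq (w : ℝ) :
    HasDerivAt (fun w : ℝ => Real.exp (-w ^ 2)) (Real.exp (-w ^ 2) * (-(2 * w))) w := by
  simpa using ((hasDerivAt_id w).pow 2).neg.exp

/-- The error in the leading term of the asymptotics of the complementary error function. -/
theorem abs_erfc_asymptotics_le {w : ℝ} (hw : 0 < w) :
    |Real.sqrt Real.pi * w * Real.exp (w ^ 2) * erfc w - 1| ≤ 1 / (2 * w ^ 2) := by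
  have hpi : 0 < Real.sqrt Real.pi := Real.sqrt_pos.2 Real.pi_pos
  have hinv : ∀ w : ℝ, 0 < w → HasDerivAt (fun w : ℝ => w⁻¹) (-(w ^ 2)⁻¹) w :=
    fun w hw => hasDerivAt_inv hw.ne'
  have herfc : Tendsto (fun w => Real.sqrt Real.pi * erfc w) atTop (𝓝 0) := by
    simpa using tendsto_erfc_atTop.const_mul (Real.sqrt Real.pi)
  have herfc' : ∀ w, HasDerivAt (fun w => Real.sqrt Real.pi * erfc w)
      (-(2 * Real.exp (-w ^ 2))) w := by
    intro w
    refine ((hasDerivAt_erfc w).const_mul _).congr_deriv ?_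
    field_simp
  -- The first and second partial sums of the expansion √π erfc w ~ exp(-w²)(1/w - 1/(2w³) + …)
  -- bound it from above and from below. In both cases the difference vanishes at infinity and has a
  -- derivative of constant sign.
  have hup : 0 ≤ Real.exp (-w ^ 2) * w⁻¹ - Real.sqrt Real.pi * erfc w := by
    refine nonneg_of_deriv_nonpos_of_tendsto_zero
      (G := fun w => Real.exp (-w ^ 2) * w⁻¹ - Real.sqrt Real.pi * erfc w)
      (G' := fun w => -(Real.exp (-w ^ 2) * (w ^ 2)⁻¹))
      (fun x hx => ?_) (fun x hx => ?_) ?_ hw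
    · refine (((hasDerivAt_exp_neg_sq x).mul (hinv x hx)).sub (herfc' x)).congr_deriv ?_
      field_simp
      ring
    · have := Real.exp_pos (-x ^ 2)
      have : 0 ≤ Real.exp (-x ^ 2) * (x ^ 2)⁻¹ := by positivity
      linarith
    · simpa using tendsto_exp_neg_sq_mul_inv.sub herfc
  have hlo : 0 ≤ Real.sqrt Real.pi * erfc w -
      Real.exp (-w ^ 2) * w⁻¹ * (1 - 2⁻¹ * (w⁻¹ * w⁻¹)) := by
    refine nonneg_of_deriv_nonpos_of_tendsto_zero
      (G := fun w => Real.sqrt Real.pi * erfc w -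
        Real.exp (-w ^ 2) * w⁻¹ * (1 - 2⁻¹ * (w⁻¹ * w⁻¹)))
      (G' := fun w => -(3 / 2 * Real.exp (-w ^ 2) * (w ^ 4)⁻¹))
      (fun x hx => ?_) (fun x hx => ?_) ?_ hw
    · refine ((herfc' x).sub (((hasDerivAt_exp_neg_sq x).mul (hinv x hx)).mul
        ((((hinv x hx).mul (hinv x hx)).const_mul (2⁻¹ : ℝ)).const_sub 1))).congr_deriv ?_
      simp only [Pi.mul_apply]
      field_simp
      ring
    · have : 0 ≤ 3 / 2 * Real.exp (-x ^ 2) * (x ^ 4)⁻¹ := by positivity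
      linarith
    · have h1 : Tendsto (fun w : ℝ => 1 - 2⁻¹ * (w⁻¹ * w⁻¹)) atTop (𝓝 1) := by
        simpa using ((tendsto_inv_atTop_zero.mul tendsto_inv_atTop_zero).const_mul
          (2⁻¹ : ℝ)).const_sub (1 : ℝ)
      simpa using herfc.sub (tendsto_exp_neg_sq_mul_inv.mul h1)
  have he : Real.exp (w ^ 2) * Real.exp (-w ^ 2) = 1 := by
    rw [← Real.exp_add]; simp
  have e1 : Real.sqrt Real.pi * w * Real.exp (w ^ 2) * erfc w - 1 =
      -(w * Real.exp (w ^ 2) * (Real.exp (-w ^ 2) * w⁻¹ - Real.sqrt Real.pi * erfc w)) := by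
    have : w * Real.exp (w ^ 2) * (Real.exp (-w ^ 2) * w⁻¹) = 1 := by
      rw [mul_mul_mul_comm, mul_comm w, mul_assoc, mul_comm (Real.exp (-w ^ 2)),
        ← mul_assoc, mul_comm w, mul_assoc]
      field_simp
      linarith
    linear_combination this
  have e2 : Real.sqrt Real.pi * w * Real.exp (w ^ 2) * erfc w - 1 =
      w * Real.exp (w ^ 2) * (Real.sqrt Real.pi * erfc w -
        Real.exp (-w ^ 2) * w⁻¹ * (1 - 2⁻¹ * (w⁻¹ * w⁻¹))) - 1 / (2 * w ^ 2) := by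
    have h1 : w * w⁻¹ = 1 := mul_inv_cancel₀ hw.ne'
    have h2 : 1 / (2 * w ^ 2) = 2⁻¹ * (w⁻¹ * w⁻¹) := by field_simp
    rw [h2]
    generalize w⁻¹ = v at *
    linear_combination ((1 - 2⁻¹ * (v * v)) * Real.exp (w ^ 2) * Real.exp (-w ^ 2)) * h1 +
      (1 - 2⁻¹ * (v * v)) * he
  have hwe : 0 ≤ w * Real.exp (w ^ 2) := by positivity
  rw [abs_le]
  constructor
  · rw [e2]; nlinarith [mul_nonneg hwe hlo]
  · rw [e1]
    have : 0 ≤ 1 / (2 * w ^ 2) := by positivity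
    nlinarith [mul_nonneg hwe hup]

end Erfc

/-! ### The Gaussian and the Robin tail -/

section Kernel

theorem gauss_nonneg (t x : ℝ) : 0 ≤ gauss t x := by
  unfold gauss; positivity

theorem gauss_neg (t x : ℝ) : gauss t (-x) = gauss t x := by
  simp [gauss]

theorem hasDerivAt_gauss {t : ℝ} (x : ℝ) :
    HasDerivAt (fun x => gauss t x) (-(x / (2 * t)) * gauss t x) x := by
  have h : HasDerivAt (fun x : ℝ => -x ^ 2 / (4 * t)) (-(2 * x) / (4 * t)) x := by
    simpa using (((hasDerivAt_id x).pow 2).neg).div_const (4 * t)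
  refine ((h.exp).const_mul (1 / Real.sqrt (4 * Real.pi * t))).congr_deriv ?_
  unfold gauss
  rw [show -(2 * x) / (4 * t) = -(x / (2 * t)) by rw [neg_div, mul_div_mul_comm]; norm_num; ring]
  ring

theorem hasDerivAt_mul_gauss {t : ℝ} (ht : 0 < t) (x : ℝ) :
    HasDerivAt (fun x => -(x / (2 * t)) * gauss t x)
      ((x ^ 2 / (4 * t ^ 2) - 1 / (2 * t)) * gauss t x) x := by
  refine ((((hasDerivAt_id x).div_const (2 * t)).neg).mul (hasDerivAt_gauss x)).congr_deriv ?_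
  simp only [id, Pi.neg_apply]
  field_simp
  ring

theorem hasDerivAt_gauss_time {t : ℝ} (ht : 0 < t) (x : ℝ) :
    HasDerivAt (fun t => gauss t x) ((x ^ 2 / (4 * t ^ 2) - 1 / (2 * t)) * gauss t x) t := by
  have hpos : 0 < 4 * Real.pi * t := by positivity
  have h1 : HasDerivAt (fun t : ℝ => -x ^ 2 / (4 * t)) (x ^ 2 / (4 * t ^ 2)) t := by
    refine ((hasDerivAt_const t (-x ^ 2)).div ((hasDerivAt_id t).const_mul 4)
      (by simpa using ht.ne')).congr_deriv ?_
    simp only [id]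
    field_simp
    ring
  have h2 : HasDerivAt (fun t : ℝ => 1 / Real.sqrt (4 * Real.pi * t))
      (-(1 / (2 * t)) * (1 / Real.sqrt (4 * Real.pi * t))) t := by
    have h3 := ((hasDerivAt_id t).const_mul (4 * Real.pi)).sqrt (by simpa using hpos.ne')
    have h4 := (hasDerivAt_const t (1 : ℝ)).div h3 (by simpa using (Real.sqrt_pos.2 hpos).ne')
    refine h4.congr_deriv ?_
    simp only [id]
    have hs := Real.sq_sqrt hpos.le
    have := (Real.sqrt_pos.2 hpos)
    generalize Real.sqrt (4 * Real.pi * t) = r at *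
    rw [hs]
    field_simp
    ring
  refine (h2.mul h1.exp).congr_deriv ?_
  unfold gauss
  ring

/-- The function `∫ z in Ioi 0, exp (l z) g_t(s + z)`, in terms of `erfc`. -/
def robinTail (l t s : ℝ) : ℝ :=
  1 / 2 * Real.exp (l ^ 2 * t - l * s) * erfc (s / (2 * Real.sqrt t) - l * Real.sqrt t)

/-- Completing the square: l²t - ls - (s/(2√t) - l√t)² = -s²/(4t). Through it the derivative of
`erfc` inside `robinTail` becomes a Gaussian. -/
theorem exp_mul_exp_neg_sq {t : ℝ} (ht : 0 < t) (l s : ℝ) :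
    Real.exp (l ^ 2 * t - l * s) * Real.exp (-(s / (2 * Real.sqrt t) - l * Real.sqrt t) ^ 2) =
      Real.sqrt (4 * Real.pi * t) * gauss t s := by
  have hpos : 0 < 4 * Real.pi * t := by positivity
  have h := (Real.sqrt_pos.2 ht)
  have hs := Real.sq_sqrt ht.le
  rw [gauss, ← mul_assoc, mul_one_div_cancel (Real.sqrt_pos.2 hpos).ne', one_mul, ← Real.exp_add]
  congr 1
  generalize Real.sqrt t = r at *
  rw [← hs]
  field_simp
  ring

theorem hFun_eq {t : ℝ} (ht : 0 < t) (s l : ℝ) : hFun t s l = -(2 * l * robinTail l t s) := by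
  have h := exp_mul_exp_neg_sq ht l s
  unfold hFun robinTail
  set w := s / (2 * Real.sqrt t) - l * Real.sqrt t
  have he : Real.exp (w ^ 2) * Real.exp (-w ^ 2) = 1 := by
    rw [← Real.exp_add]; simp
  linear_combination l * Real.exp (w ^ 2) * erfc w * h -
    l * erfc w * Real.exp (l ^ 2 * t - l * s) * he

theorem sqrt_four_pi_mul (t : ℝ) :
    Real.sqrt (4 * Real.pi * t) = 2 * Real.sqrt Real.pi * Real.sqrt t := by
  rw [Real.sqrt_mul (by positivity), Real.sqrt_mul (by norm_num),
    show (4 : ℝ) = 2 ^ 2 by norm_num, Real.sqrt_sq (by norm_num)]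

/-- The equation q' = -l q - g is what produces the boundary condition, and it makes q'' an
expression in q and g again. -/
theorem hasDerivAt_robinTail {t : ℝ} (ht : 0 < t) (l s : ℝ) :
    HasDerivAt (fun s => robinTail l t s) (-(l * robinTail l t s) - gauss t s) s := by
  have h1 : HasDerivAt (fun s => Real.exp (l ^ 2 * t - l * s))
      (Real.exp (l ^ 2 * t - l * s) * (-l)) s := by
    simpa using (((hasDerivAt_id s).const_mul l).const_sub (l ^ 2 * t)).exp
  have h2 : HasDerivAt (fun s => s / (2 * Real.sqrt t) - l * Real.sqrt t)
      (1 / (2 * Real.sqrt t)) s := by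
    simpa using ((hasDerivAt_id s).div_const (2 * Real.sqrt t)).sub_const (l * Real.sqrt t)
  refine ((h1.const_mul (1 / 2)).mul ((hasDerivAt_erfc _).comp s h2)).congr_deriv ?_
  have h := exp_mul_exp_neg_sq ht l s
  rw [sqrt_four_pi_mul t] at h
  unfold robinTail
  simp only [Function.comp_apply]
  have hpi : 0 < Real.sqrt Real.pi := Real.sqrt_pos.2 Real.pi_pos
  have hr := (Real.sqrt_pos.2 ht)
  set w := s / (2 * Real.sqrt t) - l * Real.sqrt t
  have h3 : gauss t s = Real.exp (l ^ 2 * t - l * s) * Real.exp (-w ^ 2) /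
      (2 * Real.sqrt Real.pi * Real.sqrt t) := by
    rw [h]; field_simp
  rw [h3]
  field_simp
  ring

/-- The value is the second space derivative -l q' - g', written out with q' = -l q - g and g' =
-(s/2t) g: the tail solves the heat equation. -/
theorem hasDerivAt_robinTail_time {t : ℝ} (ht : 0 < t) (l s : ℝ) :
    HasDerivAt (fun t => robinTail l t s)
      (l ^ 2 * robinTail l t s + l * gauss t s + s / (2 * t) * gauss t s) t := by
  have h1 : HasDerivAt (fun t => Real.exp (l ^ 2 * t - l * s))
      (Real.exp (l ^ 2 * t - l * s) * (l ^ 2)) t := by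
    simpa using (((hasDerivAt_id t).const_mul (l ^ 2)).sub_const (l * s)).exp
  have hsq : HasDerivAt (fun t => Real.sqrt t) (1 / (2 * Real.sqrt t)) t :=
    Real.hasDerivAt_sqrt ht.ne'
  have hr := (Real.sqrt_pos.2 ht)
  have h2 : HasDerivAt (fun t => s / (2 * Real.sqrt t) - l * Real.sqrt t)
      (-(s / (4 * t * Real.sqrt t)) - l / (2 * Real.sqrt t)) t := by
    refine (((hasDerivAt_const t s).div (hsq.const_mul 2) (by positivity)).sub
      (hsq.const_mul l)).congr_deriv ?_
    have hs := Real.sq_sqrt ht.le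
    generalize Real.sqrt t = r at *
    rw [← hs]
    field_simp
    ring
  refine ((h1.const_mul (1 / 2)).mul ((hasDerivAt_erfc _).comp t h2)).congr_deriv ?_
  have h := exp_mul_exp_neg_sq ht l s
  rw [sqrt_four_pi_mul t] at h
  unfold robinTail
  simp only [Function.comp_apply]
  have hpi : 0 < Real.sqrt Real.pi := Real.sqrt_pos.2 Real.pi_pos
  have h3 : gauss t s = Real.exp (l ^ 2 * t - l * s) *
      Real.exp (-(s / (2 * Real.sqrt t) - l * Real.sqrt t) ^ 2) /
      (2 * Real.sqrt Real.pi * Real.sqrt t) := by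
    rw [h]; field_simp
  rw [h3]
  have hs := Real.sq_sqrt ht.le
  generalize erfc (s / (2 * Real.sqrt t) - l * Real.sqrt t) = E
  generalize Real.exp (-(s / (2 * Real.sqrt t) - l * Real.sqrt t) ^ 2) = E2
  generalize Real.exp (l ^ 2 * t - l * s) = E1
  generalize Real.sqrt t = r at *
  rw [← hs]
  field_simp
  ring

theorem robinTail_nonneg (l t s : ℝ) : 0 ≤ robinTail l t s :=
  mul_nonneg (by positivity) (erfc_nonneg _)

/-- With w the argument of `erfc`: for w ≥ 0 the bound erfc w ≤ 2 exp(-w²) and the completed square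
suffice. For w ≤ 0 one has s ≤ 2lt, hence s²/(4t) ≤ ls, and erfc w ≤ 2 is enough. -/
theorem robinTail_le {t s : ℝ} (ht : 0 < t) (l : ℝ) (hs : 0 ≤ s) :
    robinTail l t s ≤ Real.exp (l ^ 2 * t) * Real.exp (-s ^ 2 / (4 * t)) := by
  have hr := (Real.sqrt_pos.2 ht)
  have hsq := Real.sq_sqrt ht.le
  have key : Real.exp (-(l * s)) * erfc (s / (2 * Real.sqrt t) - l * Real.sqrt t) ≤
      2 * Real.exp (-s ^ 2 / (4 * t)) := by
    rcases le_total 0 (s / (2 * Real.sqrt t) - l * Real.sqrt t) with h | h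
    · calc _ ≤ Real.exp (-(l * s)) *
            (2 * Real.exp (-(s / (2 * Real.sqrt t) - l * Real.sqrt t) ^ 2)) := by
            gcongr; exact erfc_le_exp h
        _ = 2 * Real.exp (-(l * s) + -(s / (2 * Real.sqrt t) - l * Real.sqrt t) ^ 2) := by
            rw [Real.exp_add]; ring
        _ ≤ _ := by
            gcongr
            generalize Real.sqrt t = r at *
            have : -(l * s) + -(s / (2 * r) - l * r) ^ 2 = -s ^ 2 / (4 * t) - l ^ 2 * t := by
              rw [← hsq]; field_simp; ring
            have h2 : 0 ≤ l ^ 2 * t := by positivity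
            linarith
    · calc _ ≤ Real.exp (-(l * s)) * 2 := by
            gcongr; exact erfc_le_two _
        _ ≤ _ := by
            rw [mul_comm]
            gcongr
            generalize Real.sqrt t = r at *
            have h1 : s ≤ 2 * (l * t) := by
              have : s / (2 * r) ≤ l * r := by linarith
              rw [div_le_iff₀ (by positivity)] at this
              rw [← hsq]; linarith
            rw [le_div_iff₀ (by positivity)]
            nlinarith
  unfold robinTail
  rw [sub_eq_add_neg, Real.exp_add]
  have := Real.exp_pos (l ^ 2 * t)
  nlinarith

end Kernel

/-! ### The half-line Robin heat kernel and its estimates -/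

section KernelBounds

/-- The heat kernel of the half-line with the boundary condition `l u(0) + u'(0) = 0`. -/
def robinKernel (l t x y : ℝ) : ℝ :=
  gauss t (x - y) + gauss t (x + y) + 2 * l * robinTail l t (x + y)

/-- The derivative of `robinKernel l t x y` in `y`. -/
def robinKernelDeriv (l t x y : ℝ) : ℝ :=
  (x - y) / (2 * t) * gauss t (x - y) - (x + y) / (2 * t) * gauss t (x + y) +
    2 * l * (-(l * robinTail l t (x + y)) - gauss t (x + y))

/-- The second derivative of `robinKernel l t x y` in `y`, and its derivative in `t`. -/
def robinKernelDeriv2 (l t x y : ℝ) : ℝ :=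
  ((x - y) ^ 2 / (4 * t ^ 2) - 1 / (2 * t)) * gauss t (x - y) +
    ((x + y) ^ 2 / (4 * t ^ 2) - 1 / (2 * t)) * gauss t (x + y) +
    2 * l * (l ^ 2 * robinTail l t (x + y) + l * gauss t (x + y) +
      (x + y) / (2 * t) * gauss t (x + y))

theorem robinKernel_symm (l t x y : ℝ) : robinKernel l t x y = robinKernel l t y x := by
  rw [robinKernel, robinKernel, ← gauss_neg t (x - y), neg_sub, add_comm x y]

/-- At y = 0 the derivatives of the two Gaussians cancel, and the tail contributes 2l(-l q - g) =
-l(2g + 2l q). -/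
theorem robinKernelDeriv_zero (l t x : ℝ) :
    robinKernelDeriv l t x 0 + l * robinKernel l t x 0 = 0 := by
  simp only [robinKernel, robinKernelDeriv, sub_zero, add_zero]
  ring

theorem hasDerivAt_robinKernel {t : ℝ} (ht : 0 < t) (l x y : ℝ) :
    HasDerivAt (fun y => robinKernel l t x y) (robinKernelDeriv l t x y) y := by
  have h1 : HasDerivAt (fun y : ℝ => x - y) (-1) y := by
    simpa using (hasDerivAt_id y).const_sub x
  have h2 : HasDerivAt (fun y : ℝ => x + y) 1 y := by
    simpa using (hasDerivAt_id y).const_add x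
  refine ((((hasDerivAt_gauss (t := t) (x - y)).comp y h1).add
    ((hasDerivAt_gauss (t := t) (x + y)).comp y h2)).add
    (((hasDerivAt_robinTail ht l (x + y)).comp y h2).const_mul (2 * l))).congr_deriv ?_
  rw [robinKernelDeriv]
  ring

theorem hasDerivAt_robinKernelDeriv {t : ℝ} (ht : 0 < t) (l x y : ℝ) :
    HasDerivAt (fun y => robinKernelDeriv l t x y) (robinKernelDeriv2 l t x y) y := by
  have h1 : HasDerivAt (fun y : ℝ => x - y) (-1) y := by
    simpa using (hasDerivAt_id y).const_sub x
  have h2 : HasDerivAt (fun y : ℝ => x + y) 1 y := by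
    simpa using (hasDerivAt_id y).const_add x
  have h := (((((hasDerivAt_mul_gauss ht (x - y)).comp y h1).neg).add
    ((hasDerivAt_mul_gauss ht (x + y)).comp y h2)).add
    (((((hasDerivAt_robinTail ht l (x + y)).comp y h2).const_mul l).neg.sub
      ((hasDerivAt_gauss (t := t) (x + y)).comp y h2)).const_mul (2 * l)))
  refine (h.congr_of_eventuallyEq (Eventually.of_forall fun z => ?_)).congr_deriv ?_
  · simp only [robinKernelDeriv, Pi.add_apply, Pi.neg_apply, Pi.sub_apply, Function.comp_apply]
    ring
  · rw [robinKernelDeriv2]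
    ring

/-- The derivative coincides with the second derivative in y from `hasDerivAt_robinKernelDeriv`;
this is the heat equation for the kernel. -/
theorem hasDerivAt_robinKernel_time {t : ℝ} (ht : 0 < t) (l x y : ℝ) :
    HasDerivAt (fun t => robinKernel l t x y) (robinKernelDeriv2 l t x y) t := by
  refine (((hasDerivAt_gauss_time ht (x - y)).add (hasDerivAt_gauss_time ht (x + y))).add
    ((hasDerivAt_robinTail_time ht l (x + y)).const_mul (2 * l))).congr_deriv ?_
  rw [robinKernelDeriv2]

theorem measurable_gauss : Measurable fun p : ℝ × ℝ => gauss p.1 p.2 := by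
  unfold gauss; fun_prop

theorem measurable_robinTail (l : ℝ) : Measurable fun p : ℝ × ℝ => robinTail l p.1 p.2 := by
  unfold robinTail
  have := continuous_erfc.measurable
  fun_prop

theorem measurable_robinKernel (l : ℝ) :
    Measurable fun p : ℝ × ℝ × ℝ => robinKernel l p.1 p.2.1 p.2.2 := by
  unfold robinKernel
  have h1 : Measurable fun p : ℝ × ℝ × ℝ => gauss p.1 (p.2.1 - p.2.2) :=
    measurable_gauss.comp (by fun_prop : Measurable fun p : ℝ × ℝ × ℝ => (p.1, p.2.1 - p.2.2))
  have h2 : Measurable fun p : ℝ × ℝ × ℝ => gauss p.1 (p.2.1 + p.2.2) :=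
    measurable_gauss.comp (by fun_prop : Measurable fun p : ℝ × ℝ × ℝ => (p.1, p.2.1 + p.2.2))
  have h3 : Measurable fun p : ℝ × ℝ × ℝ => robinTail l p.1 (p.2.1 + p.2.2) :=
    (measurable_robinTail l).comp
      (by fun_prop : Measurable fun p : ℝ × ℝ × ℝ => (p.1, p.2.1 + p.2.2))
  exact (h1.add h2).add (h3.const_mul _)

/-- From (|r| - 6t)² ≥ 0 one gets 3|r| - r²/(4t) ≤ 9t ≤ 9b. -/
theorem exp_neg_sq_div_le {t b : ℝ} (ht : 0 < t) (htb : t ≤ b) (r : ℝ) :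
    Real.exp (-r ^ 2 / (4 * t)) ≤ Real.exp (9 * b) * Real.exp (-(3 * |r|)) := by
  rw [← Real.exp_add, Real.exp_le_exp, div_le_iff₀ (by positivity), ← sq_abs r]
  nlinarith [sq_nonneg (|r| - 6 * t), abs_nonneg r]

/-- The Gaussian decays at rate 3 uniformly for t in [a, b]. One factor exp(-|r|) is spent on the
polynomial prefactors of the derivatives, leaving rate 2. -/
theorem exists_gauss_bounds {a b : ℝ} (ha : 0 < a) :
    ∃ M, 0 ≤ M ∧ ∀ t, a ≤ t → t ≤ b → ∀ r,
      gauss t r ≤ M * Real.exp (-(2 * |r|)) ∧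
      |r / (2 * t) * gauss t r| ≤ M * Real.exp (-(2 * |r|)) ∧
      |(r ^ 2 / (4 * t ^ 2) - 1 / (2 * t)) * gauss t r| ≤ M * Real.exp (-(2 * |r|)) := by
  set M₀ := 1 / Real.sqrt (4 * Real.pi * a) * Real.exp (9 * b) with hM₀
  have hM₀0 : 0 ≤ M₀ := by positivity
  have hg : ∀ t, a ≤ t → t ≤ b → ∀ r, gauss t r ≤ M₀ * Real.exp (-(3 * |r|)) := by
    intro t hat htb r
    rw [hM₀, mul_assoc]
    unfold gauss
    have := Real.pi_pos
    refine mul_le_mul ?_ (exp_neg_sq_div_le (ha.trans_le hat) htb r) (Real.exp_pos _).le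
      (by positivity)
    exact one_div_le_one_div_of_le (Real.sqrt_pos.2 (by positivity)) (Real.sqrt_le_sqrt (by gcongr))
  have he : ∀ r : ℝ, Real.exp (-(3 * |r|)) * Real.exp |r| = Real.exp (-(2 * |r|)) := by
    intro r; rw [← Real.exp_add]; ring_nf
  have hq : ∀ r : ℝ, 1 + |r| + |r| ^ 2 / 2 ≤ Real.exp |r| := fun r =>
    Real.quadratic_le_exp_of_nonneg (abs_nonneg r)
  have key : ∀ t, a ≤ t → t ≤ b → ∀ r c A, |c| ≤ A * Real.exp |r| →
      |c * gauss t r| ≤ A * M₀ * Real.exp (-(2 * |r|)) := by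
    intro t hat htb r c A hc
    rw [abs_mul, abs_of_nonneg (gauss_nonneg t r), ← he]
    calc |c| * gauss t r ≤ (A * Real.exp |r|) * (M₀ * Real.exp (-(3 * |r|))) :=
          mul_le_mul hc (hg t hat htb r) (gauss_nonneg t r) ((abs_nonneg _).trans hc)
      _ = _ := by ring
  refine ⟨(1 + 1 / (2 * a) + 1 / a ^ 2) * M₀, by positivity, fun t hat htb r => ?_⟩
  have ht := ha.trans_le hat
  have hr := abs_nonneg r
  have hqr := hq r
  have h1a : 0 ≤ 1 / (2 * a) := by positivity
  have h2a : 0 ≤ 1 / a ^ 2 := by positivity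
  have h1t : 1 / (2 * t) ≤ 1 / (2 * a) := one_div_le_one_div_of_le (by positivity) (by linarith)
  have h2t : 1 / t ^ 2 ≤ 1 / a ^ 2 := one_div_le_one_div_of_le (by positivity) (by gcongr)
  have h1t0 : 0 ≤ 1 / (2 * t) := by positivity
  have h2t0 : 0 ≤ 1 / t ^ 2 := by positivity
  have he1 : 1 ≤ Real.exp |r| := Real.one_le_exp hr
  refine ⟨?_, key t hat htb r _ _ ?_, key t hat htb r _ _ ?_⟩
  · have := key t hat htb r 1 (1 + 1 / (2 * a) + 1 / a ^ 2) (by rw [abs_one]; nlinarith)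
    rw [one_mul] at this
    exact (le_abs_self _).trans this
  · rw [show r / (2 * t) = r * (1 / (2 * t)) by ring, abs_mul, abs_of_nonneg h1t0]
    have : |r| * (1 / (2 * t)) ≤ Real.exp |r| * (1 / (2 * a)) := by
      apply mul_le_mul _ h1t h1t0 (Real.exp_pos _).le
      nlinarith
    nlinarith
  · have h3 : r ^ 2 / (4 * t ^ 2) = |r| ^ 2 / 4 * (1 / t ^ 2) := by
      rw [sq_abs]; field_simp
    refine (abs_sub _ _).trans ?_
    rw [h3, abs_of_nonneg h1t0, abs_of_nonneg (by positivity)]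
    have : |r| ^ 2 / 4 * (1 / t ^ 2) ≤ Real.exp |r| * (1 / a ^ 2) := by
      apply mul_le_mul _ h2t h2t0 (Real.exp_pos _).le
      nlinarith
    nlinarith

/-- Rate 2 in y beats the growth exp(y) allowed to domain elements in `IsRegularPair.exists_bound`,
so every integral against them converges. Uniformity in t provides the domination for
differentiating in time. -/
theorem exists_robinKernel_bounds (l : ℝ) {a b : ℝ} (ha : 0 < a) :
    ∃ M, 0 ≤ M ∧ ∀ t, a ≤ t → t ≤ b → ∀ x y, 0 ≤ x → 0 ≤ y →
      |robinKernel l t x y| ≤ M * Real.exp (2 * x) * Real.exp (-(2 * y)) ∧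
      |robinKernelDeriv l t x y| ≤ M * Real.exp (2 * x) * Real.exp (-(2 * y)) ∧
      |robinKernelDeriv2 l t x y| ≤ M * Real.exp (2 * x) * Real.exp (-(2 * y)) := by
  obtain ⟨M, hM, hMt⟩ := exists_gauss_bounds (b := b) ha
  -- The class of functions with the desired bound is closed under sums and scalar multiples, so
  -- only the building blocks need estimates.
  let P : (ℝ → ℝ → ℝ → ℝ) → Prop := fun f => ∃ M, 0 ≤ M ∧ ∀ t, a ≤ t → t ≤ b → ∀ x y, 0 ≤ x →
    0 ≤ y → |f t x y| ≤ M * (Real.exp (2 * x) * Real.exp (-(2 * y)))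
  have Padd : ∀ {f g}, P f → P g → P fun t x y => f t x y + g t x y := by
    rintro f g ⟨M, hM, hf⟩ ⟨N, hN, hg⟩
    refine ⟨M + N, by positivity, fun t h1 h2 x y h3 h4 => ?_⟩
    rw [add_mul]
    exact (abs_add_le _ _).trans (add_le_add (hf t h1 h2 x y h3 h4) (hg t h1 h2 x y h3 h4))
  have Pmul : ∀ {f} (c : ℝ), P f → P fun t x y => c * f t x y := by
    rintro f c ⟨M, hM, hf⟩
    refine ⟨|c| * M, by positivity, fun t h1 h2 x y h3 h4 => ?_⟩
    rw [abs_mul, mul_assoc]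
    exact mul_le_mul_of_nonneg_left (hf t h1 h2 x y h3 h4) (abs_nonneg c)
  have hm : ∀ x y : ℝ, Real.exp (-(2 * |x - y|)) ≤ Real.exp (2 * x) * Real.exp (-(2 * y)) := by
    intro x y
    rw [← Real.exp_add, Real.exp_le_exp]
    have := neg_le_abs (x - y)
    linarith
  have hp : ∀ x y : ℝ, 0 ≤ x → 0 ≤ y →
      Real.exp (-(2 * |x + y|)) ≤ Real.exp (2 * x) * Real.exp (-(2 * y)) := by
    intro x y hx hy
    rw [← Real.exp_add, Real.exp_le_exp, abs_of_nonneg (by positivity)]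
    linarith
  have g1 : P fun t x y => gauss t (x - y) := ⟨M, hM, fun t h1 h2 x y h3 h4 => by
    rw [abs_of_nonneg (gauss_nonneg _ _)]
    exact (hMt t h1 h2 _).1.trans (mul_le_mul_of_nonneg_left (hm x y) hM)⟩
  have g2 : P fun t x y => gauss t (x + y) := ⟨M, hM, fun t h1 h2 x y h3 h4 => by
    rw [abs_of_nonneg (gauss_nonneg _ _)]
    exact (hMt t h1 h2 _).1.trans (mul_le_mul_of_nonneg_left (hp x y h3 h4) hM)⟩
  have d1 : P fun t x y => (x - y) / (2 * t) * gauss t (x - y) := ⟨M, hM, fun t h1 h2 x y h3 h4 =>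
    (hMt t h1 h2 _).2.1.trans (mul_le_mul_of_nonneg_left (hm x y) hM)⟩
  have d2 : P fun t x y => (x + y) / (2 * t) * gauss t (x + y) := ⟨M, hM, fun t h1 h2 x y h3 h4 =>
    (hMt t h1 h2 _).2.1.trans (mul_le_mul_of_nonneg_left (hp x y h3 h4) hM)⟩
  have e1 : P fun t x y => ((x - y) ^ 2 / (4 * t ^ 2) - 1 / (2 * t)) * gauss t (x - y) :=
    ⟨M, hM, fun t h1 h2 x y h3 h4 =>
      (hMt t h1 h2 _).2.2.trans (mul_le_mul_of_nonneg_left (hm x y) hM)⟩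
  have e2 : P fun t x y => ((x + y) ^ 2 / (4 * t ^ 2) - 1 / (2 * t)) * gauss t (x + y) :=
    ⟨M, hM, fun t h1 h2 x y h3 h4 =>
      (hMt t h1 h2 _).2.2.trans (mul_le_mul_of_nonneg_left (hp x y h3 h4) hM)⟩
  have q : P fun t x y => robinTail l t (x + y) := by
    refine ⟨Real.exp (l ^ 2 * b) * Real.exp (9 * b), by positivity, fun t h1 h2 x y h3 h4 => ?_⟩
    rw [abs_of_nonneg (robinTail_nonneg _ _ _), mul_assoc]
    have ht := ha.trans_le h1
    refine (robinTail_le ht l (by positivity)).trans ?_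
    refine mul_le_mul (Real.exp_le_exp.2 (by gcongr)) ?_ (Real.exp_pos _).le (Real.exp_pos _).le
    refine (exp_neg_sq_div_le ht h2 _).trans ?_
    gcongr
    refine le_trans ?_ (hp x y h3 h4)
    rw [Real.exp_le_exp]
    linarith [abs_nonneg (x + y)]
  obtain ⟨M₁, hM₁, h₁⟩ : P (robinKernel l) := Padd (Padd g1 g2) (Pmul (2 * l) q)
  obtain ⟨M₂, hM₂, h₂⟩ : P (robinKernelDeriv l) := by
    have := Padd (Padd d1 (Pmul (-1) d2)) (Pmul (2 * l) (Padd (Pmul (-l) q) (Pmul (-1) g2)))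
    refine (congrArg P ?_).mp this
    funext t x y
    rw [robinKernelDeriv]
    ring
  obtain ⟨M₃, hM₃, h₃⟩ : P (robinKernelDeriv2 l) :=
    Padd (Padd e1 e2) (Pmul (2 * l) (Padd (Padd (Pmul (l ^ 2) q) (Pmul l g2)) d2))
  refine ⟨M₁ + M₂ + M₃, by positivity, fun t h1 h2 x y h3 h4 => ?_⟩
  rw [mul_assoc]
  refine ⟨(h₁ t h1 h2 x y h3 h4).trans ?_, (h₂ t h1 h2 x y h3 h4).trans ?_,
    (h₃ t h1 h2 x y h3 h4).trans ?_⟩ <;>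
  · gcongr
    linarith

theorem integrable_gauss {t : ℝ} (ht : 0 < t) : Integrable fun x => gauss t x := by
  have h := (integrable_exp_neg_mul_sq (b := 1 / (4 * t)) (by positivity)).const_mul
    (1 / Real.sqrt (4 * Real.pi * t))
  refine h.congr (Eventually.of_forall fun x => ?_)
  simp only [gauss]
  congr 2
  field_simp

theorem integral_gauss {t : ℝ} (ht : 0 < t) : ∫ x, gauss t x = 1 := by
  have h := integral_gaussian (1 / (4 * t))
  have hp : 0 < Real.sqrt (4 * Real.pi * t) := Real.sqrt_pos.2 (by positivity)
  calc ∫ x, gauss t x = ∫ x : ℝ, 1 / Real.sqrt (4 * Real.pi * t) *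
        Real.exp (-(1 / (4 * t)) * x ^ 2) := by
        refine integral_congr_ae (Eventually.of_forall fun x => ?_)
        simp only [gauss]
        congr 2
        field_simp
    _ = 1 := by
        rw [integral_const_mul, h, show Real.pi / (1 / (4 * t)) = 4 * Real.pi * t by
          field_simp]
        field_simp

theorem lintegral_gauss {t : ℝ} (ht : 0 < t) : ∫⁻ x, ENNReal.ofReal (gauss t x) = 1 := by
  rw [← ofReal_integral_eq_lintegral_ofReal (integrable_gauss ht)
    (Eventually.of_forall fun x => gauss_nonneg t x), integral_gauss ht, ENNReal.ofReal_one]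

theorem robinTail_le_gauss {t s : ℝ} (ht : 0 < t) (l : ℝ) (hs : 0 ≤ s) :
    robinTail l t s ≤ Real.exp (l ^ 2 * t) * Real.sqrt (4 * Real.pi * t) * gauss t s := by
  refine (robinTail_le ht l hs).trans (le_of_eq ?_)
  have hp : 0 < Real.sqrt (4 * Real.pi * t) := Real.sqrt_pos.2 (by positivity)
  rw [gauss]
  field_simp

/-- A bound of the integrals of `robinKernel l t`. -/
def robinConst (l t : ℝ) : NNReal :=
  ⟨(2 + 8 * |l|) * Real.exp ((l ^ 2 + 1) * t), by positivity⟩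

/-- From π ≤ 4 and t ≤ exp(2t) follows √(4πt) ≤ 4 exp(t). The square root is traded for the extra 1
in the growth rate l² + 1, which yields an exponential bound valid for all t > 0. -/
theorem robinTail_le_four_gauss {t s : ℝ} (ht : 0 < t) (l : ℝ) (hs : 0 ≤ s) :
    robinTail l t s ≤ 4 * Real.exp ((l ^ 2 + 1) * t) * gauss t s := by
  have h1 : Real.sqrt (4 * Real.pi * t) ≤ 4 * Real.exp t := by
    have h4 : Real.sqrt (4 * Real.pi * t) ≤ Real.sqrt ((4 * Real.exp t) ^ 2) := by
      refine Real.sqrt_le_sqrt ?_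
      have h2 := Real.pi_le_four
      have h3 := Real.add_one_le_exp t
      have h5 : t ≤ Real.exp t ^ 2 := by nlinarith
      nlinarith
    rwa [Real.sqrt_sq (by positivity)] at h4
  refine (robinTail_le_gauss ht l hs).trans ?_
  refine mul_le_mul_of_nonneg_right ?_ (gauss_nonneg t s)
  calc Real.exp (l ^ 2 * t) * Real.sqrt (4 * Real.pi * t)
      ≤ Real.exp (l ^ 2 * t) * (4 * Real.exp t) := by gcongr
    _ = _ := by rw [add_mul (l ^ 2), one_mul, Real.exp_add]; ring

theorem abs_robinKernel_le {t x y : ℝ} (ht : 0 < t) (l : ℝ) (hxy : 0 ≤ x + y) :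
    |robinKernel l t x y| ≤ gauss t (x - y) +
      (1 + 8 * |l| * Real.exp ((l ^ 2 + 1) * t)) * gauss t (x + y) := by
  have h3 := robinTail_le_four_gauss ht l hxy
  have hg := gauss_nonneg t (x + y)
  rw [robinKernel]
  refine (abs_add_three _ _ _).trans ?_
  rw [abs_mul, abs_mul, abs_two, abs_of_nonneg (gauss_nonneg t (x - y)), abs_of_nonneg hg,
    abs_of_nonneg (robinTail_nonneg l t _)]
  have := mul_le_mul_of_nonneg_left h3 (abs_nonneg l)
  linarith

theorem lintegral_robinKernel_le {t x : ℝ} (ht : 0 < t) (l : ℝ) (hx : 0 ≤ x) :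
    ∫⁻ y in Set.Ici 0, ‖robinKernel l t x y‖ₑ ≤ robinConst l t := by
  set c := 1 + 8 * |l| * Real.exp ((l ^ 2 + 1) * t) with hc
  have hc0 : 0 ≤ c := by positivity
  have m1 : Measurable fun y => ENNReal.ofReal (gauss t (x - y)) :=
    (measurable_gauss.comp (by fun_prop : Measurable fun y : ℝ => (t, x - y))).ennreal_ofReal
  have m2 : Measurable fun y => ENNReal.ofReal (gauss t (x + y)) :=
    (measurable_gauss.comp (by fun_prop : Measurable fun y : ℝ => (t, x + y))).ennreal_ofReal
  calc ∫⁻ y in Set.Ici 0, ‖robinKernel l t x y‖ₑ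
      ≤ ∫⁻ y in Set.Ici 0, (ENNReal.ofReal (gauss t (x - y)) +
          ENNReal.ofReal c * ENNReal.ofReal (gauss t (x + y))) := by
        refine setLIntegral_mono' measurableSet_Ici fun y hy => ?_
        have hy : 0 ≤ y := hy
        rw [← ENNReal.ofReal_mul hc0, ← ENNReal.ofReal_add (gauss_nonneg _ _)
          (mul_nonneg hc0 (gauss_nonneg _ _)), ← ofReal_norm, Real.norm_eq_abs]
        exact ENNReal.ofReal_le_ofReal (abs_robinKernel_le ht l (add_nonneg hx hy))
    _ ≤ ∫⁻ y, (ENNReal.ofReal (gauss t (x - y)) +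
          ENNReal.ofReal c * ENNReal.ofReal (gauss t (x + y))) := setLIntegral_le_lintegral _ _
    _ = 1 + ENNReal.ofReal c := by
        rw [lintegral_add_left m1, lintegral_const_mul _ m2,
          lintegral_sub_left_eq_self (fun y => ENNReal.ofReal (gauss t y)) x,
          lintegral_add_left_eq_self (fun y => ENNReal.ofReal (gauss t y)) x,
          lintegral_gauss ht, mul_one]
    _ ≤ _ := by
        rw [← ENNReal.ofReal_one, ← ENNReal.ofReal_add zero_le_one hc0,
          show ((robinConst l t : NNReal) : ENNReal) =
            ENNReal.ofReal ((2 + 8 * |l|) * Real.exp ((l ^ 2 + 1) * t)) by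
            rw [ENNReal.ofReal, Real.toNNReal_of_nonneg (by positivity)]; rfl]
        refine ENNReal.ofReal_le_ofReal ?_
        have : 1 ≤ Real.exp ((l ^ 2 + 1) * t) := Real.one_le_exp (by positivity)
        rw [hc]
        linarith

theorem isSchurKernel_robinKernel {t : ℝ} (ht : 0 < t) (l : ℝ) :
    IsSchurKernel (volume.restrict (Set.Ici (0 : ℝ))) (robinKernel l t) (robinConst l t) where
  meas := (measurable_robinKernel l).comp
    (by fun_prop : Measurable fun p : ℝ × ℝ => (t, p.1, p.2))
  left := by
    filter_upwards [ae_restrict_mem measurableSet_Ici] with x hx using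
      lintegral_robinKernel_le ht l hx
  right := by
    filter_upwards [ae_restrict_mem measurableSet_Ici] with x hx
    simp only [fun y => robinKernel_symm l t y x]
    exact lintegral_robinKernel_le ht l hx

end KernelBounds

/-! ### Absolutely continuous complex-valued functions -/

section AbsolutelyContinuous

theorem absolutelyContinuousOnInterval_of_hasDerivWithinAt {f f' : ℝ → ℂ} {a b C : ℝ} (hab : a ≤ b)
    (hf : ∀ x ∈ Set.Icc a b, HasDerivWithinAt f (f' x) (Set.Icc a b) x)
    (hC : ∀ x ∈ Set.Icc a b, ‖f' x‖ ≤ C) : AbsolutelyContinuousOnInterval f a b := by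
  have hC0 : 0 ≤ C := (norm_nonneg _).trans (hC a (Set.left_mem_Icc.2 hab))
  refine LipschitzOnWith.absolutelyContinuousOnInterval (K := ⟨C, hC0⟩) ?_
  rw [Set.uIcc_of_le hab]
  exact (convex_Icc a b).lipschitzOnWith_of_nnnorm_hasDerivWithin_le hf hC

theorem absolutelyContinuousOnInterval_integral {g : ℝ → ℂ} {a b : ℝ}
    (hg : IntervalIntegrable g volume a b) :
    AbsolutelyContinuousOnInterval (fun x => ∫ y in a..x, g y) a b := by
  have hre : IntervalIntegrable (fun x => (g x).re) volume a b :=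
    ⟨hg.1.re, hg.2.re⟩
  have him : IntervalIntegrable (fun x => (g x).im) volume a b :=
    ⟨hg.1.im, hg.2.im⟩
  have ofReal : ∀ h : ℝ → ℝ, AbsolutelyContinuousOnInterval h a b →
      AbsolutelyContinuousOnInterval (fun x => (h x : ℂ)) a b := by
    intro h hh
    rw [absolutelyContinuousOnInterval_iff] at hh ⊢
    simpa [Complex.dist_eq, ← Complex.ofReal_sub, Complex.norm_real, Real.dist_eq] using hh
  have h1 := ofReal _ (hre.absolutelyContinuousOnInterval_intervalIntegral Set.left_mem_uIcc)
  have h2 := ofReal _ (him.absolutelyContinuousOnInterval_intervalIntegral Set.left_mem_uIcc)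
  have h3 := h1.fun_add (h2.const_smul Complex.I)
  rw [absolutelyContinuousOnInterval_iff] at h3 ⊢
  have key : ∀ x ∈ Set.uIcc a b, (∫ y in a..x, g y) = ((∫ y in a..x, (g y).re : ℝ) : ℂ) +
      Complex.I • ((∫ y in a..x, (g y).im : ℝ) : ℂ) := by
    intro x hx
    have hsub : Set.uIcc a x ⊆ Set.uIcc a b := Set.uIcc_subset_uIcc Set.left_mem_uIcc hx
    rw [smul_eq_mul, mul_comm, ← intervalIntegral.integral_ofReal, ← intervalIntegral.integral_ofReal,
      ← intervalIntegral.integral_mul_const, ← intervalIntegral.integral_add]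
    · simp
    · exact ⟨(hre.mono_set hsub).1.ofReal, (hre.mono_set hsub).2.ofReal⟩
    · exact IntervalIntegrable.mul_const
        ⟨(him.mono_set hsub).1.ofReal, (him.mono_set hsub).2.ofReal⟩ _
  intro ε hε
  obtain ⟨δ, hδ, h⟩ := h3 ε hε
  refine ⟨δ, hδ, fun I hI hlt => ?_⟩
  refine lt_of_eq_of_lt (Finset.sum_congr rfl fun i hi => ?_) (h I hI hlt)
  rw [key _ (hI.1 i hi).1, key _ (hI.1 i hi).2]

/-- Subtracting the primitive of g leaves an absolutely continuous function with zero derivative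
almost everywhere, hence a constant. -/
theorem integral_eq_sub_of_absolutelyContinuous {w g : ℝ → ℂ} {a b : ℝ}
    (hw : AbsolutelyContinuousOnInterval w a b)
    (hd : ∀ᵐ x, x ∈ Set.uIcc a b → HasDerivAt w (g x) x)
    (hg : IntervalIntegrable g volume a b) : ∫ x in a..b, g x = w b - w a := by
  have hac := hw.sub (absolutelyContinuousOnInterval_integral hg)
  have hz : ∀ᵐ x, x ∈ Set.uIcc a b →
      HasDerivAt (w - fun x => ∫ y in a..x, g y) 0 x := by
    filter_upwards [hd, hg.ae_hasDerivAt_integral] with x h1 h2 hx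
    simpa using (h1 hx).sub (h2 hx a Set.left_mem_uIcc)
  obtain ⟨C, hC⟩ := hac.const_of_ae_hasDerivAt_zero hz
  have ha := hC a Set.left_mem_uIcc
  have hb := hC b Set.right_mem_uIcc
  simp only [Pi.sub_apply, intervalIntegral.integral_same, sub_zero] at ha hb
  rw [ha, ← hb]
  ring

end AbsolutelyContinuous

/-! ### The half-line Laplacian and Green's identity -/

section Robin

/-- The Hilbert space of one edge. -/
abbrev HalfLine : Type := Lp ℂ 2 (volume.restrict (Set.Ici (0 : ℝ)))

/-- `u` is a representative of `ψ`, with derivative `v`, and `v` is absolutely continuous with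
derivative `φ`. -/
structure IsRegularPair (ψ φ : HalfLine) (u v : ℝ → ℂ) : Prop where
  rep : (ψ : ℝ → ℂ) =ᵐ[volume.restrict (Set.Ici (0 : ℝ))] u
  deriv : ∀ x, 0 ≤ x → HasDerivWithinAt u (v x) (Set.Ici 0) x
  ac : ∀ b, 0 ≤ b → AbsolutelyContinuousOnInterval v 0 b
  ae_deriv : ∀ᵐ x ∂(volume.restrict (Set.Ici (0 : ℝ))), HasDerivAt v ((φ : ℝ → ℂ) x) x

/-- The graph of the Laplace operator on the half-line with the boundary condition
`l u(0) + u'(0) = 0`. -/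
def IsRobin (l : ℝ) (ψ φ : HalfLine) : Prop :=
  ∃ u v, IsRegularPair ψ φ u v ∧ (l : ℂ) * u 0 + v 0 = 0

theorem HalfLine.integrableOn_Icc (f : HalfLine) (b : ℝ) : IntegrableOn f (Set.Icc 0 b) := by
  have h : MemLp f 2 (volume.restrict (Set.Icc 0 b)) :=
    (Lp.memLp f).mono_measure (Measure.restrict_mono Set.Icc_subset_Ici_self le_rfl)
  exact h.integrable (by norm_num)

theorem HalfLine.intervalIntegrable (f : HalfLine) {b : ℝ} (hb : 0 ≤ b) :
    IntervalIntegrable f volume 0 b :=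
  (intervalIntegrable_iff_integrableOn_Icc_of_le hb).2 (f.integrableOn_Icc b)

/-- From |f| ≤ 1 + |f|²; the resulting linear growth is crude but sufficient. -/
theorem HalfLine.norm_integral_le (f : HalfLine) :
    ∃ N, 0 ≤ N ∧ ∀ x, 0 ≤ x → ‖∫ y in (0 : ℝ)..x, f y‖ ≤ x + N := by
  have hsq : Integrable (fun y => ‖f y‖ ^ 2) (volume.restrict (Set.Ici (0 : ℝ))) :=
    (Lp.memLp f).integrable_norm_pow two_ne_zero
  refine ⟨∫ y in Set.Ici 0, ‖f y‖ ^ 2, by positivity, fun x hx => ?_⟩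
  refine (intervalIntegral.norm_integral_le_integral_norm hx).trans ?_
  have hsq' : IntervalIntegrable (fun y => ‖f y‖ ^ 2) volume 0 x :=
    (intervalIntegrable_iff_integrableOn_Icc_of_le hx).2
      (hsq.mono_measure (Measure.restrict_mono Set.Icc_subset_Ici_self le_rfl))
  calc ∫ y in (0 : ℝ)..x, ‖f y‖ ≤ ∫ y in (0 : ℝ)..x, (1 + ‖f y‖ ^ 2) := by
        refine intervalIntegral.integral_mono hx (f.intervalIntegrable hx).norm
          (intervalIntegrable_const.add hsq') fun y => ?_
        simp only
        nlinarith [sq_nonneg (‖f y‖ - 1), norm_nonneg (f y)]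
    _ = x + ∫ y in (0 : ℝ)..x, ‖f y‖ ^ 2 := by
        rw [intervalIntegral.integral_add intervalIntegrable_const hsq']
        simp
    _ ≤ _ := by
        gcongr
        rw [intervalIntegral.integral_of_le hx]
        exact setIntegral_mono_set hsq (Eventually.of_forall fun y => by positivity)
          (Eventually.of_forall fun y hy => le_of_lt hy.1)

variable {ψ φ : HalfLine} {u v : ℝ → ℂ}

theorem IsRegularPair.ae_deriv' (h : IsRegularPair ψ φ u v) :
    ∀ᵐ x, 0 ≤ x → HasDerivAt v ((φ : ℝ → ℂ) x) x :=
  (ae_restrict_iff' measurableSet_Ici).1 h.ae_deriv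

theorem IsRegularPair.eq_integral (h : IsRegularPair ψ φ u v) {x : ℝ} (hx : 0 ≤ x) :
    v x = v 0 + ∫ y in (0 : ℝ)..x, φ y := by
  rw [integral_eq_sub_of_absolutelyContinuous (h.ac x hx) ?_ (φ.intervalIntegrable hx)]
  · ring
  · filter_upwards [h.ae_deriv'] with y hy hyx
    rw [Set.uIcc_of_le hx] at hyx
    exact hy hyx.1

theorem IsRegularPair.continuousOn (h : IsRegularPair ψ φ u v) : ContinuousOn u (Set.Ici 0) :=
  fun x hx => (h.deriv x hx).continuousWithinAt

/-- Since v = v(0) + ∫ φ grows at most linearly, u grows at most quadratically. No integrability of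
v is needed for the boundary terms at infinity. -/
theorem IsRegularPair.exists_bound (h : IsRegularPair ψ φ u v) :
    ∃ A, 0 ≤ A ∧ ∀ x, 0 ≤ x → ‖u x‖ ≤ A * Real.exp x ∧ ‖v x‖ ≤ A * Real.exp x := by
  obtain ⟨N, hN, hφ⟩ := φ.norm_integral_le
  set B := ‖v 0‖ + 1 + N with hB
  have hB0 : 0 ≤ B := by positivity
  have hv : ∀ x, 0 ≤ x → ‖v x‖ ≤ B * (1 + x) := by
    intro x hx
    rw [h.eq_integral hx]
    refine (norm_add_le _ _).trans ?_
    have := hφ x hx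
    have := mul_nonneg (norm_nonneg (v 0)) hx
    have := mul_nonneg hN hx
    rw [hB]
    nlinarith
  have hu : ∀ x, 0 ≤ x → ‖u x‖ ≤ ‖u 0‖ + B * (1 + x) * x := by
    intro x hx
    have h1 := norm_image_sub_le_of_norm_deriv_le_segment' (f := u) (f' := v) (a := 0) (b := x)
      (C := B * (1 + x)) (fun y hy => (h.deriv y hy.1).mono Set.Icc_subset_Ici_self)
      (fun y hy => (hv y hy.1).trans (by have := hy.2.le; gcongr)) x (Set.right_mem_Icc.2 hx)
    rw [sub_zero] at h1
    have h2 := norm_sub_norm_le (u x) (u 0)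
    linarith
  refine ⟨‖u 0‖ + 2 * B, by positivity, fun x hx => ?_⟩
  have he := Real.quadratic_le_exp_of_nonneg hx
  have h0 := norm_nonneg (u 0)
  have hx2 := sq_nonneg x
  constructor
  · refine (hu x hx).trans ?_
    have h1 : ‖u 0‖ * 1 ≤ ‖u 0‖ * Real.exp x := by gcongr; exact Real.one_le_exp hx
    have h2 : B * (2 * (1 + x + x ^ 2 / 2)) ≤ B * (2 * Real.exp x) := by gcongr
    nlinarith
  · refine (hv x hx).trans ?_
    have h1 : 0 ≤ ‖u 0‖ * Real.exp x := by positivity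
    have h2 : B * (1 + x) ≤ B * (2 * Real.exp x) := by
      gcongr
      nlinarith
    nlinarith

theorem IsRegularPair.abs_continuous (h : IsRegularPair ψ φ u v) {b : ℝ} (hb : 0 ≤ b) :
    AbsolutelyContinuousOnInterval u 0 b := by
  obtain ⟨A, hA, hA'⟩ := h.exists_bound
  refine absolutelyContinuousOnInterval_of_hasDerivWithinAt (C := A * Real.exp b) hb
    (fun x hx => (h.deriv x hx.1).mono Set.Icc_subset_Ici_self) fun x hx => ?_
  refine (hA' x hx.1).2.trans ?_
  have := hx.2
  gcongr

theorem integrableOn_exp_neg : IntegrableOn (fun y : ℝ => Real.exp (-y)) (Set.Ici 0) := by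
  rw [integrableOn_Ici_iff_integrableOn_Ioi]
  simpa using exp_neg_integrableOn_Ioi 0 one_pos

theorem integrableOn_mul_of_exp_bound {k : ℝ → ℝ} {u : ℝ → ℂ} {M A : ℝ} (hM : 0 ≤ M)
    (hk : ContinuousOn k (Set.Ici 0)) (hu : ContinuousOn u (Set.Ici 0))
    (hkM : ∀ y, 0 ≤ y → |k y| ≤ M * Real.exp (-(2 * y)))
    (huA : ∀ y, 0 ≤ y → ‖u y‖ ≤ A * Real.exp y) :
    IntegrableOn (fun y => (k y : ℂ) * u y) (Set.Ici 0) := by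
  refine Integrable.mono' (integrableOn_exp_neg.const_mul (M * A)) ?_ ?_
  · exact ((Complex.continuous_ofReal.comp_continuousOn hk).mul hu).aestronglyMeasurable
      measurableSet_Ici
  · filter_upwards [ae_restrict_mem measurableSet_Ici] with y hy
    rw [norm_mul, Complex.norm_real, Real.norm_eq_abs]
    calc |k y| * ‖u y‖ ≤ (M * Real.exp (-(2 * y))) * (A * Real.exp y) :=
          mul_le_mul (hkM y hy) (huA y hy) (norm_nonneg _) (by positivity)
      _ = M * A * (Real.exp (-(2 * y)) * Real.exp y) := by ring
      _ = _ := by rw [← Real.exp_add]; ring_nf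

theorem continuous_robinKernel {t : ℝ} (ht : 0 < t) (l x : ℝ) :
    Continuous fun y => robinKernel l t x y :=
  continuous_iff_continuousAt.2 fun y => (hasDerivAt_robinKernel ht l x y).continuousAt

theorem continuous_robinKernelDeriv2 {t : ℝ} (ht : 0 < t) (l x : ℝ) :
    Continuous fun y => robinKernelDeriv2 l t x y := by
  have h1 : Continuous fun r => gauss t r := by unfold gauss; fun_prop
  have h2 : Continuous fun s => robinTail l t s :=
    continuous_iff_continuousAt.2 fun s => (hasDerivAt_robinTail ht l s).continuousAt
  unfold robinKernelDeriv2
  fun_prop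

/-- Green's identity for the kernel. -/
theorem IsRegularPair.integral_robinKernelDeriv2 (h : IsRegularPair ψ φ u v) {l : ℝ}
    (hl : (l : ℂ) * u 0 + v 0 = 0) {t x : ℝ} (ht : 0 < t) (hx : 0 ≤ x)
    (hφ : IntegrableOn (fun y => (robinKernel l t x y : ℂ) * φ y) (Set.Ici 0)) :
    ∫ y in Set.Ici 0, (robinKernelDeriv2 l t x y : ℂ) * u y =
      ∫ y in Set.Ici 0, (robinKernel l t x y : ℂ) * φ y := by
  obtain ⟨A, hA, hA'⟩ := h.exists_bound
  obtain ⟨M, hM, hM'⟩ := exists_robinKernel_bounds l (b := t) ht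
  have hb := hM' t le_rfl le_rfl x
  set N := M * Real.exp (2 * x) with hN
  have hN0 : 0 ≤ N := by positivity
  have h2u : IntegrableOn (fun y => (robinKernelDeriv2 l t x y : ℂ) * u y) (Set.Ici 0) :=
    integrableOn_mul_of_exp_bound hN0 (continuous_robinKernelDeriv2 ht l x).continuousOn
      h.continuousOn (fun y hy => (hb y hx hy).2.2) (fun y hy => (hA' y hy).1)
  -- The Wronskian of kernel and function: W' = k_yy u - k φ almost everywhere. It vanishes at 0
  -- because both factors satisfy the same boundary condition, and at infinity by the growth bounds.
  set W : ℝ → ℂ := fun y => (robinKernelDeriv l t x y : ℂ) • u y - (robinKernel l t x y : ℂ) • v y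
    with hW
  have hW0 : W 0 = 0 := by
    have h1 : (robinKernelDeriv l t x 0 : ℂ) + l * robinKernel l t x 0 = 0 := by
      exact_mod_cast congrArg (fun r : ℝ => (r : ℂ)) (robinKernelDeriv_zero l t x)
    simp only [hW, smul_eq_mul]
    linear_combination u 0 * h1 - (robinKernel l t x 0 : ℂ) * hl
  have key : ∀ b, 0 ≤ b → ∫ y in (0 : ℝ)..b, ((robinKernelDeriv2 l t x y : ℂ) * u y -
      (robinKernel l t x y : ℂ) * φ y) = W b := by
    intro b hb0
    have hexp : ∀ y : ℝ, 0 ≤ y → N * Real.exp (-(2 * y)) ≤ N := fun y hy =>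
      mul_le_of_le_one_right hN0 (Real.exp_le_one_iff.2 (by linarith))
    have a1 : AbsolutelyContinuousOnInterval (fun y => (robinKernelDeriv l t x y : ℂ)) 0 b := by
      refine absolutelyContinuousOnInterval_of_hasDerivWithinAt (C := N) hb0
        (fun y hy => ((hasDerivAt_robinKernelDeriv ht l x y).ofReal_comp).hasDerivWithinAt)
        fun y hy => ?_
      rw [Complex.norm_real, Real.norm_eq_abs]
      exact ((hb y hx hy.1).2.2).trans (hexp y hy.1)
    have a2 : AbsolutelyContinuousOnInterval (fun y => (robinKernel l t x y : ℂ)) 0 b := by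
      refine absolutelyContinuousOnInterval_of_hasDerivWithinAt (C := N) hb0
        (fun y hy => ((hasDerivAt_robinKernel ht l x y).ofReal_comp).hasDerivWithinAt)
        fun y hy => ?_
      rw [Complex.norm_real, Real.norm_eq_abs]
      exact ((hb y hx hy.1).2.1).trans (hexp y hy.1)
    have aW : AbsolutelyContinuousOnInterval W 0 b :=
      (a1.fun_smul (h.abs_continuous hb0)).fun_sub (a2.fun_smul (h.ac b hb0))
    rw [integral_eq_sub_of_absolutelyContinuous aW, hW0, sub_zero]
    -- At 0 only a one-sided derivative of u is available; this null set is discarded.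
    · have hne : ∀ᵐ y : ℝ, y ≠ 0 := by simp [ae_iff, measure_singleton]
      filter_upwards [h.ae_deriv', hne] with y hy hy0 hyb
      rw [Set.uIcc_of_le hb0] at hyb
      have hyp : 0 < y := lt_of_le_of_ne hyb.1 (Ne.symm hy0)
      have d1 := (hasDerivAt_robinKernelDeriv ht l x y).ofReal_comp
      have d2 := (hasDerivAt_robinKernel ht l x y).ofReal_comp
      have d3 : HasDerivAt u (v y) y := (h.deriv y hyb.1).hasDerivAt (Ici_mem_nhds hyp)
      have := (d1.mul d3).sub (d2.mul (hy hyb.1))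
      refine this.congr_deriv ?_
      ring
    · exact ((intervalIntegrable_iff_integrableOn_Icc_of_le hb0).2
        ((h2u.sub hφ).mono_set Set.Icc_subset_Ici_self))
  have hWlim : Tendsto W atTop (𝓝 0) := by
    have h1 : Tendsto (fun y : ℝ => 2 * N * A * Real.exp (-y)) atTop (𝓝 0) := by
      simpa using (Real.tendsto_exp_neg_atTop_nhds_zero).const_mul (2 * N * A)
    refine squeeze_zero_norm' ?_ h1
    filter_upwards [eventually_ge_atTop 0] with y hy
    obtain ⟨b1, b2, -⟩ := hb y hx hy
    obtain ⟨c1, c2⟩ := hA' y hy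
    simp only [hW, smul_eq_mul]
    refine (norm_sub_le _ _).trans ?_
    rw [norm_mul, norm_mul, Complex.norm_real, Complex.norm_real, Real.norm_eq_abs,
      Real.norm_eq_abs]
    calc _ ≤ (N * Real.exp (-(2 * y))) * (A * Real.exp y) +
          (N * Real.exp (-(2 * y))) * (A * Real.exp y) := by gcongr
      _ = 2 * N * A * (Real.exp (-(2 * y)) * Real.exp y) := by ring
      _ = _ := by rw [← Real.exp_add]; ring_nf
  have hlim := intervalIntegral_tendsto_integral_Ioi 0
    ((h2u.sub hφ).mono_set Set.Ioi_subset_Ici_self) tendsto_id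
  have h0 : ∫ y in Set.Ioi 0, ((robinKernelDeriv2 l t x y : ℂ) * u y -
      (robinKernel l t x y : ℂ) * φ y) = 0 := by
    refine tendsto_nhds_unique hlim (hWlim.congr' ?_)
    filter_upwards [eventually_ge_atTop 0] with b hb0 using (key b hb0).symm
  rw [← integral_Ici_eq_integral_Ioi, integral_sub h2u hφ] at h0
  exact sub_eq_zero.1 h0

theorem IsRegularPair.hasDerivAt_integral (h : IsRegularPair ψ φ u v) {l : ℝ} {t x : ℝ}
    (ht : 0 < t) (hx : 0 ≤ x) :
    HasDerivAt (fun t => ∫ y in Set.Ici 0, (robinKernel l t x y : ℂ) * u y)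
      (∫ y in Set.Ici 0, (robinKernelDeriv2 l t x y : ℂ) * u y) t := by
  obtain ⟨A, hA, hA'⟩ := h.exists_bound
  obtain ⟨M, hM, hM'⟩ := exists_robinKernel_bounds l (a := t / 2) (b := 2 * t) (by linarith)
  set N := M * Real.exp (2 * x) with hN
  have hN0 : 0 ≤ N := by positivity
  have hs : Set.Ioo (t / 2) (2 * t) ∈ 𝓝 t := Ioo_mem_nhds (by linarith) (by linarith)
  have hint : ∀ s ∈ Set.Ioo (t / 2) (2 * t),
      IntegrableOn (fun y => (robinKernel l s x y : ℂ) * u y) (Set.Ici 0) := fun s hs =>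
    integrableOn_mul_of_exp_bound hN0
      (continuous_robinKernel (by linarith [hs.1]) l x).continuousOn h.continuousOn
      (fun y hy => (hM' s hs.1.le hs.2.le x y hx hy).1) (fun y hy => (hA' y hy).1)
  refine (hasDerivAt_integral_of_dominated_loc_of_deriv_le 
    (μ := volume.restrict (Set.Ici 0)) (F := fun s y => (robinKernel l s x y : ℂ) * u y)
    (F' := fun s y => (robinKernelDeriv2 l s x y : ℂ) * u y)
    (bound := fun y => N * A * Real.exp (-y)) hs ?_ (hint t (mem_of_mem_nhds hs)) ?_ ?_
    (integrableOn_exp_neg.const_mul (N * A)) ?_).2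
  · filter_upwards [hs] with s hs using (hint s hs).aestronglyMeasurable
  · exact ((Complex.continuous_ofReal.comp_continuousOn
      (continuous_robinKernelDeriv2 ht l x).continuousOn).mul h.continuousOn).aestronglyMeasurable
      measurableSet_Ici
  · filter_upwards [ae_restrict_mem measurableSet_Ici] with y hy s hs
    rw [norm_mul, Complex.norm_real, Real.norm_eq_abs]
    calc _ ≤ (N * Real.exp (-(2 * y))) * (A * Real.exp y) :=
          mul_le_mul (hM' s hs.1.le hs.2.le x y hx hy).2.2 (hA' y hy).1 (norm_nonneg _)
            (by positivity)
      _ = N * A * (Real.exp (-(2 * y)) * Real.exp y) := by ring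
      _ = _ := by rw [← Real.exp_add]; ring_nf
  · refine Eventually.of_forall fun y s hs => ?_
    exact ((hasDerivAt_robinKernel_time (by linarith [hs.1]) l x y).ofReal_comp).mul_const _

end Robin

/-! ### The Gaussian approximate identity on functions of exponential growth -/

section ApproximateIdentity

variable {F : Type*} [NormedAddCommGroup F] [NormedSpace ℝ F]

/-- Half of the exponent r²/(4t) absorbs |r|: completing the square leaves (|r| - 4t)²/(8t) ≥ 0. -/
theorem gauss_mul_exp_le {t : ℝ} (ht : 0 < t) (r : ℝ) :
    gauss t r * Real.exp |r| ≤ Real.sqrt 2 * Real.exp (2 * t) * gauss (2 * t) r := by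
  have hp : 0 < Real.sqrt (4 * Real.pi * t) := Real.sqrt_pos.2 (by positivity)
  have h2 : 0 < Real.sqrt 2 := by positivity
  have hs : Real.sqrt (4 * Real.pi * (2 * t)) = Real.sqrt 2 * Real.sqrt (4 * Real.pi * t) := by
    rw [← Real.sqrt_mul (by norm_num)]; congr 1; ring
  have he : Real.exp (-r ^ 2 / (4 * t)) * Real.exp |r| ≤
      Real.exp (2 * t) * Real.exp (-r ^ 2 / (4 * (2 * t))) := by
    rw [← Real.exp_add, ← Real.exp_add, Real.exp_le_exp]
    have h3 : 2 * t + -r ^ 2 / (4 * (2 * t)) - (-r ^ 2 / (4 * t) + |r|) =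
        (|r| - 4 * t) ^ 2 / (8 * t) := by
      have := sq_abs r
      field_simp
      rw [sub_sq, this]
      ring
    have : 0 ≤ (|r| - 4 * t) ^ 2 / (8 * t) := by positivity
    linarith
  rw [gauss, gauss, hs]
  calc _ = 1 / Real.sqrt (4 * Real.pi * t) * (Real.exp (-r ^ 2 / (4 * t)) * Real.exp |r|) := by ring
    _ ≤ 1 / Real.sqrt (4 * Real.pi * t) *
        (Real.exp (2 * t) * Real.exp (-r ^ 2 / (4 * (2 * t)))) := by gcongr
    _ = _ := by field_simp

/-- The factor c serves two uses: c = 1 gives integrability of the convolution, and c = √t ≤ 1 with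
unit-time Gaussian gives the dominating function after rescaling. -/
theorem norm_gauss_smul_le {w : ℝ → F} {A t x : ℝ} (ht : 0 < t)
    (hA : ∀ y, ‖w y‖ ≤ A * Real.exp |y|) (r c : ℝ) (hc0 : 0 ≤ c) (hc1 : c ≤ 1) :
    ‖gauss t r • w (x - c * r)‖ ≤
      A * Real.exp |x| * (Real.sqrt 2 * Real.exp (2 * t) * gauss (2 * t) r) := by
  have hA0 : 0 ≤ A := by simpa using (norm_nonneg _).trans (hA 0)
  rw [norm_smul, Real.norm_eq_abs, abs_of_nonneg (gauss_nonneg t r)]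
  have h1 : |x - c * r| ≤ |x| + |r| := by
    refine (abs_sub _ _).trans ?_
    rw [abs_mul, abs_of_nonneg hc0]
    have := mul_le_mul_of_nonneg_right hc1 (abs_nonneg r)
    linarith
  calc gauss t r * ‖w (x - c * r)‖ ≤ gauss t r * (A * Real.exp (|x| + |r|)) := by
        refine mul_le_mul_of_nonneg_left ((hA _).trans ?_) (gauss_nonneg t r)
        gcongr
    _ = A * Real.exp |x| * (gauss t r * Real.exp |r|) := by rw [Real.exp_add]; ring
    _ ≤ _ := by
        exact mul_le_mul_of_nonneg_left (gauss_mul_exp_le ht r) (by positivity)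

theorem continuous_gauss (t : ℝ) : Continuous (gauss t) := by
  unfold gauss; fun_prop

theorem integrable_gauss_smul {w : ℝ → F} {A t : ℝ} (x : ℝ) (ht : 0 < t)
    (hw : StronglyMeasurable w) (hA : ∀ y, ‖w y‖ ≤ A * Real.exp |y|) :
    Integrable fun y => gauss t (x - y) • w y := by
  have h : Integrable fun r => gauss t r • w (x - 1 * r) := by
    refine Integrable.mono' (((integrable_gauss (by linarith : 0 < 2 * t)).const_mul
      (Real.sqrt 2 * Real.exp (2 * t))).const_mul (A * Real.exp |x|)) ?_ (Eventually.of_forall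
        fun r => norm_gauss_smul_le ht hA r 1 zero_le_one le_rfl)
    exact (continuous_gauss t).aestronglyMeasurable.smul
      (hw.comp_measurable (by fun_prop)).aestronglyMeasurable
  simpa using h.comp_sub_left x

/-- The substitution y = x - √t z moves all dependence on t into the argument of w; then dominated
convergence applies. -/
theorem tendsto_integral_gauss_smul [CompleteSpace F] {w : ℝ → F} {A x : ℝ} (hw : StronglyMeasurable w)
    (hA : ∀ y, ‖w y‖ ≤ A * Real.exp |y|) (hc : ContinuousAt w x) :
    Tendsto (fun t => ∫ y, gauss t (x - y) • w y) (𝓝[>] 0) (𝓝 (w x)) := by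
  have hA0 : 0 ≤ A := by simpa using (norm_nonneg _).trans (hA 0)
  have hsub : ∀ t, 0 < t → ∫ y, gauss t (x - y) • w y =
      ∫ z, gauss 1 z • w (x - Real.sqrt t * z) := by
    intro t ht
    have hr := Real.sqrt_pos.2 ht
    have h1 := integral_sub_left_eq_self (fun y => gauss t y • w (x - y)) volume x
    simp only [sub_sub_cancel] at h1
    rw [h1]
    have h2 := Measure.integral_comp_mul_left (fun y => gauss t y • w (x - y)) (Real.sqrt t)
    rw [abs_of_pos (inv_pos.2 hr)] at h2
    have h3 : ∫ y, gauss t y • w (x - y) =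
        Real.sqrt t • ∫ z, gauss t (Real.sqrt t * z) • w (x - Real.sqrt t * z) := by
      rw [h2, smul_smul, mul_inv_cancel₀ hr.ne', one_smul]
    rw [h3, ← integral_smul]
    refine integral_congr_ae (Eventually.of_forall fun z => ?_)
    simp only
    rw [smul_smul]
    congr 1
    rw [gauss, gauss, Real.sqrt_mul (by positivity), mul_one]
    have hsq := Real.sq_sqrt ht.le
    have e : -(Real.sqrt t * z) ^ 2 / (4 * t) = -z ^ 2 / 4 := by
      rw [mul_pow, hsq]; field_simp
    rw [e, mul_one]
    field_simp
  have hlim : Tendsto (fun t => ∫ z, gauss 1 z • w (x - Real.sqrt t * z)) (𝓝[>] 0)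
      (𝓝 (∫ z, gauss 1 z • w x)) := by
    refine tendsto_integral_filter_of_dominated_convergence (fun z =>
      A * Real.exp |x| * (Real.sqrt 2 * Real.exp (2 * 1) * gauss (2 * 1) z)) ?_ ?_ ?_ ?_
    · refine Eventually.of_forall fun t => ?_
      exact (continuous_gauss 1).aestronglyMeasurable.smul
        (hw.comp_measurable (by fun_prop)).aestronglyMeasurable
    · filter_upwards [Ioo_mem_nhdsGT (zero_lt_one' ℝ)] with t ht
      exact Eventually.of_forall fun z => norm_gauss_smul_le one_pos hA z _ (Real.sqrt_nonneg t)
        (Real.sqrt_le_one.2 ht.2.le)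
    · exact ((integrable_gauss (by norm_num)).const_mul _).const_mul _
    · refine Eventually.of_forall fun z => Tendsto.const_smul ?_ _
      refine hc.tendsto.comp ?_
      have : Continuous fun t => x - Real.sqrt t * z := by fun_prop
      simpa using (this.tendsto 0).mono_left (nhdsWithin_le_nhds (s := Set.Ioi 0))
  rw [integral_smul_const, integral_gauss one_pos, one_smul] at hlim
  refine hlim.congr' ?_
  filter_upwards [self_mem_nhdsWithin] with t ht using (hsub t ht).symm

end ApproximateIdentity

/-! ### Initial values and the weak Duhamel identity -/

section Duhamel

variable {ψ φ : HalfLine} {u v : ℝ → ℂ}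

/-- The direct Gaussian is an approximate identity at x. The remaining part of the kernel is at most
a constant times g_t(x+y), a Gaussian centred at -x outside the half-line, and contributes nothing
in the limit. -/
theorem IsRegularPair.tendsto_integral (h : IsRegularPair ψ φ u v) (l : ℝ) {x : ℝ} (hx : 0 < x) :
    Tendsto (fun t => ∫ y in Set.Ici 0, (robinKernel l t x y : ℂ) * u y) (𝓝[>] 0) (𝓝 (u x)) := by
  obtain ⟨A, hA, hA'⟩ := h.exists_bound
  set w : ℝ → ℂ := (Set.Ici 0).indicator fun y => u (max y 0) with hw
  have hmax : Continuous fun y => u (max y 0) :=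
    h.continuousOn.comp_continuous (by fun_prop) fun y => le_max_right y 0
  have hwm : StronglyMeasurable w := hmax.stronglyMeasurable.indicator measurableSet_Ici
  have hwA : ∀ y, ‖w y‖ ≤ A * Real.exp |y| := by
    intro y
    by_cases hy : 0 ≤ y
    · simp only [hw, Set.indicator_of_mem (Set.mem_Ici.2 hy), max_eq_left hy, abs_of_nonneg hy]
      exact (hA' y hy).1
    · rw [hw, Set.indicator_of_notMem (by simpa using hy), norm_zero]
      positivity
  have hwc : w =ᶠ[𝓝 x] fun y => u (max y 0) := by
    filter_upwards [lt_mem_nhds hx] with y hy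
    simp [hw, hy.le]
  have h1 := tendsto_integral_gauss_smul hwm hwA
    (hmax.continuousAt.congr hwc.symm)
  rw [hwc.eq_of_nhds, max_eq_left hx.le] at h1
  -- The reflection y ↦ -y turns ∫ g_t(x+y) exp(y) over y ≥ 0 into a convolution with `w'`, which
  -- vanishes near x > 0.
  set w' : ℝ → ℝ := (Set.Iic 0).indicator fun y => Real.exp (-y) with hw'
  have hwm' : StronglyMeasurable w' :=
    (by fun_prop : Continuous fun y : ℝ => Real.exp (-y)).stronglyMeasurable.indicator
      measurableSet_Iic
  have hwA' : ∀ y, ‖w' y‖ ≤ 1 * Real.exp |y| := by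
    intro y
    by_cases hy : y ≤ 0
    · simp [hw', hy, abs_of_nonpos hy]
    · rw [hw', Set.indicator_of_notMem (by simpa using hy), norm_zero]
      positivity
  have hwc' : w' =ᶠ[𝓝 x] fun _ => 0 := by
    filter_upwards [lt_mem_nhds hx] with y hy
    simp [hw', hy]
  have h2 := tendsto_integral_gauss_smul hwm' hwA' (continuousAt_const.congr hwc'.symm)
  rw [hwc'.eq_of_nhds] at h2
  set c := (1 + 8 * |l| * Real.exp (l ^ 2 + 1)) * A with hc
  have hc0 : 0 ≤ c := by positivity
  have h3 : Tendsto (fun t => c * ∫ y, gauss t (x - y) • w' y) (𝓝[>] 0) (𝓝 0) := by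
    simpa using h2.const_mul c
  have key : ∀ t ∈ Set.Ioo (0 : ℝ) 1, ‖(∫ y in Set.Ici 0, (robinKernel l t x y : ℂ) * u y) -
      ∫ y, gauss t (x - y) • w y‖ ≤ c * ∫ y, gauss t (x - y) • w' y := by
    intro t ht
    obtain ⟨M, hM, hM'⟩ := exists_robinKernel_bounds l (b := t) ht.1
    have i1 : IntegrableOn (fun y => (robinKernel l t x y : ℂ) * u y) (Set.Ici 0) :=
      integrableOn_mul_of_exp_bound (by positivity) (continuous_robinKernel ht.1 l x).continuousOn
        h.continuousOn (fun y hy => (hM' t le_rfl le_rfl x y hx.le hy).1) (fun y hy => (hA' y hy).1)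
    have i2 := integrable_gauss_smul x ht.1 hwm hwA
    have i3 := integrable_gauss_smul x ht.1 hwm' hwA'
    have e1 : ∫ y, gauss t (x - y) • w y = ∫ y in Set.Ici 0, gauss t (x - y) • w y := by
      refine (setIntegral_eq_integral_of_forall_compl_eq_zero fun y hy => ?_).symm
      rw [hw, Set.indicator_of_notMem hy, smul_zero]
    have e2 : ∫ y in Set.Ici 0, gauss t (x + y) * Real.exp y =
        ∫ y, gauss t (x - y) • w' y := by
      rw [← integral_neg_eq_self (fun y => gauss t (x - y) • w' y),
        ← integral_indicator measurableSet_Ici]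
      refine integral_congr_ae (Eventually.of_forall fun y => ?_)
      by_cases hy : 0 ≤ y
      · simp [hw', hy]
      · simp [hw', hy]
    have i4 : IntegrableOn (fun y => gauss t (x + y) * Real.exp y) (Set.Ici 0) := by
      have := i3.comp_neg.integrableOn (s := Set.Ici 0)
      refine this.congr ?_
      filter_upwards [ae_restrict_mem measurableSet_Ici] with y hy
      have hy : 0 ≤ y := hy
      simp [hw', hy]
    rw [e1, ← integral_sub i1 i2.integrableOn, ← e2, ← integral_const_mul]
    refine norm_integral_le_of_norm_le (i4.const_mul c) ?_
    filter_upwards [ae_restrict_mem measurableSet_Ici] with y hy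
    have hy : 0 ≤ y := hy
    have e3 : w y = u y := by simp [hw, hy]
    have hxy : 0 ≤ x + y := by positivity
    rw [e3, Complex.real_smul, ← sub_mul, ← Complex.ofReal_sub, norm_mul, Complex.norm_real,
      Real.norm_eq_abs, robinKernel]
    have hg := gauss_nonneg t (x + y)
    have e4 : robinTail l t (x + y) ≤ 4 * Real.exp (l ^ 2 + 1) * gauss t (x + y) := by
      refine (robinTail_le_four_gauss ht.1 l hxy).trans ?_
      gcongr
      have := ht.2.le
      nlinarith [sq_nonneg l]
    have e5 : |gauss t (x - y) + gauss t (x + y) + 2 * l * robinTail l t (x + y) -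
        gauss t (x - y)| ≤ (1 + 8 * |l| * Real.exp (l ^ 2 + 1)) * gauss t (x + y) := by
      rw [add_assoc, add_sub_cancel_left]
      refine (abs_add_le _ _).trans ?_
      rw [abs_mul, abs_mul, abs_two, abs_of_nonneg hg, abs_of_nonneg (robinTail_nonneg l t _)]
      have := mul_le_mul_of_nonneg_left e4 (abs_nonneg l)
      linarith
    calc _ ≤ ((1 + 8 * |l| * Real.exp (l ^ 2 + 1)) * gauss t (x + y)) * (A * Real.exp y) :=
          mul_le_mul e5 (hA' y hy).1 (norm_nonneg _) (by positivity)
      _ = _ := by rw [hc]; ring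
  have h4 : Tendsto (fun t => (∫ y in Set.Ici 0, (robinKernel l t x y : ℂ) * u y) -
      ∫ y, gauss t (x - y) • w y) (𝓝[>] 0) (𝓝 0) := by
    refine squeeze_zero_norm' ?_ h3
    filter_upwards [Ioo_mem_nhdsGT (zero_lt_one' ℝ)] with t ht using key t ht
  simpa using h4.add h1

theorem integrableOn_robinKernel_mul (f : HalfLine) (l : ℝ) {t x : ℝ} (ht : 0 < t) (hx : 0 ≤ x) :
    IntegrableOn (fun y => (robinKernel l t x y : ℂ) * f y) (Set.Ici 0) := by
  obtain ⟨M, hM, hM'⟩ := exists_robinKernel_bounds l (b := t) ht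
  have hsq : Integrable (fun y => ‖f y‖ ^ 2) (volume.restrict (Set.Ici (0 : ℝ))) :=
    (Lp.memLp f).integrable_norm_pow two_ne_zero
  set N := M * Real.exp (2 * x)
  have hN : 0 ≤ N := by positivity
  refine Integrable.mono' ((integrableOn_exp_neg.const_mul N).add (hsq.const_mul N)) ?_ ?_
  · exact (Complex.continuous_ofReal.comp (continuous_robinKernel ht l x)).aestronglyMeasurable.mul
      (Lp.aestronglyMeasurable f)
  · filter_upwards [ae_restrict_mem measurableSet_Ici] with y hy
    have hy : 0 ≤ y := hy
    rw [norm_mul, Complex.norm_real, Real.norm_eq_abs, Pi.add_apply]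
    have h1 := (hM' t le_rfl le_rfl x y hx hy).1
    have h2 : ‖f y‖ ≤ 1 + ‖f y‖ ^ 2 := by nlinarith [sq_nonneg (‖f y‖ - 1), norm_nonneg (f y)]
    have h3 : Real.exp (-(2 * y)) ≤ Real.exp (-y) := Real.exp_le_exp.2 (by linarith)
    have h4 : Real.exp (-(2 * y)) ≤ 1 := Real.exp_le_one_iff.2 (by linarith)
    have h5 := Real.exp_pos (-(2 * y))
    calc |robinKernel l t x y| * ‖f y‖ ≤ (N * Real.exp (-(2 * y))) * (1 + ‖f y‖ ^ 2) :=
          mul_le_mul h1 h2 (norm_nonneg _) (by positivity)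
      _ = N * Real.exp (-(2 * y)) + N * (Real.exp (-(2 * y)) * ‖f y‖ ^ 2) := by ring
      _ ≤ N * Real.exp (-y) + N * (1 * ‖f y‖ ^ 2) := by gcongr
      _ = _ := by ring

/-- The heat semigroup of the half-line with the boundary condition `l u(0) + u'(0) = 0`. -/
def robinSemigroup (l t : ℝ) : HalfLine →L[ℂ] HalfLine :=
  if h : 0 < t then integralOp (isSchurKernel_robinKernel h l) else ContinuousLinearMap.id ℂ _

theorem robinSemigroup_of_pos (l : ℝ) {t : ℝ} (ht : 0 < t) :
    robinSemigroup l t = integralOp (isSchurKernel_robinKernel ht l) :=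
  dif_pos ht

theorem robinSemigroup_zero (l : ℝ) (f : HalfLine) : robinSemigroup l 0 f = f := by
  simp [robinSemigroup]

theorem robinSemigroup_ae (l : ℝ) {t : ℝ} (ht : 0 < t) (f : HalfLine) :
    robinSemigroup l t f =ᵐ[volume.restrict (Set.Ici (0 : ℝ))]
      fun x => ∫ y in Set.Ici 0, (robinKernel l t x y : ℂ) * f y := by
  rw [robinSemigroup_of_pos l ht]
  exact integralOp_ae _ f

theorem norm_robinSemigroup_le (l : ℝ) {t : ℝ} (ht : 0 ≤ t) :
    ‖robinSemigroup l t‖ ≤ (2 + 8 * |l|) * Real.exp ((l ^ 2 + 1) * t) := by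
  rcases ht.eq_or_lt with rfl | ht
  · rw [robinSemigroup, dif_neg (lt_irrefl 0), mul_zero, Real.exp_zero, mul_one]
    refine ContinuousLinearMap.norm_id_le.trans ?_
    linarith [abs_nonneg l]
  · rw [robinSemigroup_of_pos l ht]
    exact norm_integralOp_le _

theorem inner_robinSemigroup_left (l t : ℝ) (f g : HalfLine) :
    inner ℂ (robinSemigroup l t f) g = inner ℂ f (robinSemigroup l t g) := by
  by_cases ht : 0 < t
  · rw [robinSemigroup_of_pos l ht, inner_integralOp_left]
    congr 3
    funext x y
    exact robinKernel_symm l t y x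
  · rw [robinSemigroup, dif_neg ht]
    rfl

/-- For fixed x > 0 the function s ↦ ∫ k_s(x,y) u(y) dy has derivative ∫ k_s φ by Green's identity
and limit u(x) at 0, so the identity holds pointwise in x. Pairing with η and Fubini give the claim.
The weak form needs only joint measurability in (s, x), not strong continuity in s. -/
theorem weak_duhamel_robinSemigroup {l : ℝ} (h : IsRobin l ψ φ) (η : HalfLine) {t : ℝ}
    (ht : 0 ≤ t) :
    IntervalIntegrable (fun s => inner ℂ η (robinSemigroup l s φ)) volume 0 t ∧
      inner ℂ η (robinSemigroup l t ψ - ψ) =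
        ∫ s in (0 : ℝ)..t, inner ℂ η (robinSemigroup l s φ) := by
  rcases ht.eq_or_lt with rfl | ht
  · simp [robinSemigroup_zero]
  obtain ⟨u, v, huv, hl⟩ := h
  set ν := volume.restrict (Set.Ici (0 : ℝ)) with hν
  set G : ℝ × ℝ → ℂ := fun p => ∫ y, (robinKernel l p.1 p.2 y : ℂ) * φ y ∂ν with hG
  have hGm : StronglyMeasurable G := by
    have h1 : Measurable fun q : (ℝ × ℝ) × ℝ => robinKernel l q.1.1 q.1.2 q.2 :=
      (measurable_robinKernel l).comp
        (by fun_prop : Measurable fun q : (ℝ × ℝ) × ℝ => (q.1.1, q.1.2, q.2))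
    have h2 : Measurable fun q : (ℝ × ℝ) × ℝ => φ q.2 :=
      (Lp.stronglyMeasurable φ).measurable.comp measurable_snd
    exact ((Complex.measurable_ofReal.comp h1).mul h2).stronglyMeasurable.integral_prod_right'
  set J : ℝ × ℝ → ℂ := fun p => G p * starRingEnd ℂ (η p.2) with hJ
  have hJm : StronglyMeasurable J := by
    refine hGm.mul ?_
    have := (Lp.stronglyMeasurable η).measurable.comp (measurable_snd : Measurable (Prod.snd : ℝ × ℝ → ℝ))
    exact (Complex.continuous_conj.measurable.comp this).stronglyMeasurable
  have hinner : ∀ s, 0 < s → inner ℂ η (robinSemigroup l s φ) = ∫ x, J (s, x) ∂ν := by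
    intro s hs
    rw [L2.inner_def]
    refine integral_congr_ae ?_
    filter_upwards [robinSemigroup_ae l hs φ] with x hx
    rw [hx, RCLike.inner_apply]
  -- Bound |G η| by |G|² + |η|²; the Schur constants are uniform for s in (0, t].
  have hJI : Integrable J ((volume.restrict (Set.Ioc 0 t)).prod ν) := by
    refine ⟨hJm.aestronglyMeasurable, ?_⟩
    have hm1 : Measurable fun x => ‖η x‖ₑ := (Lp.stronglyMeasurable η).measurable.enorm
    rw [HasFiniteIntegral, lintegral_prod _ hJm.enorm.aemeasurable]
    calc ∫⁻ s in Set.Ioc 0 t, ∫⁻ x, ‖J (s, x)‖ₑ ∂ν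
        ≤ ∫⁻ s in Set.Ioc 0 t, ((robinConst l t : ENNReal) ^ 2 * ∫⁻ y, ‖φ y‖ₑ ^ 2 ∂ν +
            ∫⁻ y, ‖η y‖ₑ ^ 2 ∂ν) := by
          refine setLIntegral_mono' measurableSet_Ioc fun s hs => ?_
          calc ∫⁻ x, ‖J (s, x)‖ₑ ∂ν ≤ ∫⁻ x, (‖G (s, x)‖ₑ ^ 2 + ‖η x‖ₑ ^ 2) ∂ν := by
                refine lintegral_mono fun x => ?_
                simp only [hJ, enorm_mul]
                rw [show ‖starRingEnd ℂ (η x)‖ₑ = ‖η x‖ₑ by simp [enorm_eq_nnnorm]]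
                exact mul_le_sq_add_sq_ennreal _ _
            _ = ∫⁻ x, ‖G (s, x)‖ₑ ^ 2 ∂ν + ∫⁻ x, ‖η x‖ₑ ^ 2 ∂ν :=
                lintegral_add_right _ (hm1.pow_const 2)
            _ ≤ _ := by
                gcongr
                refine ((isSchurKernel_robinKernel hs.1 l).lintegral_integral_le φ).trans ?_
                gcongr
                rw [← NNReal.coe_le_coe]
                change (2 + 8 * |l|) * Real.exp ((l ^ 2 + 1) * s) ≤
                  (2 + 8 * |l|) * Real.exp ((l ^ 2 + 1) * t)
                have := hs.2
                gcongr
      _ < ⊤ := by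
          rw [setLIntegral_const]
          refine ENNReal.mul_lt_top (ENNReal.add_lt_top.2 ⟨ENNReal.mul_lt_top (by simp)
            (lintegral_enorm_sq_lt_top φ), lintegral_enorm_sq_lt_top η⟩) (by simp)
  have hcongr : ∀ᵐ s ∂(volume.restrict (Set.Ioc 0 t)), ∫ x, J (s, x) ∂ν =
      inner ℂ η (robinSemigroup l s φ) := by
    filter_upwards [ae_restrict_mem measurableSet_Ioc] with s hs using (hinner s hs.1).symm
  constructor
  · rw [intervalIntegrable_iff_integrableOn_Ioc_of_le ht.le]
    exact hJI.integral_prod_left.congr hcongr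
  rw [intervalIntegral.integral_of_le ht.le, ← integral_congr_ae hcongr,
    integral_integral_swap (f := fun s x => J (s, x)) hJI, L2.inner_def]
  refine integral_congr_ae ?_
  have hpos : ∀ᵐ x ∂ν, x ≠ 0 := ae_restrict_of_ae (by simp [ae_iff, measure_singleton])
  filter_upwards [hJI.prod_left_ae, robinSemigroup_ae l ht ψ, huv.rep, Lp.coeFn_sub
    (robinSemigroup l t ψ) ψ, hpos, ae_restrict_mem measurableSet_Ici] with x hx1 hx2 hx3 hx4 hx5 hx6
  have hx0 : 0 < x := lt_of_le_of_ne hx6 (Ne.symm hx5)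
  rw [hx4, Pi.sub_apply, hx2, hx3, RCLike.inner_apply]
  have e1 : ∫ y, (robinKernel l t x y : ℂ) * ψ y ∂ν = ∫ y, (robinKernel l t x y : ℂ) * u y ∂ν := by
    refine integral_congr_ae ?_
    filter_upwards [huv.rep] with y hy
    rw [hy]
  rw [e1]
  -- Fubini yields integrability in s of G(s, x) times the conjugate of η(x); where η(x) ≠ 0 that
  -- factor can be divided out.
  by_cases hη : η x = 0
  · simp [hJ, hη]
  have hGI : IntervalIntegrable (fun s => G (s, x)) volume 0 t := by
    rw [intervalIntegrable_iff_integrableOn_Ioc_of_le ht.le]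
    have := hx1.mul_const (starRingEnd ℂ (η x))⁻¹
    refine this.congr (Eventually.of_forall fun s => ?_)
    simp only [hJ]
    rw [mul_assoc, mul_inv_cancel₀ (by simpa using hη), mul_one]
  have hd : ∀ s, 0 < s → HasDerivAt (fun t => ∫ y, (robinKernel l t x y : ℂ) * u y ∂ν)
      (G (s, x)) s := by
    intro s hs
    have := huv.hasDerivAt_integral (l := l) hs hx0.le
    rwa [huv.integral_robinKernelDeriv2 hl hs hx0.le
      (integrableOn_robinKernel_mul φ l hs hx0.le)] at this
  have hftc := intervalIntegral.integral_eq_sub_of_hasDerivAt_of_tendsto ht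
    (fun s hs => hd s hs.1) hGI (huv.tendsto_integral l hx0)
    ((hd t ht).continuousAt.tendsto.mono_left nhdsWithin_le_nhds)
  simp only [hJ]
  rw [integral_mul_const, ← intervalIntegral.integral_of_le ht.le, hftc]

end Duhamel

/-! ### An explicit resolvent of the half-line Robin Laplacian -/

section Resolvent

/-- The kernel of the bounded right inverse of `u ↦ u' + κ u` on the half-line. -/
def volterraKernel (κ x y : ℝ) : ℝ :=
  if y ≤ x then Real.exp (-(κ * (x - y))) else 0

theorem measurable_volterraKernel (κ : ℝ) : Measurable (Function.uncurry (volterraKernel κ)) := by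
  unfold volterraKernel Function.uncurry
  exact Measurable.ite (measurableSet_le measurable_snd measurable_fst) (by fun_prop)
    measurable_const

theorem lintegral_exp_mul_Ioi {a : ℝ} (ha : a < 0) (c : ℝ) :
    ∫⁻ x in Set.Ioi c, ENNReal.ofReal (Real.exp (a * x)) =
      ENNReal.ofReal (-Real.exp (a * c) / a) := by
  rw [← ofReal_integral_eq_lintegral_ofReal (integrableOn_exp_mul_Ioi ha c)
    (Eventually.of_forall fun x => (Real.exp_pos _).le), integral_exp_mul_Ioi ha]

theorem lintegral_exp_mul_Iic {a : ℝ} (ha : 0 < a) (c : ℝ) :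
    ∫⁻ x in Set.Iic c, ENNReal.ofReal (Real.exp (a * x)) =
      ENNReal.ofReal (Real.exp (a * c) / a) := by
  rw [← ofReal_integral_eq_lintegral_ofReal (integrableOn_exp_mul_Iic ha c)
    (Eventually.of_forall fun x => (Real.exp_pos _).le), integral_exp_mul_Iic ha]

theorem isSchurKernel_volterraKernel {κ : ℝ} (hκ : 0 < κ) :
    IsSchurKernel (volume.restrict (Set.Ici (0 : ℝ))) (volterraKernel κ) (Real.toNNReal κ⁻¹) where
  meas := measurable_volterraKernel κ
  left := by
    refine Eventually.of_forall fun x => ?_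
    calc ∫⁻ y in Set.Ici 0, ‖volterraKernel κ x y‖ₑ ≤ ∫⁻ y, ‖volterraKernel κ x y‖ₑ :=
          setLIntegral_le_lintegral _ _
      _ = ∫⁻ y in Set.Iic x, ENNReal.ofReal (Real.exp (-(κ * x))) *
            ENNReal.ofReal (Real.exp (κ * y)) := by
          rw [← lintegral_indicator measurableSet_Iic]
          refine lintegral_congr fun y => ?_
          by_cases h : y ≤ x
          · rw [Set.indicator_of_mem (Set.mem_Iic.2 h), volterraKernel, if_pos h,
              ← ENNReal.ofReal_mul (Real.exp_pos _).le, ← Real.exp_add, ← ofReal_norm,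
              Real.norm_eq_abs, abs_of_pos (Real.exp_pos _)]
            ring_nf
          · rw [Set.indicator_of_notMem (by simpa using h), volterraKernel, if_neg h, enorm_zero]
      _ = ENNReal.ofReal κ⁻¹ := by
          rw [lintegral_const_mul' _ _ ENNReal.ofReal_ne_top, lintegral_exp_mul_Iic hκ,
            ← ENNReal.ofReal_mul (Real.exp_pos _).le, mul_div_assoc', ← Real.exp_add,
            neg_add_cancel, Real.exp_zero, one_div]
  right := by
    refine Eventually.of_forall fun y => ?_
    calc ∫⁻ x in Set.Ici 0, ‖volterraKernel κ x y‖ₑ ≤ ∫⁻ x, ‖volterraKernel κ x y‖ₑ :=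
          setLIntegral_le_lintegral _ _
      _ = ∫⁻ x in Set.Ici y, ENNReal.ofReal (Real.exp (κ * y)) *
            ENNReal.ofReal (Real.exp (-κ * x)) := by
          rw [← lintegral_indicator measurableSet_Ici]
          refine lintegral_congr fun x => ?_
          by_cases h : y ≤ x
          · rw [Set.indicator_of_mem (Set.mem_Ici.2 h), volterraKernel, if_pos h,
              ← ENNReal.ofReal_mul (Real.exp_pos _).le, ← Real.exp_add, ← ofReal_norm,
              Real.norm_eq_abs, abs_of_pos (Real.exp_pos _)]
            ring_nf
          · rw [Set.indicator_of_notMem (by simpa using h), volterraKernel, if_neg h, enorm_zero]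
      _ = ENNReal.ofReal κ⁻¹ := by
          rw [lintegral_const_mul' _ _ ENNReal.ofReal_ne_top, setLIntegral_congr Ioi_ae_eq_Ici.symm,
            lintegral_exp_mul_Ioi (by linarith), ← ENNReal.ofReal_mul (Real.exp_pos _).le,
            neg_div_neg_eq, mul_div_assoc', ← Real.exp_add]
          simp

theorem memLp_exp {κ : ℝ} (hκ : 0 < κ) :
    MemLp (fun x : ℝ => (Real.exp (-κ * x) : ℂ)) 2 (volume.restrict (Set.Ici (0 : ℝ))) := by
  refine memLp_two_of_lintegral_lt_top (by fun_prop) ?_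
  have : ∀ x : ℝ, ‖(Real.exp (-κ * x) : ℂ)‖ₑ ^ 2 = ENNReal.ofReal (Real.exp (-(2 * κ) * x)) := by
    intro x
    rw [enorm_ofReal_complex, ← ofReal_norm, Real.norm_eq_abs, abs_of_pos (Real.exp_pos _), sq,
      ← ENNReal.ofReal_mul (Real.exp_pos _).le, ← Real.exp_add]
    ring_nf
  simp only [this]
  rw [setLIntegral_congr Ioi_ae_eq_Ici.symm, lintegral_exp_mul_Ioi (by linarith)]
  exact ENNReal.ofReal_lt_top

/-- The exponential `x ↦ exp (-κ x)` in `L²([0, ∞))`. -/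
def expVec {κ : ℝ} (hκ : 0 < κ) : HalfLine := (memLp_exp hκ).toLp

theorem expVec_ae {κ : ℝ} (hκ : 0 < κ) : expVec hκ =ᵐ[volume.restrict (Set.Ici (0 : ℝ))]
    fun x => (Real.exp (-κ * x) : ℂ) := (memLp_exp hκ).coeFn_toLp

theorem integral_volterraKernel_swap (κ : ℝ) {x : ℝ} (hx : 0 ≤ x) (g : ℝ → ℂ) :
    ∫ y in Set.Ici 0, (volterraKernel κ y x : ℂ) * g y =
      (Real.exp (κ * x) : ℂ) * ∫ y in Set.Ioi x, (Real.exp (-κ * y) : ℂ) * g y := by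
  rw [← integral_Ici_eq_integral_Ioi, ← integral_const_mul,
    ← integral_indicator measurableSet_Ici, ← integral_indicator measurableSet_Ici]
  refine integral_congr_ae (Eventually.of_forall fun y => ?_)
  by_cases h : x ≤ y
  · have hy : 0 ≤ y := hx.trans h
    simp only [Set.indicator_of_mem (Set.mem_Ici.2 h), Set.indicator_of_mem (Set.mem_Ici.2 hy),
      volterraKernel, if_pos h]
    rw [← mul_assoc, ← Complex.ofReal_mul, ← Real.exp_add]
    ring_nf
  · by_cases hy : 0 ≤ y <;> simp [Set.indicator, volterraKernel, h, hy]

theorem integral_volterraKernel (κ : ℝ) {x : ℝ} (hx : 0 ≤ x) (f : ℝ → ℂ) :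
    ∫ y in Set.Ici 0, (volterraKernel κ x y : ℂ) * f y =
      (Real.exp (-κ * x) : ℂ) * ∫ y in (0 : ℝ)..x, (Real.exp (κ * y) : ℂ) * f y := by
  rw [intervalIntegral.integral_of_le hx, ← integral_Icc_eq_integral_Ioc, ← integral_const_mul,
    ← integral_indicator measurableSet_Ici, ← integral_indicator measurableSet_Icc]
  refine integral_congr_ae (Eventually.of_forall fun y => ?_)
  by_cases hy : 0 ≤ y <;> by_cases h : y ≤ x
  · have hyx : y ∈ Set.Icc 0 x := ⟨hy, h⟩
    simp only [Set.indicator_of_mem hyx, Set.indicator_of_mem (Set.mem_Ici.2 hy),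
      volterraKernel, if_pos h]
    rw [← mul_assoc, ← Complex.ofReal_mul, ← Real.exp_add]
    ring_nf
  all_goals simp [Set.indicator, volterraKernel, h, hy]

variable {κ : ℝ}

/-- The operator with kernel `volterraKernel κ`. -/
def volterra (hκ : 0 < κ) : HalfLine →L[ℂ] HalfLine := integralOp (isSchurKernel_volterraKernel hκ)

/-- The adjoint of `volterra`. -/
def volterraAdj (hκ : 0 < κ) : HalfLine →L[ℂ] HalfLine :=
  integralOp (isSchurKernel_volterraKernel hκ).swap

theorem volterraAdj_expVec (hκ : 0 < κ) :
    volterraAdj hκ (expVec hκ) = ((1 / (2 * κ) : ℝ) : ℂ) • expVec hκ := by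
  refine Lp.ext ?_
  filter_upwards [integralOp_ae (isSchurKernel_volterraKernel hκ).swap (expVec hκ), expVec_ae hκ,
    Lp.coeFn_smul (((1 / (2 * κ) : ℝ) : ℂ)) (expVec hκ), ae_restrict_mem measurableSet_Ici]
    with x h1 h2 h3 hx
  rw [volterraAdj, h1, h3, Pi.smul_apply, h2]
  have h4 : ∫ y in Set.Ici 0, (volterraKernel κ y x : ℂ) * expVec hκ y =
      ∫ y in Set.Ici 0, (volterraKernel κ y x : ℂ) * (Real.exp (-κ * y) : ℂ) := by
    refine integral_congr_ae ?_
    filter_upwards [expVec_ae hκ] with y hy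
    rw [hy]
  rw [h4, integral_volterraKernel_swap κ hx]
  have h5 : ∫ y in Set.Ioi x, (Real.exp (-κ * y) : ℂ) * (Real.exp (-κ * y) : ℂ) =
      ((∫ y in Set.Ioi x, Real.exp (-(2 * κ) * y) : ℝ) : ℂ) := by
    rw [← integral_complex_ofReal]
    refine integral_congr_ae (Eventually.of_forall fun y => ?_)
    simp only
    rw [← Complex.ofReal_mul, ← Real.exp_add]
    ring_nf
  rw [h5, integral_exp_mul_Ioi (by linarith), smul_eq_mul, ← Complex.ofReal_mul,
    ← Complex.ofReal_mul, neg_div_neg_eq, mul_div_assoc', ← Real.exp_add]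
  congr 1
  rw [show κ * x + -(2 * κ) * x = -κ * x by ring]
  ring

/-- The resolvent at `κ²` of the Laplace operator with the boundary condition
`l u(0) + u'(0) = 0`. -/
def robinResolvent (l : ℝ) (hκ : 0 < κ) : HalfLine →L[ℂ] HalfLine :=
  (volterraAdj hκ).comp (volterra hκ) +
    (((κ + l) / (2 * κ * (κ - l)) : ℝ) : ℂ) • (innerSL ℂ (expVec hκ)).smulRight (expVec hκ)

theorem robinResolvent_apply (l : ℝ) (hκ : 0 < κ) (f : HalfLine) :
    robinResolvent l hκ f = volterraAdj hκ (volterra hκ f) +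
      (((κ + l) / (2 * κ * (κ - l)) : ℝ) : ℂ) • (inner ℂ (expVec hκ) f • expVec hκ) := by
  simp [robinResolvent]

theorem inner_volterraAdj_left (hκ : 0 < κ) (f g : HalfLine) :
    inner ℂ (volterraAdj hκ f) g = inner ℂ f (volterra hκ g) :=
  inner_integralOp_left (isSchurKernel_volterraKernel hκ).swap f g

theorem inner_volterra_left (hκ : 0 < κ) (f g : HalfLine) :
    inner ℂ (volterra hκ f) g = inner ℂ f (volterraAdj hκ g) :=
  inner_integralOp_left (isSchurKernel_volterraKernel hκ) f g

theorem inner_robinResolvent_left (l : ℝ) (hκ : 0 < κ) (f g : HalfLine) :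
    inner ℂ (robinResolvent l hκ f) g = inner ℂ f (robinResolvent l hκ g) := by
  rw [robinResolvent_apply, robinResolvent_apply, inner_add_left, inner_add_right,
    inner_volterraAdj_left, ← inner_volterra_left, inner_smul_left, inner_smul_left,
    inner_smul_right, inner_smul_right, inner_conj_symm, Complex.conj_ofReal]
  ring

/-- Factorise κ² - d²/dx² = (-d/dx + κ)(d/dx + κ). The Volterra operator inverts the right factor,
its adjoint the left one, and a multiple of exp(-κx), which solves the homogeneous equation,
corrects the boundary value. Written as V*V plus a real multiple of a rank one projection, the
resolvent is visibly symmetric. -/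
theorem isRobin_robinResolvent (l : ℝ) (hκ : 0 < κ) (hl : l ≠ κ) (f : HalfLine) :
    IsRobin l (robinResolvent l hκ f) (((κ ^ 2 : ℝ) : ℂ) • robinResolvent l hκ f - f) := by
  set ν := volume.restrict (Set.Ici (0 : ℝ)) with hν
  -- The chosen representative of f is arbitrary on the negative axis; cutting it off makes the
  -- primitives continuous on all of ℝ, so u below is differentiable on both sides of 0.
  set ft : ℝ → ℂ := (Set.Ici 0).indicator f with hft
  have hftI : ∀ a b, IntervalIntegrable ft volume a b := by
    intro a b
    rw [intervalIntegrable_iff]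
    refine IntegrableOn.mono_set (t := Set.Icc (-(|a| + |b|)) (|a| + |b|)) ?_ ?_
    · rw [hft, integrableOn_indicator_iff measurableSet_Ici]
      refine (f.integrableOn_Icc (|a| + |b|)).mono_set fun x hx => ⟨hx.1, hx.2.2⟩
    · intro x hx
      have h1 := hx.1
      have h2 := hx.2
      have := neg_abs_le a
      have := neg_abs_le b
      have := le_abs_self a
      have := le_abs_self b
      have := abs_nonneg a
      have := abs_nonneg b
      constructor
      · rcases min_lt_iff.1 h1 with h | h <;> linarith
      · rcases le_max_iff.1 h2 with h | h <;> linarith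
  have hgI : ∀ a b, IntervalIntegrable (fun y => (Real.exp (κ * y) : ℂ) * ft y) volume a b :=
    fun a b => (hftI a b).continuousOn_mul (by fun_prop)
  have hee : ∀ x : ℝ, (Real.exp (-κ * x) : ℂ) * (Real.exp (κ * x) : ℂ) = 1 := by
    intro x
    rw [← Complex.ofReal_mul, ← Real.exp_add]
    simp
  have hdexp : ∀ a x : ℝ, HasDerivAt (fun x : ℝ => (Real.exp (a * x) : ℂ))
      (a * (Real.exp (a * x) : ℂ)) x := by
    intro a x
    have h1 := (((hasDerivAt_id x).const_mul a).exp).ofReal_comp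
    refine h1.congr_deriv ?_
    push_cast
    simp only [id, mul_one]
    ring
  set P : ℝ → ℂ := fun x => ∫ y in (0 : ℝ)..x, (Real.exp (κ * y) : ℂ) * ft y with hP
  have hPc : Continuous P := intervalIntegral.continuous_primitive hgI 0
  set χ : ℝ → ℂ := fun x => (Real.exp (-κ * x) : ℂ) * P x with hχ
  have hχc : Continuous χ := by
    have : Continuous fun x : ℝ => (Real.exp (-κ * x) : ℂ) := by fun_prop
    exact this.mul hPc
  have hVχ : volterra hκ f =ᵐ[ν] χ := by
    filter_upwards [integralOp_ae (isSchurKernel_volterraKernel hκ) f,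
      ae_restrict_mem measurableSet_Ici] with x h1 hx
    rw [volterra, h1, integral_volterraKernel κ hx]
    simp only [hχ, hP]
    congr 1
    refine intervalIntegral.integral_congr fun y hy => ?_
    rw [Set.uIcc_of_le hx] at hy
    simp only [hft, Set.indicator_of_mem (Set.mem_Ici.2 hy.1)]
  have heχ : IntegrableOn (fun y => (Real.exp (-κ * y) : ℂ) * χ y) (Set.Ici 0) := by
    refine (L2.integrable_inner (𝕜 := ℂ) (expVec hκ) (volterra hκ f)).congr ?_
    filter_upwards [hVχ, expVec_ae hκ] with y h1 h2
    rw [h1, h2, RCLike.inner_apply, Complex.conj_ofReal, mul_comm]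
  set I : ℂ := ∫ y in Set.Ioi 0, (Real.exp (-κ * y) : ℂ) * χ y with hI
  -- The boundary value I = ⟨e, Vf⟩ = ⟨V*e, f⟩ equals ⟨e, f⟩/(2κ), since e is an eigenvector of V*.
  have hI' : I = ((1 / (2 * κ) : ℝ) : ℂ) * inner ℂ (expVec hκ) f := by
    have h1 : I = inner ℂ (expVec hκ) (volterra hκ f) := by
      rw [L2.inner_def, hI, ← integral_Ici_eq_integral_Ioi]
      refine integral_congr_ae ?_
      filter_upwards [hVχ, expVec_ae hκ] with y h1 h2
      rw [h1, h2, RCLike.inner_apply, Complex.conj_ofReal, mul_comm]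
    rw [h1, ← inner_volterraAdj_left, volterraAdj_expVec, inner_smul_left, Complex.conj_ofReal]
  have hcc : Continuous fun y => (Real.exp (-κ * y) : ℂ) * χ y :=
    (by fun_prop : Continuous fun x : ℝ => (Real.exp (-κ * x) : ℂ)).mul hχc
  set u₀ : ℝ → ℂ := fun x => (Real.exp (κ * x) : ℂ) *
    (I - ∫ y in (0 : ℝ)..x, (Real.exp (-κ * y) : ℂ) * χ y) with hu₀
  have hu₀d : ∀ x, HasDerivAt u₀ (κ * u₀ x - χ x) x := by
    intro x
    have h1 := ((hcc.integral_hasStrictDerivAt 0 x).hasDerivAt).const_sub I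
    refine ((hdexp κ x).mul h1).congr_deriv ?_
    simp only [hu₀]
    linear_combination -(χ x) * hee x
  set c : ℂ := (((κ + l) / (2 * κ * (κ - l)) : ℝ) : ℂ) * inner ℂ (expVec hκ) f with hc
  set u : ℝ → ℂ := fun x => u₀ x + c * (Real.exp (-κ * x) : ℂ) with hu
  set v : ℝ → ℂ := fun x => κ * u₀ x - χ x - κ * c * (Real.exp (-κ * x) : ℂ) with hv
  have hud : ∀ x, HasDerivAt u (v x) x := by
    intro x
    refine ((hu₀d x).add ((hdexp (-κ) x).const_mul c)).congr_deriv ?_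
    simp only [hv]
    push_cast
    ring
  have hrep : robinResolvent l hκ f =ᵐ[ν] u := by
    rw [robinResolvent_apply, smul_smul]
    filter_upwards [Lp.coeFn_add (volterraAdj hκ (volterra hκ f)) (c • expVec hκ),
      Lp.coeFn_smul c (expVec hκ), expVec_ae hκ,
      integralOp_ae (isSchurKernel_volterraKernel hκ).swap (volterra hκ f),
      ae_restrict_mem measurableSet_Ici] with x h1 h2 h3 h4 hx
    rw [h1, Pi.add_apply, h2, Pi.smul_apply, h3, volterraAdj, h4, smul_eq_mul]
    have h5 : ∫ y in Set.Ici 0, (volterraKernel κ y x : ℂ) * volterra hκ f y =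
        ∫ y in Set.Ici 0, (volterraKernel κ y x : ℂ) * χ y := by
      refine integral_congr_ae ?_
      filter_upwards [hVχ] with y hy
      rw [hy]
    rw [h5, integral_volterraKernel_swap κ hx]
    simp only [hu, hu₀, hI]
    rw [← intervalIntegral.integral_interval_add_Ioi (heχ.mono_set Set.Ioi_subset_Ici_self)
      (heχ.mono_set fun y hy => Set.mem_Ici.2 (hx.trans (le_of_lt hy)))]
    ring
  refine ⟨u, v, ⟨hrep, fun x _ => (hud x).hasDerivWithinAt, fun b hb => ?_, ?_⟩, ?_⟩
  · have hbd : ∀ g g' : ℝ → ℂ, (∀ x, HasDerivAt g (g' x) x) → Continuous g' →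
        AbsolutelyContinuousOnInterval g 0 b := by
      intro g g' hg hg'
      obtain ⟨C, hC⟩ := isCompact_Icc.exists_bound_of_continuousOn (hg'.continuousOn (s := Set.Icc 0 b))
      exact absolutelyContinuousOnInterval_of_hasDerivWithinAt hb
        (fun x _ => (hg x).hasDerivWithinAt) hC
    have hu₀c : Continuous u₀ := continuous_iff_continuousAt.2 fun x => (hu₀d x).continuousAt
    have a1 : AbsolutelyContinuousOnInterval u₀ 0 b :=
      hbd u₀ _ hu₀d ((continuous_const.mul hu₀c).sub hχc)
    have a2 : ∀ a : ℝ, AbsolutelyContinuousOnInterval (fun x : ℝ => (Real.exp (a * x) : ℂ)) 0 b :=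
      fun a => hbd _ _ (hdexp a) (by fun_prop)
    have a3 : AbsolutelyContinuousOnInterval χ 0 b :=
      (a2 (-κ)).fun_smul (absolutelyContinuousOnInterval_integral (hgI 0 b))
    exact ((a1.const_smul (κ : ℂ)).fun_sub a3).fun_sub ((a2 (-κ)).const_smul ((κ : ℂ) * c))
  · have hloc : LocallyIntegrable (fun y => (Real.exp (κ * y) : ℂ) * ft y) volume := by
      refine (locallyIntegrable_iff).2 fun k hk => ?_
      obtain ⟨r, hr⟩ := hk.isBounded.subset_closedBall 0
      rw [Real.closedBall_eq_Icc] at hr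
      by_cases h0 : 0 - r ≤ 0 + r
      · exact ((intervalIntegrable_iff_integrableOn_Icc_of_le h0).1 (hgI _ _)).mono_set hr
      · rw [Set.Icc_eq_empty h0, Set.subset_empty_iff] at hr
        rw [hr]
        exact integrableOn_empty
    filter_upwards [ae_restrict_of_ae (_root_.LocallyIntegrable.ae_hasDerivAt_integral hloc), hrep,
      Lp.coeFn_sub (((κ ^ 2 : ℝ) : ℂ) • robinResolvent l hκ f) f,
      Lp.coeFn_smul ((κ ^ 2 : ℝ) : ℂ) (robinResolvent l hκ f),
      ae_restrict_mem measurableSet_Ici] with x h1 h2 h3 h4 hx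
    rw [h3, Pi.sub_apply, h4, Pi.smul_apply, h2]
    have hχd : HasDerivAt χ (-κ * χ x + ft x) x := by
      refine ((hdexp (-κ) x).mul (h1 0)).congr_deriv ?_
      simp only [hχ, hP]
      simp only [Complex.ofReal_neg]
      linear_combination ft x * hee x
    refine ((((hu₀d x).const_mul (κ : ℂ)).sub hχd).sub
      ((hdexp (-κ) x).const_mul ((κ : ℂ) * c))).congr_deriv ?_
    have hfx : ft x = f x := by simp only [hft, Set.indicator_of_mem hx]
    rw [hfx]
    simp only [hu, smul_eq_mul]
    push_cast
    ring
  -- With u(0) = I + c and v(0) = κ(I - c), the condition reads c = (κ + l)/(κ - l) · I; this is the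
  -- origin of the coefficient in the resolvent.
  · have h0 : u₀ 0 = I := by simp [hu₀]
    have h1 : χ 0 = 0 := by simp [hχ, hP]
    simp only [hu, hv, h0, h1, mul_zero, Real.exp_zero, Complex.ofReal_one, mul_one, sub_zero]
    rw [hI', hc]
    have hκl : (κ : ℂ) - l ≠ 0 := by
      rw [← Complex.ofReal_sub, Complex.ofReal_ne_zero, sub_ne_zero]
      exact hl.symm
    have hκ0 : (κ : ℂ) ≠ 0 := Complex.ofReal_ne_zero.2 hκ.ne'
    push_cast
    field_simp
    ring

/-- A continuous representative of 0 vanishes everywhere on [0, ∞), hence so do its derivative v at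
positive points and the derivative φ of v. -/
theorem IsRobin.eq_zero {l : ℝ} {φ : HalfLine} (h : IsRobin l 0 φ) : φ = 0 := by
  obtain ⟨u, v, huv, -⟩ := h
  have hu : Set.EqOn u (fun _ => 0) (Set.Ici 0) := by
    refine Measure.eqOn_of_ae_eq (μ := volume) ?_ huv.continuousOn continuousOn_const ?_
    · filter_upwards [huv.rep, Lp.coeFn_zero ℂ 2 (volume.restrict (Set.Ici (0 : ℝ)))] with x h1 h2
      rw [← h1, h2, Pi.zero_apply]
    · rw [interior_Ici, closure_Ioi]
  have hv : ∀ x, 0 < x → v x = 0 := by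
    intro x hx
    have h1 : HasDerivAt u (v x) x := (huv.deriv x hx.le).hasDerivAt (Ici_mem_nhds hx)
    have h2 : HasDerivAt u 0 x := (hasDerivAt_const x (0 : ℂ)).congr_of_eventuallyEq (by
      filter_upwards [lt_mem_nhds hx] with y hy using hu (Set.mem_Ici.2 hy.le))
    exact h1.unique h2
  refine Lp.ext ?_
  have hne : ∀ᵐ x ∂(volume.restrict (Set.Ici (0 : ℝ))), x ≠ 0 :=
    ae_restrict_of_ae (by simp [ae_iff, measure_singleton])
  filter_upwards [huv.ae_deriv, Lp.coeFn_zero ℂ 2 (volume.restrict (Set.Ici (0 : ℝ))), hne,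
    ae_restrict_mem measurableSet_Ici] with x h1 h2 h3 h4
  rw [h2, Pi.zero_apply]
  have hx : 0 < x := lt_of_le_of_ne h4 (Ne.symm h3)
  exact h1.unique ((hasDerivAt_const x (0 : ℂ)).congr_of_eventuallyEq (by
    filter_upwards [lt_mem_nhds hx] with y hy using hv y hy))

theorem isSemigroupOf_robinSemigroup (l : ℝ) : IsSemigroupOf (IsRobin l) (robinSemigroup l) := by
  -- κ = |l| + 2 differs from l and has κ² > l² + 1, so μ = κ² lies above the growth rate of
  -- `norm_robinSemigroup_le`.
  have hκ : 0 < |l| + 2 := by positivity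
  have hl : l ≠ |l| + 2 := by linarith [le_abs_self l]
  refine isSemigroupOf_of_symmetric (R := robinResolvent l hκ) (μ := (|l| + 2) ^ 2)
    (ω := l ^ 2 + 1) ?_ (robinSemigroup_zero l) (fun t ht => norm_robinSemigroup_le l ht)
    (fun ψ φ h η t ht => weak_duhamel_robinSemigroup h η ht) (isRobin_robinResolvent l hκ hl)
    (inner_robinResolvent_left l hκ) (fun t _ => inner_robinSemigroup_left l t)
    (fun φ h => h.eq_zero)
  nlinarith [sq_abs l, abs_nonneg l]

end Resolvent

/-! ### Similarity of semigroups -/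

section Conjugation

variable {X Y : Type*} [NormedAddCommGroup X] [NormedSpace ℂ X] [NormedAddCommGroup Y]
  [NormedSpace ℂ Y]

theorem IsSemigroupOf.conj {D : X → X → Prop} {T : ℝ → X →L[ℂ] X} (hT : IsSemigroupOf D T)
    {P : X →L[ℂ] Y} {Q : Y →L[ℂ] X} (hPQ : ∀ f, P (Q f) = f) (hQP : ∀ f, Q (P f) = f) :
    IsSemigroupOf (fun ψ φ => D (Q ψ) (Q φ)) (fun t => P ∘L T t ∘L Q) where
  zero f := by simp [hT.zero, hPQ]
  add s t hs ht f := by simp [hT.add s t hs ht, hQP]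
  tendsto f := by
    have := (P.continuous.tendsto _).comp (hT.tendsto (Q f))
    rwa [hPQ] at this
  generator ψ φ := by
    have key : ∀ t : ℝ, ((t⁻¹ : ℝ) : ℂ) • ((P ∘L T t ∘L Q) ψ - ψ) =
        P (((t⁻¹ : ℝ) : ℂ) • (T t (Q ψ) - Q ψ)) := fun t => by
      rw [map_smul, map_sub, hPQ]
      rfl
    rw [hT.generator]
    simp only [key]
    refine ⟨fun h => ?_, fun h => ?_⟩
    · have := (P.continuous.tendsto _).comp h
      rwa [hPQ] at this
    · have := (Q.continuous.tendsto _).comp h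
      simpa only [Function.comp_def, hQP] using this

end Conjugation

/-! ### Decoupling the star graph by diagonalising H -/

section MatrixAction

variable {E : Type*} [Fintype E]

/-- The action of a scalar matrix on `⨁_{e ∈ E} L²([0, ∞))`. -/
def matAct (A : Matrix E E ℂ) : HilbertSpace E →L[ℂ] HilbertSpace E :=
  (PiLp.continuousLinearEquiv 2 ℂ (fun _ : E => HalfLine)).symm.toContinuousLinearMap ∘L
    ContinuousLinearMap.pi fun e => ∑ e', A e e' • PiLp.proj 2 (fun _ : E => HalfLine) e'

/-- The direct sum of operators on the edges. -/
def diagAct (S : E → HalfLine →L[ℂ] HalfLine) : HilbertSpace E →L[ℂ] HilbertSpace E :=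
  (PiLp.continuousLinearEquiv 2 ℂ (fun _ : E => HalfLine)).symm.toContinuousLinearMap ∘L
    ContinuousLinearMap.pi fun e => S e ∘L PiLp.proj 2 (fun _ : E => HalfLine) e

theorem matAct_apply (A : Matrix E E ℂ) (f : HilbertSpace E) (e : E) :
    matAct A f e = ∑ e', A e e' • f e' := by
  simp [matAct]

theorem diagAct_apply (S : E → HalfLine →L[ℂ] HalfLine) (f : HilbertSpace E) (e : E) :
    diagAct S f e = S e (f e) := by
  simp [diagAct]

theorem matAct_matAct (A B : Matrix E E ℂ) (f : HilbertSpace E) :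
    matAct A (matAct B f) = matAct (A * B) f := by
  ext1 e
  simp only [matAct_apply, Matrix.mul_apply, Finset.smul_sum, Finset.sum_smul, smul_smul]
  exact Finset.sum_comm

theorem matAct_one [DecidableEq E] (f : HilbertSpace E) : matAct 1 f = f := by
  ext1 e
  simp [matAct_apply, Matrix.one_apply, ite_smul]

theorem tendsto_hilbertSpace_iff {ι : Type*} {l : Filter ι} {F : ι → HilbertSpace E}
    {f : HilbertSpace E} : Tendsto F l (𝓝 f) ↔ ∀ e, Tendsto (fun i => F i e) l (𝓝 (f e)) := by
  rw [← (PiLp.continuousLinearEquiv 2 ℂ (fun _ : E => HalfLine)).toHomeomorph.isInducing.tendsto_nhds_iff.symm,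
    tendsto_pi_nhds]
  rfl

theorem isSemigroupOf_diagAct {D : E → HalfLine → HalfLine → Prop}
    {S : E → ℝ → HalfLine →L[ℂ] HalfLine} (hS : ∀ e, IsSemigroupOf (D e) (S e)) :
    IsSemigroupOf (fun ψ φ : HilbertSpace E => ∀ e, D e (ψ e) (φ e))
      (fun t => diagAct fun e => S e t) where
  zero f := by
    ext1 e
    rw [diagAct_apply, (hS e).zero]
  add s t hs ht f := by
    ext1 e
    simp only [diagAct_apply, (hS e).add s t hs ht]
  tendsto f := by
    rw [tendsto_hilbertSpace_iff]
    intro e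
    simpa only [diagAct_apply] using (hS e).tendsto (f e)
  generator ψ φ := by
    rw [tendsto_hilbertSpace_iff]
    refine forall_congr' fun e => ?_
    simpa only [PiLp.smul_apply, PiLp.sub_apply, diagAct_apply] using
      (hS e).generator (ψ e) (φ e)

theorem IsRegularPair.zero : IsRegularPair 0 0 (fun _ => 0) (fun _ => 0) where
  rep := Lp.coeFn_zero _ _ _
  deriv _ _ := hasDerivWithinAt_const _ _ _
  ac b hb := absolutelyContinuousOnInterval_of_hasDerivWithinAt (f' := fun _ => 0) (C := 0) hb
    (fun _ _ => hasDerivWithinAt_const _ _ _) (by simp)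
  ae_deriv := by
    filter_upwards [Lp.coeFn_zero ℂ 2 (volume.restrict (Set.Ici (0 : ℝ)))] with x hx
    rw [hx]
    exact hasDerivAt_const _ _

theorem IsRegularPair.add {ψ φ ψ' φ' : HalfLine} {u v u' v' : ℝ → ℂ}
    (h : IsRegularPair ψ φ u v) (h' : IsRegularPair ψ' φ' u' v') :
    IsRegularPair (ψ + ψ') (φ + φ') (fun x => u x + u' x) (fun x => v x + v' x) where
  rep := by
    filter_upwards [Lp.coeFn_add ψ ψ', h.rep, h'.rep] with x h1 h2 h3
    rw [h1, Pi.add_apply, h2, h3]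
  deriv x hx := (h.deriv x hx).add (h'.deriv x hx)
  ac b hb := (h.ac b hb).fun_add (h'.ac b hb)
  ae_deriv := by
    filter_upwards [Lp.coeFn_add φ φ', h.ae_deriv, h'.ae_deriv] with x h1 h2 h3
    rw [h1]
    exact h2.add h3

theorem IsRegularPair.const_smul {ψ φ : HalfLine} {u v : ℝ → ℂ} (h : IsRegularPair ψ φ u v)
    (c : ℂ) : IsRegularPair (c • ψ) (c • φ) (fun x => c * u x) (fun x => c * v x) where
  rep := by
    filter_upwards [Lp.coeFn_smul c ψ, h.rep] with x h1 h2
    rw [h1, Pi.smul_apply, h2, smul_eq_mul]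
  deriv x hx := (h.deriv x hx).const_mul c
  ac b hb := (h.ac b hb).const_smul c
  ae_deriv := by
    filter_upwards [Lp.coeFn_smul c φ, h.ae_deriv] with x h1 h2
    rw [h1]
    exact h2.const_mul c

theorem IsRegularPair.sum {ι : Type*} (s : Finset ι) {ψ φ : ι → HalfLine} {u v : ι → ℝ → ℂ}
    (h : ∀ i, IsRegularPair (ψ i) (φ i) (u i) (v i)) (c : ι → ℂ) :
    IsRegularPair (∑ i ∈ s, c i • ψ i) (∑ i ∈ s, c i • φ i)
      (fun x => ∑ i ∈ s, c i * u i x) (fun x => ∑ i ∈ s, c i * v i x) := by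
  classical
  induction s using Finset.induction_on with
  | empty => simpa using IsRegularPair.zero
  | insert i s hi ih =>
    simp only [Finset.sum_insert hi]
    exact ((h i).const_smul (c i)).add ih

theorem isLaplacian_iff {A B : Matrix E E ℂ} {ψ φ : HilbertSpace E} :
    IsLaplacian (boundarySubspace A B) ψ φ ↔ ∃ u v : E → ℝ → ℂ,
      (∀ e, IsRegularPair (ψ e) (φ e) (u e) (v e)) ∧
        A.mulVec (fun e => u e 0) + B.mulVec (fun e => v e 0) = 0 := by
  have hmem : ∀ a b : E → ℂ, (a, b) ∈ boundarySubspace A B ↔ A.mulVec a + B.mulVec b = 0 :=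
    fun a b => by simp [boundarySubspace]
  refine ⟨?_, ?_⟩
  · rintro ⟨u, v, h1, h2, h3, h4, h5⟩
    exact ⟨u, v, fun e => ⟨h1 e, h2 e, h3 e, h4 e⟩, (hmem _ _).1 h5⟩
  · rintro ⟨u, v, h, h5⟩
    exact ⟨u, v, fun e => (h e).rep, fun e => (h e).deriv, fun e => (h e).ac,
      fun e => (h e).ae_deriv, (hmem _ _).2 h5⟩

/-- Scalar matrices commute with differentiation along the edges, so they may be applied directly to
the regular representatives. Their boundary values turn Hu + v = 0 into diag(d)Vu + Vv = 0. -/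
theorem isLaplacian_iff_isRobin [DecidableEq E] {H U V : Matrix E E ℂ} {d : E → ℝ}
    (hUV : U * V = 1) (hVU : V * U = 1)
    (hH : H = U * Matrix.diagonal (fun k => (d k : ℂ)) * V) {ψ φ : HilbertSpace E} :
    IsLaplacian (boundarySubspace H 1) ψ φ ↔
      ∀ k, IsRobin (d k) (matAct V ψ k) (matAct V φ k) := by
  rw [isLaplacian_iff]
  constructor
  · rintro ⟨u, v, h, h0⟩ k
    refine ⟨fun x => ∑ e, V k e * u e x, fun x => ∑ e, V k e * v e x, ?_, ?_⟩
    · rw [matAct_apply, matAct_apply]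
      exact IsRegularPair.sum _ h _
    · have h1 : V.mulVec (H.mulVec (fun e => u e 0) + (1 : Matrix E E ℂ).mulVec fun e => v e 0) k =
          0 := by rw [h0, Matrix.mulVec_zero, Pi.zero_apply]
      rw [Matrix.mulVec_add, Matrix.mulVec_mulVec, Matrix.one_mulVec, hH, ← mul_assoc, ← mul_assoc,
        hVU, one_mul, ← Matrix.mulVec_mulVec, Pi.add_apply, Matrix.mulVec_diagonal] at h1
      exact h1
  · intro h
    choose u v huv h0 using h
    refine ⟨fun e x => ∑ k, U e k * u k x, fun e x => ∑ k, U e k * v k x, fun e => ?_, ?_⟩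
    · have h1 := IsRegularPair.sum Finset.univ huv (fun k => U e k)
      rwa [← matAct_apply, ← matAct_apply, matAct_matAct, matAct_matAct, hUV, matAct_one,
        matAct_one] at h1
    · have h1 : ((Matrix.diagonal fun k => (d k : ℂ)).mulVec (fun k => u k 0) + fun k => v k 0) =
          0 := by
        ext k
        simpa [Matrix.mulVec_diagonal] using h0 k
      have h2 := congrArg U.mulVec h1
      rw [Matrix.mulVec_add, Matrix.mulVec_mulVec, Matrix.mulVec_zero] at h2
      rw [Matrix.one_mulVec]
      refine Eq.trans (congrArg₂ (· + ·) ?_ rfl) h2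
      rw [hH]
      change (U * Matrix.diagonal (fun k => (d k : ℂ)) * V).mulVec (U.mulVec fun k => u k 0) = _
      rw [Matrix.mulVec_mulVec, mul_assoc, hVU, mul_one]

end MatrixAction

/-! ### Integral kernels on the star graph and their uniqueness -/

section Kernel

theorem continuous_robinTail {t : ℝ} (ht : 0 < t) (l : ℝ) : Continuous (robinTail l t) :=
  continuous_iff_continuousAt.2 fun s => (hasDerivAt_robinTail ht l s).continuousAt

theorem continuous_robinKernel_prod {t : ℝ} (ht : 0 < t) (l : ℝ) :
    Continuous fun z : ℝ × ℝ => robinKernel l t z.1 z.2 := by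
  have h1 : Continuous (gauss t) := by unfold gauss; fun_prop
  have h2 := continuous_robinTail ht l
  unfold robinKernel
  fun_prop

theorem coeFn_sum_smul {ι : Type*} (s : Finset ι) (c : ι → ℂ) (g : ι → HalfLine) :
    (∑ i ∈ s, c i • g i : HalfLine) =ᵐ[volume.restrict (Set.Ici (0 : ℝ))]
      fun x => ∑ i ∈ s, c i * g i x := by
  classical
  induction s using Finset.induction_on with
  | empty => exact Lp.coeFn_zero ℂ 2 (volume.restrict (Set.Ici (0 : ℝ)))
  | insert i s hi ih =>
    simp only [Finset.sum_insert hi]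
    filter_upwards [Lp.coeFn_add (c i • g i) (∑ i ∈ s, c i • g i), Lp.coeFn_smul (c i) (g i), ih]
      with x h1 h2 h3
    rw [h1, Pi.add_apply, h2, h3, Pi.smul_apply, smul_eq_mul]

variable {E : Type*} [Fintype E]

theorem hasIntegralKernel_robin (U V : Matrix E E ℂ) (d : E → ℝ) {t : ℝ} (ht : 0 < t) :
    HasIntegralKernel (matAct U ∘L (diagAct fun k => robinSemigroup (d k) t) ∘L matAct V)
      (fun e e' x y => ∑ k, U e k * robinKernel (d k) t x y * V k e') := by
  intro f e
  have hS : ∀ᵐ x ∂(volume.restrict (Set.Ici (0 : ℝ))), ∀ k,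
      robinSemigroup (d k) t (matAct V f k) x =
        ∫ y in Set.Ici 0, (robinKernel (d k) t x y : ℂ) * (matAct V f k : ℝ → ℂ) y :=
    ae_all_iff.2 fun k => robinSemigroup_ae (d k) ht _
  filter_upwards [hS, coeFn_sum_smul Finset.univ (fun k => U e k)
    (fun k => robinSemigroup (d k) t (matAct V f k)), ae_restrict_mem measurableSet_Ici]
    with x h1 h2 hx
  have hI : ∀ k e', Integrable (fun y => U e k * robinKernel (d k) t x y * V k e' * f e' y)
      (volume.restrict (Set.Ici (0 : ℝ))) := fun k e' => by
    refine ((integrableOn_robinKernel_mul (f e') (d k) ht hx).const_mul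
      (U e k * V k e')).congr (Eventually.of_forall fun y => ?_)
    ring
  refine ⟨fun e' => ?_, ?_⟩
  · simp only [Finset.sum_mul]
    exact integrable_finsetSum _ fun k _ => hI k e'
  · have h3 : (matAct U ∘L (diagAct fun k => robinSemigroup (d k) t) ∘L matAct V) f e =
        ∑ k, U e k • robinSemigroup (d k) t (matAct V f k) := by
      simp only [ContinuousLinearMap.comp_apply, matAct_apply U, diagAct_apply]
    rw [h3, h2]
    have h4 : ∀ k, U e k * robinSemigroup (d k) t (matAct V f k) x =
        ∑ e', ∫ y in Set.Ici 0, U e k * robinKernel (d k) t x y * V k e' * f e' y := fun k => by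
      rw [h1, ← integral_finsetSum _ fun e' _ => hI k e', ← integral_const_mul]
      refine integral_congr_ae ?_
      filter_upwards [coeFn_sum_smul Finset.univ (fun e' => V k e') (fun e' => f e')] with y hy
      rw [matAct_apply, hy, Finset.mul_sum, Finset.mul_sum]
      exact Finset.sum_congr rfl fun e' _ => by ring
    simp only [h4]
    rw [Finset.sum_comm]
    refine Finset.sum_congr rfl fun e' _ => ?_
    simp only [Finset.sum_mul]
    exact (integral_finsetSum _ fun k _ => hI k e').symm

/-- The indicator function of `[0, b]` on the edge `e`. -/
def edgeIndicator [DecidableEq E] (e : E) (b : ℝ) : HilbertSpace E :=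
  WithLp.toLp 2 (Pi.single e (indicatorConstLp 2 (measurableSet_Icc (a := (0 : ℝ)) (b := b))
    (((Measure.restrict_apply_le _ _).trans_lt (by simp)).ne) (1 : ℂ)))

theorem integral_mul_edgeIndicator [DecidableEq E] (k : E → ℝ → ℂ) (e : E) {b : ℝ} (hb : 0 ≤ b) :
    ∑ e', ∫ y in Set.Ici (0 : ℝ), k e' y * (edgeIndicator e b e' : ℝ → ℂ) y =
      ∫ y in (0 : ℝ)..b, k e y := by
  rw [Finset.sum_eq_single e]
  · have h : (edgeIndicator e b e : ℝ → ℂ) =ᵐ[volume.restrict (Set.Ici (0 : ℝ))]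
        (Set.Icc 0 b).indicator fun _ => (1 : ℂ) := by
      simp only [edgeIndicator, Pi.single_eq_same]
      exact indicatorConstLp_coeFn
    have h2 : (fun y => k e y * (edgeIndicator e b e : ℝ → ℂ) y)
        =ᵐ[volume.restrict (Set.Ici (0 : ℝ))] (Set.Icc 0 b).indicator (k e) := by
      filter_upwards [h] with y hy
      rw [hy]
      by_cases hyb : y ∈ Set.Icc 0 b <;> simp [hyb]
    rw [integral_congr_ae h2, integral_indicator measurableSet_Icc,
      Measure.restrict_restrict measurableSet_Icc,
      Set.inter_eq_left.2 Set.Icc_subset_Ici_self, integral_Icc_eq_integral_Ioc,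
      intervalIntegral.integral_of_le hb]
  · intro e' _ he
    have h : (edgeIndicator e b e' : ℝ → ℂ) =ᵐ[volume.restrict (Set.Ici (0 : ℝ))] 0 := by
      simp only [edgeIndicator, Pi.single_eq_of_ne he]
      exact Lp.coeFn_zero _ _ _
    refine integral_eq_zero_of_ae ?_
    filter_upwards [h] with y hy
    simp [hy]
  · simp

/-- Applied to the indicator of [0, b] on edge e', the two kernels have equal integrals over [0, b]
for almost every x, hence for all x ≥ 0 by continuity. Differentiating in b recovers the kernels. -/
theorem HasIntegralKernel.eq_of_continuousOn [DecidableEq E]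
    {S : HilbertSpace E →L[ℂ] HilbertSpace E} {p q : E → E → ℝ → ℝ → ℂ}
    (hp : HasIntegralKernel S p) (hq : HasIntegralKernel S q)
    (hpc : ∀ e e', ContinuousOn (fun z : ℝ × ℝ => p e e' z.1 z.2) (Set.Ici 0 ×ˢ Set.Ici 0))
    (hqc : ∀ e e', ContinuousOn (fun z : ℝ × ℝ => q e e' z.1 z.2) (Set.Ici 0 ×ˢ Set.Ici 0))
    (e e' : E) {x y : ℝ} (hx : 0 ≤ x) (hy : 0 ≤ y) : p e e' x y = q e e' x y := by
  -- Composition with max(·, 0) extends the kernels continuously to the plane, so that parametric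
  -- integrals are continuous on the whole line.
  have hext : ∀ k : E → E → ℝ → ℝ → ℂ,
      ContinuousOn (fun z : ℝ × ℝ => k e e' z.1 z.2) (Set.Ici 0 ×ˢ Set.Ici 0) →
      Continuous (Function.uncurry fun x y => k e e' (max x 0) (max y 0)) := fun k hk =>
    hk.comp_continuous (f := fun z : ℝ × ℝ => (max z.1 0, max z.2 0)) (by fun_prop)
      fun z => ⟨le_max_right z.1 0, le_max_right z.2 0⟩
  have hPc := hext p (hpc e e')
  have hQc := hext q (hqc e e')
  have hmax : ∀ k : ℝ → ℝ → ℂ, ∀ x b : ℝ, 0 ≤ x → 0 ≤ b →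
      ∫ y in (0 : ℝ)..b, k (max x 0) (max y 0) = ∫ y in (0 : ℝ)..b, k x y := by
    intro k x b hx hb
    refine intervalIntegral.integral_congr fun y hy => ?_
    rw [Set.uIcc_of_le hb] at hy
    simp only [max_eq_left hx, max_eq_left hy.1]
  have hint : ∀ b : ℝ, 0 ≤ b → ∀ x : ℝ, 0 ≤ x →
      ∫ y in (0 : ℝ)..b, p e e' (max x 0) (max y 0) =
        ∫ y in (0 : ℝ)..b, q e e' (max x 0) (max y 0) := by
    intro b hb
    refine Measure.eqOn_of_ae_eq (μ := volume) (s := Set.Ici (0 : ℝ))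
      (f := fun x => ∫ y in (0 : ℝ)..b, p e e' (max x 0) (max y 0))
      (g := fun x => ∫ y in (0 : ℝ)..b, q e e' (max x 0) (max y 0)) ?_
      (intervalIntegral.continuous_parametric_intervalIntegral_of_continuous' hPc 0 b).continuousOn
      (intervalIntegral.continuous_parametric_intervalIntegral_of_continuous' hQc 0 b).continuousOn
      (by rw [interior_Ici, closure_Ioi])
    filter_upwards [hp (edgeIndicator e' b) e, hq (edgeIndicator e' b) e,
      ae_restrict_mem measurableSet_Ici] with x h1 h2 hx
    rw [hmax _ _ _ hx hb, hmax _ _ _ hx hb, ← integral_mul_edgeIndicator (fun e' y => p e e' x y) e' hb,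
      ← integral_mul_edgeIndicator (fun e' y => q e e' x y) e' hb, ← h1.2, ← h2.2]
  have hd : ∀ k : E → E → ℝ → ℝ → ℂ,
      Continuous (Function.uncurry fun x y => k e e' (max x 0) (max y 0)) →
      HasDerivWithinAt (fun b => ∫ z in (0 : ℝ)..b, k e e' (max x 0) (max z 0))
        (k e e' x y) (Set.Ici 0) y := by
    intro k hk
    have hc : Continuous fun z => k e e' (max x 0) (max z 0) :=
      hk.comp (Continuous.prodMk_right x)
    have := (hc.integral_hasStrictDerivAt 0 y).hasDerivAt.hasDerivWithinAt (s := Set.Ici 0)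
    simpa only [max_eq_left hx, max_eq_left hy] using this
  have h1 := hd p hPc
  have h2 := (hd q hQc).congr (fun b hb => hint b hb x hx) (hint y hy x hx)
  exact (uniqueDiffOn_Ici (0 : ℝ) y hy).eq_deriv _ h1 h2

end Kernel

/-! ### Small time asymptotics of h_t -/

section Asymptotics

/-- The relative correction in `-h_t(s, l) = (4t/s) g_t(s) (l + hRemainder s l t)`. -/
def hRemainder (s l t : ℝ) : ℝ :=
  -hFun t s l / (4 * t / s * gauss t s) - l

theorem gauss_pos {t : ℝ} (ht : 0 < t) (x : ℝ) : 0 < gauss t x := by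
  unfold gauss
  have := Real.pi_pos
  positivity

theorem neg_hFun_eq {s t : ℝ} (hs : 0 < s) (ht : 0 < t) (l : ℝ) :
    -hFun t s l = 4 * t / s * gauss t s * (l + hRemainder s l t) := by
  have := gauss_pos ht s
  rw [hRemainder, add_sub_cancel]
  field_simp

/-- The Gaussian cancels, leaving √π · s/(2√t) · exp(w²) erfc w with w = s/(2√t) - l√t. This is the
quantity of `abs_erfc_asymptotics_le` up to replacing s/(2√t) = w + l√t by w. -/
theorem hRemainder_eq {s t : ℝ} (hs : s ≠ 0) (ht : 0 < t) (l : ℝ) :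
    hRemainder s l t = l * (Real.sqrt Real.pi * (s / (2 * Real.sqrt t)) *
      Real.exp ((s / (2 * Real.sqrt t) - l * Real.sqrt t) ^ 2) *
      erfc (s / (2 * Real.sqrt t) - l * Real.sqrt t)) - l := by
  have hg := gauss_pos ht s
  have hst := Real.sqrt_pos.2 ht
  rw [hRemainder, hFun, sqrt_four_pi_mul]
  obtain ⟨r, hr⟩ : ∃ r, r = Real.sqrt t := ⟨_, rfl⟩
  rw [← hr] at hst ⊢
  have ht' : t = r ^ 2 := by rw [hr, Real.sq_sqrt ht.le]
  generalize gauss t s = g at hg ⊢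
  generalize Real.exp _ = a
  generalize erfc _ = c
  rw [ht']
  field_simp
  ring

theorem abs_hRemainder_le {s t l : ℝ} (hs : 0 < s) (ht : 0 < t) (hlt : 4 * |l| * t ≤ s) :
    |hRemainder s l t| ≤ |l| * (16 / s ^ 2 + 4 * |l| / s) * t := by
  rw [hRemainder_eq hs.ne' ht]
  have hst := Real.sqrt_pos.2 ht
  obtain ⟨r, hr⟩ : ∃ r, r = Real.sqrt t := ⟨_, rfl⟩
  have ht' : t = r ^ 2 := by rw [hr, Real.sq_sqrt ht.le]
  rw [← hr] at hst ⊢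
  obtain ⟨w, hw⟩ : ∃ w, w = s / (2 * r) - l * r := ⟨_, rfl⟩
  have hlr : |l * r| ≤ s / (4 * r) := by
    rw [abs_mul, abs_of_pos hst, le_div_iff₀ (by positivity)]
    rw [ht'] at hlt
    linarith
  have hhalf : s / (2 * r) = s / (4 * r) + s / (4 * r) := by field_simp; norm_num
  -- The condition 4|l|t ≤ s keeps w at least half of s/(2√t), so w⁻² is O(t) and l√t/w is O(t).
  have hwl : s / (4 * r) ≤ w := by
    rw [hw, hhalf]
    linarith [le_abs_self (l * r)]
  have hs4 : 0 < s / (4 * r) := by positivity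
  have hw0 : 0 < w := hs4.trans_le hwl
  have hθ := abs_erfc_asymptotics_le hw0
  rw [← hw, show s / (2 * r) = w + l * r by rw [hw]; ring]
  obtain ⟨θ, hθ'⟩ : ∃ θ, θ = Real.sqrt Real.pi * w * Real.exp (w ^ 2) * erfc w := ⟨_, rfl⟩
  rw [← hθ'] at hθ
  have key : l * (Real.sqrt Real.pi * (w + l * r) * Real.exp (w ^ 2) * erfc w) - l =
      l * ((θ - 1) * (1 + l * r / w) + l * r / w) := by
    rw [hθ']
    field_simp
    ring
  have h1 : |l * r / w| ≤ 4 * |l| / s * t := by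
    rw [abs_div, abs_of_pos hw0, div_le_iff₀ hw0, abs_mul, abs_of_pos hst]
    calc |l| * r = 4 * |l| / s * t * (s / (4 * r)) := by rw [ht']; field_simp
      _ ≤ _ := by gcongr
  have h2 : |l * r / w| ≤ 1 := by
    rw [abs_div, abs_of_pos hw0, div_le_one hw0]
    exact hlr.trans hwl
  have h3 : |θ - 1| ≤ 8 / s ^ 2 * t := by
    refine hθ.trans ?_
    calc 1 / (2 * w ^ 2) ≤ 1 / (2 * (s / (4 * r)) ^ 2) := by gcongr
      _ = _ := by rw [ht']; field_simp; norm_num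
  rw [key, abs_mul, mul_assoc]
  refine mul_le_mul_of_nonneg_left ?_ (abs_nonneg l)
  calc |(θ - 1) * (1 + l * r / w) + l * r / w|
      ≤ |θ - 1| * (1 + |l * r / w|) + |l * r / w| := by
        refine (abs_add_le _ _).trans (add_le_add_left ?_ _)
        rw [abs_mul]
        refine mul_le_mul_of_nonneg_left ((abs_add_le _ _).trans ?_) (abs_nonneg _)
        rw [abs_one]
    _ ≤ 8 / s ^ 2 * t * (1 + 1) + 4 * |l| / s * t := by gcongr
    _ = _ := by ring

theorem hRemainder_isBigO {s : ℝ} (hs : 0 < s) (l : ℝ) :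
    (fun t => hRemainder s l t) =O[𝓝[>] 0] fun t : ℝ => t := by
  refine IsBigO.of_bound (|l| * (16 / s ^ 2 + 4 * |l| / s)) ?_
  have hev : ∀ᶠ t : ℝ in 𝓝[>] 0, 4 * |l| * t ≤ s := by
    have : Tendsto (fun t : ℝ => 4 * |l| * t) (𝓝[>] 0) (𝓝 0) := by
      have h : Continuous fun t : ℝ => 4 * |l| * t := by fun_prop
      simpa using (h.tendsto 0).mono_left nhdsWithin_le_nhds
    exact (this.eventually_lt_const hs).mono fun _ h => h.le
  filter_upwards [hev, self_mem_nhdsWithin] with t h ht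
  rw [Real.norm_eq_abs, Real.norm_eq_abs, abs_of_pos (Set.mem_Ioi.1 ht)]
  exact abs_hRemainder_le hs ht h

end Asymptotics

/-! ### Spectral decomposition and the main theorem -/

section Main

variable {E : Type*} [Fintype E] [DecidableEq E]

theorem hMatrix_apply {H : Matrix E E ℂ} (hH : H.IsHermitian) (t s : ℝ) (e e' : E) :
    hMatrix t s H e e' = ∑ k, (hH.eigenvectorUnitary : Matrix E E ℂ) e k *
      (hFun t s (hH.eigenvalues k) : ℂ) * (star (hH.eigenvectorUnitary : Matrix E E ℂ)) k e' := by
  rw [hMatrix, hH.cfc_eq, Matrix.IsHermitian.cfc, Unitary.conjStarAlgAut_apply, Matrix.mul_apply]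
  simp [Matrix.mul_diagonal]

theorem exists_kernel_representation {H : Matrix E E ℂ} (hH : H.IsHermitian) :
    ∃ (U V : Matrix E E ℂ) (d : E → ℝ), U * V = 1 ∧ V * U = 1 ∧
      H = U * Matrix.diagonal (fun k => (d k : ℂ)) * V ∧
      ∀ t s e e', hMatrix t s H e e' = ∑ k, U e k * (hFun t s (d k) : ℂ) * V k e' := by
  refine ⟨hH.eigenvectorUnitary, star (hH.eigenvectorUnitary : Matrix E E ℂ), hH.eigenvalues,
    Unitary.coe_mul_star_self _, Unitary.coe_star_mul_self _, ?_, hMatrix_apply hH⟩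
  have h := hH.spectral_theorem
  rw [Unitary.conjStarAlgAut_apply] at h
  exact h

theorem sum_robinKernel_eq {U V : Matrix E E ℂ} (d : E → ℝ) (hUV : U * V = 1) {t : ℝ} (ht : 0 < t)
    (e e' : E) (x y : ℝ) :
    ∑ k, U e k * robinKernel (d k) t x y * V k e' =
      neumannPart t e e' x y - ∑ k, U e k * (hFun t (x + y) (d k) : ℂ) * V k e' := by
  have h1 : ∑ k, U e k * V k e' = if e = e' then 1 else 0 := by
    rw [← Matrix.mul_apply, hUV, Matrix.one_apply]
  have h2 : neumannPart t e e' x y =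
      ∑ k, ((gauss t (x - y) : ℂ) + gauss t (x + y)) * (U e k * V k e') := by
    rw [← Finset.mul_sum, h1, neumannPart]
    split_ifs <;> simp
  rw [h2, ← Finset.sum_sub_distrib]
  refine Finset.sum_congr rfl fun k _ => ?_
  rw [hFun_eq ht, robinKernel]
  push_cast
  ring

end Main

end StarGraph

end

open StarGraph in
theorem theorem6 {E : Type*} [Fintype E] [DecidableEq E]
    (H : Matrix E E ℂ) (hH : H.IsHermitian) :
    (∃ p, StarGraph.IsHeatKernel (StarGraph.boundarySubspace H 1) p) ∧
    ∀ p : ℝ → E → E → ℝ → ℝ → ℂ,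
      StarGraph.IsHeatKernel (StarGraph.boundarySubspace H 1) p →
      -- the explicit formula
      (∀ t : ℝ, 0 < t → ∀ (e e' : E) (x y : ℝ), 0 ≤ x → 0 ≤ y →
        p t e e' x y =
          StarGraph.neumannPart t e e' x y - StarGraph.hMatrix t (x + y) H e e') ∧
      -- the small time asymptotics
      (∀ (e e' : E) (x y : ℝ), 0 ≤ x → 0 ≤ y → 0 < x + y →
        ∃ r : ℝ → ℂ, r =O[𝓝[>] 0] (fun t : ℝ => t) ∧ ∀ t : ℝ, 0 < t →
          p t e e' x y = StarGraph.neumannPart t e e' x y +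
            4 * (t : ℂ) / ((x + y : ℝ) : ℂ) * (StarGraph.gauss t (x + y) : ℂ) *
              (H e e' + r t)) ∧
      -- the same with a relative error, for nonzero matrix elements
      (∀ (e e' : E) (x y : ℝ), 0 ≤ x → 0 ≤ y → 0 < x + y → H e e' ≠ 0 →
        ∃ r : ℝ → ℂ, r =O[𝓝[>] 0] (fun t : ℝ => t) ∧ ∀ t : ℝ, 0 < t →
          p t e e' x y = StarGraph.neumannPart t e e' x y +
            4 * (t : ℂ) * H e e' / ((x + y : ℝ) : ℂ) * (StarGraph.gauss t (x + y) : ℂ) *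
              (1 + r t)) := by
  obtain ⟨U, V, d, hUV, hVU, hHd, hh⟩ := exists_kernel_representation hH
  have hsg : IsSemigroupOf (IsLaplacian (boundarySubspace H 1))
      (fun t => matAct U ∘L (diagAct fun k => robinSemigroup (d k) t) ∘L matAct V) := by
    have h := (isSemigroupOf_diagAct fun k => isSemigroupOf_robinSemigroup (d k)).conj
      (P := matAct U) (Q := matAct V) (fun f => by rw [matAct_matAct, hUV, matAct_one])
      (fun f => by rw [matAct_matAct, hVU, matAct_one])
    exact ⟨h.zero, h.add, h.tendsto, fun ψ φ =>
      (isLaplacian_iff_isRobin hUV hVU hHd).trans (h.generator ψ φ)⟩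
  have hcont : ∀ t, 0 < t → ∀ e e', ContinuousOn
      (fun z : ℝ × ℝ => ∑ k, U e k * (robinKernel (d k) t z.1 z.2 : ℂ) * V k e')
      (Set.Ici 0 ×ˢ Set.Ici 0) := fun t ht e e' =>
    (continuous_finsetSum _ fun k _ => (continuous_const.mul
      (Complex.continuous_ofReal.comp (continuous_robinKernel_prod ht (d k)))).mul
        continuous_const).continuousOn
  refine ⟨⟨fun t e e' x y => ∑ k, U e k * robinKernel (d k) t x y * V k e', _,
    ⟨hsg.zero, hsg.add, hsg.tendsto, hsg.generator⟩,
    fun t ht => ⟨hasIntegralKernel_robin U V d ht, hcont t ht⟩⟩, ?_⟩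
  rintro p ⟨T, hT, hp⟩
  have hformula : ∀ t : ℝ, 0 < t → ∀ (e e' : E) (x y : ℝ), 0 ≤ x → 0 ≤ y →
      p t e e' x y = neumannPart t e e' x y - hMatrix t (x + y) H e e' := by
    intro t ht e e' x y hx hy
    -- The semigroup underlying p is unspecified, but it has the same generator as the one
    -- constructed, so the two agree.
    have hTt : T t = matAct U ∘L (diagAct fun k => robinSemigroup (d k) t) ∘L matAct V :=
      IsSemigroupOf.unique ⟨hT.zero, hT.add, hT.tendsto, hT.generator⟩ hsg ht.le
    rw [hh, ← sum_robinKernel_eq d hUV ht]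
    refine HasIntegralKernel.eq_of_continuousOn
      (q := fun e e' x y => ∑ k, U e k * robinKernel (d k) t x y * V k e')
      (hp t ht).1 ?_ (hp t ht).2 (hcont t ht) e e' hx hy
    rw [hTt]
    exact hasIntegralKernel_robin U V d ht
  have hasymp : ∀ (e e' : E) (x y : ℝ), 0 ≤ x → 0 ≤ y → 0 < x + y →
      ∃ r : ℝ → ℂ, r =O[𝓝[>] 0] (fun t : ℝ => t) ∧ ∀ t : ℝ, 0 < t →
        p t e e' x y = neumannPart t e e' x y +
          4 * (t : ℂ) / ((x + y : ℝ) : ℂ) * (gauss t (x + y) : ℂ) * (H e e' + r t) := by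
    intro e e' x y hx hy hs
    -- The error is the matrix entry of the scalar remainder evaluated on H. Since the remainder is
    -- defined as an exact quotient, the formula holds for every t > 0 and only its size concerns t
    -- ↓ 0.
    refine ⟨fun t => ∑ k, U e k * (hRemainder (x + y) (d k) t : ℂ) * V k e', ?_, ?_⟩
    · refine IsBigO.fun_sum fun k _ => ?_
      refine (IsBigO.const_mul_left (f := fun t => (hRemainder (x + y) (d k) t : ℂ))
        (Complex.isBigO_ofReal_left.2 (hRemainder_isBigO hs (d k))) (U e k * V k e')).congr_left
        fun t => by ring
    · intro t ht
      have hHe : H e e' = ∑ k, U e k * (d k : ℂ) * V k e' := by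
        conv_lhs => rw [hHd, Matrix.mul_apply]
        simp [Matrix.mul_diagonal]
      rw [hformula t ht e e' x y hx hy, hh, sub_eq_add_neg, ← Finset.sum_neg_distrib, hHe,
        ← Finset.sum_add_distrib, Finset.mul_sum]
      congr 1
      refine Finset.sum_congr rfl fun k _ => ?_
      have h := congrArg (fun a : ℝ => (a : ℂ)) (neg_hFun_eq hs ht (d k))
      push_cast at h ⊢
      linear_combination U e k * V k e' * h
  refine ⟨hformula, hasymp, fun e e' x y hx hy hs hne => ?_⟩
  obtain ⟨r, hr, hr'⟩ := hasymp e e' x y hx hy hs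
  refine ⟨fun t => (H e e')⁻¹ * r t, hr.const_mul_left _, fun t ht => ?_⟩
  rw [hr' t ht]
  have hs' : ((x + y : ℝ) : ℂ) ≠ 0 := Complex.ofReal_ne_zero.2 hs.ne'
  field_simp
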